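/- Let $n\ge 1$ and $f(v)=|v|^{4/n}v\,e^{v^2}$, and consider $$\partial_t u=\Delta u+f(u)\ \ (t>0,\ x\in\mathbb R^n),\qquad u(0,\cdot)=\varphi. \tag{1}$$ Let $\exp L^2$ be the space of $v\in L^1_{loc}(\mathbb R^n)$ with $\int_{\mathbb R^n}(e^{(|v|/\lambda)^2}-1)\,dx<\infty$ for some $\lambda>0$, with norm $\|v\|_{\exp L^2}=\inf\{\lambda>0:\int_{\mathbb R^n}(e^{(|v|/\lambda)^2}-1)\,dx\le 1\}$, and put $\|v\|_{\exp L^2\cap L^p}=\max\{\|v\|_{\exp L^2},\|v\|_{L^p}\}$. A solution of (1) is a $u\in L^\infty(0,\infty;\exp L^2)\cap C((0,\infty);\exp L^2)$ with $u(t)=e^{t\Delta}\varphi+\int_0^t e^{(t-s)\Delta}f(u(s))\,ds$ for all $t>0$, where $e^{t\Delta}$ is convolution with $(4\pi t)^{-n/2}e^{-|x|^2/(4t)}$, and $u(t)\to\varphi$ as $t\to0^+$ in the weak-$*$ topology of $\exp L^2$, that is, $\int_{\mathbb R^n}(u(t)-\varphi)\psi\,dx\to0$ for every $\psi$ in the predual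 of $\exp L^2$, the Orlicz space defined by the complementary function $\tilde A(s)=\sup_{t\ge0}(st-A(t))$ of $A(t)=e^{t^2}-1$. **Theorem.** There are constants $\delta>0$ and $C>0$ depending only on $n$, and constants $C'_q$ depending only on $n$ and $q$, such that the following holds. Let $p\in[1,2)$, let $\varphi\in\exp L^2\cap L^p$ with $\varphi\ge0$, and assume that (1) has a unique positive (that is, a.e. nonnegative) solution $u$ satisfying $\sup_{t>0}\|u(t)\|_{\exp L^2}\le 2\|\varphi\|_{\exp L^2}$. If $$\max\{\|\varphi\|_{\exp L^2},\|\varphi\|_{L^p}\}<\delta,$$ then 1. for all $q\in[p,\infty]$ and $t>0$, $$\|u(t)\|_{L^q}\le C\,t^{-\frac n2\left(\frac1p-\frac1q\right)}\|\varphi\|_{\exp L^2\cap L^p};$$ 2. for all $q\in[p,\infty)$ and $t>0$, $$\|u(t)\|_{L^q}\le C'_q\,(1+t)^{-\frac n2\left(\frac1p-\frac1q\right)}\|\varphi\|_{\exp L^2\cap L^p};$$ 3. if $p\in(1,2)$, then for all $q\in[p,\infty]$, $$\|u(t)\|_{L^q}=o\!\left(t^{-\frac n2\left(\frac1p-\frac1q\right)}\right),\qquad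 t\to\infty.$$ -/

import Mathlib

open MeasureTheory Filter Topology Asymptotics
open scoped ENNReal

noncomputable section

namespace ExpHeat

/-- The space `ℝⁿ` with its Euclidean norm and Lebesgue measure. -/
abbrev Rn (n : ℕ) : Type := EuclideanSpace ℝ (Fin n)

/-- The nonlinearity `f(u) = |u|^{4/n} u e^{u²}`. -/
def nonlin (n : ℕ) (v : ℝ) : ℝ := |v| ^ ((4 : ℝ) / n) * v * Real.exp (v ^ 2)

/-- The integral of `exp((|v(x)|/lam)²) - 1` over `ℝⁿ`. The integrand is nonnegative. -/
def expModular {n : ℕ} (lam : ℝ) (v : Rn n → ℝ) : ℝ≥0∞ :=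
  ∫⁻ x, ENNReal.ofReal (Real.exp ((|v x| / lam) ^ 2) - 1)

/-- Membership in the Orlicz space `exp L²(ℝⁿ)`. -/
def MemExpL2 {n : ℕ} (v : Rn n → ℝ) : Prop :=
  LocallyIntegrable v volume ∧ ∃ lam : ℝ, 0 < lam ∧ expModular lam v < ∞

/-- The Luxemburg norm of `exp L²`, with values in `[0, ∞]`. -/
def expL2Norm {n : ℕ} (v : Rn n → ℝ) : ℝ≥0∞ :=
  ⨅ (lam : ℝ) (_ : 0 < lam) (_ : expModular lam v ≤ 1), ENNReal.ofReal lam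

/-- The complementary function `Ã(s) = sup_{t ≥ 0} (s t - A(t))` of `A(t) = e^{t²} - 1`.
Truncation at zero is harmless: `t = 0` contributes the value `0` to the supremum. -/
def complA (s : ℝ) : ℝ≥0∞ :=
  ⨆ (t : ℝ) (_ : 0 ≤ t), ENNReal.ofReal (s * t - (Real.exp (t ^ 2) - 1))

/-- Membership in the predual of `exp L²`: the Orlicz space of the complementary function `Ã`. -/
def MemPredual {n : ℕ} (ψ : Rn n → ℝ) : Prop :=
  LocallyIntegrable ψ volume ∧ ∃ lam : ℝ, 0 < lam ∧ ∫⁻ x, complA (|ψ x| / lam) < ∞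

/-- The heat kernel `(4πt)^{-n/2} exp(-|x|²/(4t))`. -/
def heatKernel (n : ℕ) (t : ℝ) (x : Rn n) : ℝ :=
  (4 * Real.pi * t) ^ (-((n : ℝ) / 2)) * Real.exp (-(‖x‖ ^ 2 / (4 * t)))

/-- The heat semigroup `(e^{tΔ} v)(x) = ∫ G(t, x - y) v(y) dy`, for `t > 0`. -/
def heat {n : ℕ} (t : ℝ) (v : Rn n → ℝ) (x : Rn n) : ℝ :=
  ∫ y, heatKernel n t (x - y) * v y

/-- `u` is a solution, that is, a mild solution in `(0, ∞) × ℝⁿ`, of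
`∂ₜ u = Δ u + |u|^{4/n} u e^{u²}`, `u(0) = φ`.  Only the values `u t` with `t > 0` matter, and
each `u t` only up to a null set. -/
structure IsMildSolution {n : ℕ} (φ : Rn n → ℝ) (u : ℝ → Rn n → ℝ) : Prop where
  /-- `u(t) ∈ exp L²` for every `t > 0`. -/
  mem : ∀ t : ℝ, 0 < t → MemExpL2 (u t)
  /-- `u ∈ L^∞(0, ∞; exp L²)`; as `u` is continuous in time, the essential supremum over `t` is
  the supremum. -/
  bounded : ∃ M : ℝ, ∀ t : ℝ, 0 < t → expL2Norm (u t) ≤ ENNReal.ofReal M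
  /-- `u ∈ C((0, ∞); exp L²)`. -/
  continuous : ∀ t : ℝ, 0 < t →
    Tendsto (fun s : ℝ => expL2Norm (fun x => u s x - u t x)) (𝓝 t) (𝓝 0)
  /-- `u(t) = e^{tΔ} φ + ∫₀ᵗ e^{(t-s)Δ} f(u(s)) ds`, all integrals being convergent. -/
  duhamel : ∀ t : ℝ, 0 < t → ∀ᵐ x : Rn n,
    (∀ᵐ s ∂(volume.restrict (Set.Ioo 0 t)),
      Integrable (fun y => heatKernel n (t - s) (x - y) * nonlin n (u s y)) volume) ∧
    IntegrableOn (fun s => heat (t - s) (fun y => nonlin n (u s y)) x) (Set.Ioo 0 t) volume ∧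
    u t x = heat t φ x + ∫ s in Set.Ioo 0 t, heat (t - s) (fun y => nonlin n (u s y)) x
  /-- `u(t) → φ` in the weak-* topology of `exp L²` as `t → 0`. -/
  initial : ∀ ψ : Rn n → ℝ, MemPredual ψ →
    Tendsto (fun t : ℝ => ∫ x, (u t x * ψ x - φ x * ψ x)) (𝓝[>] 0) (𝓝 0)

/-- `u` is a positive solution with `sup_{t>0} ‖u(t)‖_{exp L²} ≤ 2 ‖φ‖_{exp L²}`. -/
structure IsPositiveSmallSolution {n : ℕ} (φ : Rn n → ℝ) (u : ℝ → Rn n → ℝ) : Prop where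
  solution : IsMildSolution φ u
  nonneg : ∀ t : ℝ, 0 < t → ∀ᵐ x : Rn n, 0 ≤ u t x
  bound : ∀ t : ℝ, 0 < t → expL2Norm (u t) ≤ 2 * expL2Norm φ

/-- `u` is the unique positive solution with `sup_{t>0} ‖u(t)‖_{exp L²} ≤ 2 ‖φ‖_{exp L²}`. -/
structure IsUniquePositiveSmallSolution {n : ℕ} (φ : Rn n → ℝ) (u : ℝ → Rn n → ℝ) : Prop where
  positive : IsPositiveSmallSolution φ u
  unique : ∀ v : ℝ → Rn n → ℝ, IsPositiveSmallSolution φ v → ∀ t : ℝ, 0 < t → v t =ᵐ[volume] u t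

/-- The norm of the intersection `exp L² ∩ Lᵖ`. -/
def interNorm {n : ℕ} (p : ℝ) (v : Rn n → ℝ) : ℝ≥0∞ :=
  max (expL2Norm v) (eLpNorm v (ENNReal.ofReal p) volume)

/-- The decay exponent `(n/2)(1/p - 1/q)`, where `1/∞ = 0`. -/
def decayExp (n : ℕ) (p : ℝ) (q : ℝ≥0∞) : ℝ := (n : ℝ) / 2 * (1 / p - (q⁻¹).toReal)

end ExpHeat

end

/-!
The proof is a set of a priori estimates on the given solution, carried out for `[0, ∞]`-valued
functions, so that Tonelli's theorem applies throughout. The solution is only given at each time up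
to null sets; its continuity in time yields a jointly measurable version
(`exists_measurable_version`), for which the integral equation reads
`U(t) = e^{tΔ} Φ + ∫₀ᵗ e^{(t-s)Δ} (V U)(s) ds` with the potential `V = U^{4/n} e^{U²} ≥ 0`
(`exists_smallMild`).

Lebesgue norms are indexed by the inverse exponent `θ = 1/p`. Put `d = 1/(n+2)` and
`b = n d / 2 = 1/2 - d`. The power `4/n` is the one for which `L²` is scale invariant, and the
argument is Kato's: the quantity `t^b ‖u(t)‖_{L^{1/b}}` is scale invariant, vanishes at `t = 0`, and
stays below `4ε` for all times by a first-exit argument (`SmallMild.kato_le`). The exponential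
factor is harmless: for `t ≤ 1` the Lebesgue norms of `V` in use are controlled by the `exp L²`
norm, and for `t ≥ 1` smoothing over a time interval of length `1/2` bounds `u` in `L^∞`, whence
`V ≤ 2 u^{4/n}`. Thus `‖V(s)‖_{L^{(n+2)/2}} ≤ C ε^{4/n} s^{-2/(n+2)}`.

With `V` frozen the equation is linear with a nonnegative kernel. The Duhamel operator contracts the
norms `sup_t t^b ‖·‖_{L^{1/(θ-d)}}` for `1/2 ≤ θ ≤ 1 - d`, with constants depending only on `n`
(`SmallMild.critical_contraction`). Since it also contracts the norm in which `u` is known to be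
finite, `u` is the sum of its Neumann series and inherits the bounds of `e^{tΔ} Φ`
(`volterra_bound`); no finiteness of `‖u(t)‖_{L^p}` has to be known beforehand. The critical
estimate places the source in `L^{1/(θ+d)}`, which requires `θ ≤ 1 - d` and excludes `p` near `1`.
For such `p` the data also lie in `L^{3/2}`, so that `u` already decays at the rate
of `L^{3/2}` data and `V` is integrable in time at infinity, which gives the contraction for all
`θ ≤ 1` (`SmallMild.supercritical_contraction`). A restart at time `t / 2` turns the `L^p` bound
into decay of the supremum norm (`SmallMild.sup_decay`), and interpolation gives all `q`.

For `p > 1` the strict decay follows from a restart at a large time `τ`: the linear part tends to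
zero in `L^p`, and the nonlinear part is at most a constant times `∫_τ^∞ s^{-2/p} ds`, which is
small because `p < 2`.
-/

namespace ExpHeat

/-! ### Lebesgue norms indexed by the inverse exponent -/


/-- The `L^{1/θ}` norm of a `[0, ∞]`-valued function, indexed by the inverse exponent `θ > 0`.
With this indexing Hölder's inequality and the smoothing exponents of the heat semigroup are
affine in the index. -/
noncomputable def invNorm {α : Type*} [MeasureSpace α] (θ : ℝ) (f : α → ℝ≥0∞) : ℝ≥0∞ :=
  (∫⁻ x, f x ^ (1 / θ)) ^ θ

section InvNorm

variable {α : Type*} [MeasureSpace α]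

theorem invNorm_mono_ae {θ : ℝ} (hθ : 0 < θ) {f g : α → ℝ≥0∞}
    (h : ∀ᵐ x, f x ≤ g x) : invNorm θ f ≤ invNorm θ g := by
  unfold invNorm
  refine ENNReal.rpow_le_rpow (lintegral_mono_ae ?_) hθ.le
  filter_upwards [h] with x hx
  exact ENNReal.rpow_le_rpow hx (by positivity)

theorem invNorm_congr_ae {θ : ℝ} {f g : α → ℝ≥0∞} (h : ∀ᵐ x, f x = g x) :
    invNorm θ f = invNorm θ g := by
  unfold invNorm
  congr 1
  refine lintegral_congr_ae ?_
  filter_upwards [h] with x hx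
  rw [hx]

theorem invNorm_rpow_inv {θ : ℝ} (hθ : 0 < θ) (f : α → ℝ≥0∞) :
    invNorm θ f ^ (1 / θ) = ∫⁻ x, f x ^ (1 / θ) := by
  unfold invNorm
  rw [← ENNReal.rpow_mul, mul_one_div_cancel hθ.ne', ENNReal.rpow_one]

theorem invNorm_add_le {θ : ℝ} (hθ : 0 < θ) (hθ1 : θ ≤ 1) {f g : α → ℝ≥0∞}
    (hf : AEMeasurable f) (hg : AEMeasurable g) :
    invNorm θ (fun x => f x + g x) ≤ invNorm θ f + invNorm θ g := by
  have h := ENNReal.lintegral_Lp_add_le (p := 1 / θ) hf hg ((one_le_div hθ).2 hθ1)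
  simpa [invNorm] using h

theorem invNorm_const_mul {θ : ℝ} (hθ : 0 < θ) (c : ℝ≥0∞) {f : α → ℝ≥0∞}
    (hf : AEMeasurable f) :
    invNorm θ (fun x => c * f x) = c * invNorm θ f := by
  unfold invNorm
  have : ∀ x, (c * f x) ^ (1 / θ) = c ^ (1 / θ) * f x ^ (1 / θ) := fun x =>
    ENNReal.mul_rpow_of_nonneg _ _ (by positivity)
  simp_rw [this]
  rw [lintegral_const_mul'' _ (hf.pow_const _), ENNReal.mul_rpow_of_nonneg _ _ hθ.le,
    ← ENNReal.rpow_mul, one_div_mul_cancel hθ.ne', ENNReal.rpow_one]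

theorem invNorm_rpow {θ a : ℝ} (ha : 0 < a) (f : α → ℝ≥0∞) :
    invNorm θ (fun x => f x ^ a) = invNorm (θ / a) f ^ a := by
  unfold invNorm
  rw [← ENNReal.rpow_mul, div_mul_cancel₀ _ ha.ne']
  congr 1
  refine lintegral_congr fun x => ?_
  rw [← ENNReal.rpow_mul]
  congr 1
  rw [one_div_div]; ring

theorem invNorm_mul_le {θ₁ θ₂ : ℝ} (h₁ : 0 < θ₁) (h₂ : 0 < θ₂) {f g : α → ℝ≥0∞}
    (hf : AEMeasurable f) (hg : AEMeasurable g) :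
    invNorm (θ₁ + θ₂) (fun x => f x * g x) ≤ invNorm θ₁ f * invNorm θ₂ g := by
  unfold invNorm
  have hs : 0 < θ₁ + θ₂ := by positivity
  have key := ENNReal.lintegral_mul_norm_pow_le (μ := (volume : Measure α))
    (hf.pow_const (1 / θ₁)) (hg.pow_const (1 / θ₂))
    (p := θ₁ / (θ₁ + θ₂)) (q := θ₂ / (θ₁ + θ₂)) (by positivity) (by positivity)
    (by field_simp)
  have e : ∀ x, (f x ^ (1 / θ₁)) ^ (θ₁ / (θ₁ + θ₂)) * (g x ^ (1 / θ₂)) ^ (θ₂ / (θ₁ + θ₂)) =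
      (f x * g x) ^ (1 / (θ₁ + θ₂)) := by
    intro x
    rw [← ENNReal.rpow_mul, ← ENNReal.rpow_mul, ENNReal.mul_rpow_of_nonneg _ _ (by positivity)]
    congr 2 <;> field_simp
  simp_rw [e] at key
  refine (ENNReal.rpow_le_rpow key hs.le).trans (le_of_eq ?_)
  rw [ENNReal.mul_rpow_of_nonneg _ _ hs.le, ← ENNReal.rpow_mul, ← ENNReal.rpow_mul,
    div_mul_cancel₀ _ hs.ne', div_mul_cancel₀ _ hs.ne']

/-- Jensen's inequality for a weight `k`, with the total mass of `k` kept. -/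
theorem lintegral_mul_le_rpow {β : Type*} [MeasurableSpace β] {μ : Measure β} {θ : ℝ}
    (hθ : 0 < θ) (hθ1 : θ ≤ 1) {k f : β → ℝ≥0∞}
    (hk : AEMeasurable k μ) (hf : AEMeasurable f μ) :
    ∫⁻ y, k y * f y ∂μ ≤
      (∫⁻ y, k y * f y ^ (1 / θ) ∂μ) ^ θ * (∫⁻ y, k y ∂μ) ^ (1 - θ) := by
  have key := ENNReal.lintegral_mul_norm_pow_le (μ := μ)
    (hk.mul (hf.pow_const (1 / θ))) hk (p := θ) (q := 1 - θ) hθ.le (by linarith) (by ring)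
  refine le_trans (le_of_eq (lintegral_congr fun y => ?_)) key
  simp only [Pi.mul_apply]
  rw [ENNReal.mul_rpow_of_nonneg _ _ hθ.le, ← ENNReal.rpow_mul, one_div_mul_cancel hθ.ne',
    ENNReal.rpow_one, mul_right_comm, ← ENNReal.rpow_add_of_nonneg _ _ hθ.le (by linarith)]
  simp

/-- Minkowski's integral inequality, for explicit bounds on the integrand. -/
theorem invNorm_lintegral_le {β : Type*} [MeasurableSpace β] {μ : Measure β} [SFinite μ]
    [SFinite (volume : Measure α)]
    {θ : ℝ} (hθ : 0 < θ) (hθ1 : θ ≤ 1) {w : β → α → ℝ≥0∞}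
    (hw : Measurable (Function.uncurry w)) {a : β → ℝ≥0∞} (ha : Measurable a)
    (ha0 : ∀ᵐ s ∂μ, a s ≠ 0) (hat : ∀ᵐ s ∂μ, a s ≠ ∞)
    (h : ∀ᵐ s ∂μ, invNorm θ (w s) ≤ a s) :
    invNorm θ (fun x => ∫⁻ s, w s x ∂μ) ≤ ∫⁻ s, a s ∂μ := by
  have hi : 0 < 1 / θ := by positivity
  have hws : ∀ x, Measurable fun s => w s x := fun x =>
    hw.comp (measurable_id.prodMk measurable_const)
  have h1 : ∀ x, (∫⁻ s, w s x ∂μ) ^ (1 / θ) ≤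
      (∫⁻ s, a s * (w s x / a s) ^ (1 / θ) ∂μ) * (∫⁻ s, a s ∂μ) ^ ((1 - θ) * (1 / θ)) := by
    intro x
    have h2 := lintegral_mul_le_rpow (μ := μ) hθ hθ1 ha.aemeasurable
      ((hws x).div ha).aemeasurable
    have h3 : ∫⁻ s, w s x ∂μ = ∫⁻ s, a s * (w s x / a s) ∂μ := by
      refine lintegral_congr_ae ?_
      filter_upwards [ha0, hat] with s h0 ht
      rw [ENNReal.mul_div_cancel h0 ht]
    rw [h3]
    refine (ENNReal.rpow_le_rpow h2 hi.le).trans (le_of_eq ?_)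
    rw [ENNReal.mul_rpow_of_nonneg _ _ hi.le, ← ENNReal.rpow_mul, ← ENNReal.rpow_mul,
      mul_one_div_cancel hθ.ne', ENNReal.rpow_one]
    rfl
  have hmeas : Measurable (Function.uncurry fun (x : α) (s : β) =>
      a s * (w s x / a s) ^ (1 / θ)) := by
    have hw' : Measurable fun p : α × β => w p.2 p.1 := hw.comp measurable_swap
    have ha' : Measurable fun p : α × β => a p.2 := ha.comp measurable_snd
    exact ha'.mul ((hw'.div ha').pow_const _)
  have h4 : ∫⁻ x, ∫⁻ s, a s * (w s x / a s) ^ (1 / θ) ∂μ ≤ ∫⁻ s, a s ∂μ := by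
    rw [lintegral_lintegral_swap hmeas.aemeasurable]
    refine lintegral_mono_ae ?_
    filter_upwards [ha0, hat, h] with s h0 ht hs
    have e : ∀ x, a s * (w s x / a s) ^ (1 / θ) =
        (a s * (a s)⁻¹ ^ (1 / θ)) * (w s x) ^ (1 / θ) := by
      intro x
      rw [div_eq_mul_inv, ENNReal.mul_rpow_of_nonneg _ _ hi.le]; ring
    simp_rw [e]
    have hwx : Measurable (w s) := hw.comp (measurable_const.prodMk measurable_id)
    rw [lintegral_const_mul _ (hwx.pow_const _), ← invNorm_rpow_inv hθ]
    calc a s * (a s)⁻¹ ^ (1 / θ) * invNorm θ (w s) ^ (1 / θ)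
        ≤ a s * (a s)⁻¹ ^ (1 / θ) * (a s) ^ (1 / θ) := by gcongr
      _ = a s := by
        rw [mul_assoc, ← ENNReal.mul_rpow_of_nonneg _ _ hi.le, ENNReal.inv_mul_cancel h0 ht]
        simp
  have hm2 : Measurable fun x : α => ∫⁻ s, a s * (w s x / a s) ^ (1 / θ) ∂μ :=
    hmeas.lintegral_prod_right'
  unfold invNorm
  calc (∫⁻ x, (∫⁻ s, w s x ∂μ) ^ (1 / θ)) ^ θ
      ≤ (∫⁻ x, (∫⁻ s, a s * (w s x / a s) ^ (1 / θ) ∂μ) *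
          (∫⁻ s, a s ∂μ) ^ ((1 - θ) * (1 / θ))) ^ θ :=
        ENNReal.rpow_le_rpow (lintegral_mono h1) hθ.le
    _ ≤ ((∫⁻ s, a s ∂μ) * (∫⁻ s, a s ∂μ) ^ ((1 - θ) * (1 / θ))) ^ θ := by
        rw [lintegral_mul_const _ hm2]
        gcongr
    _ = ∫⁻ s, a s ∂μ := by
        rw [ENNReal.mul_rpow_of_nonneg _ _ hθ.le, ← ENNReal.rpow_mul, mul_assoc,
          one_div_mul_cancel hθ.ne', mul_one, ← ENNReal.rpow_add_of_nonneg _ _ hθ.le (by linarith)]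
        simp

/-- Interpolation between `L^{1/θ}` and a pointwise bound. -/
theorem invNorm_le_of_le_const {θ θ' : ℝ} (hθ' : 0 < θ') (h : θ' ≤ θ) {f : α → ℝ≥0∞}
    {A : ℝ≥0∞} (hA : ∀ᵐ x, f x ≤ A) (hf : AEMeasurable f) :
    invNorm θ' f ≤ A ^ (1 - θ' / θ) * invNorm θ f ^ (θ' / θ) := by
  have hθ : 0 < θ := hθ'.trans_le h
  have e0 : 0 ≤ 1 / θ' - 1 / θ := sub_nonneg.2 (one_div_le_one_div_of_le hθ' h)
  have h1 : ∫⁻ x, f x ^ (1 / θ') ≤ A ^ (1 / θ' - 1 / θ) * ∫⁻ x, f x ^ (1 / θ) := by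
    rw [← lintegral_const_mul'' _ (hf.pow_const _)]
    refine lintegral_mono_ae ?_
    filter_upwards [hA] with x hx
    calc f x ^ (1 / θ') = f x ^ (1 / θ' - 1 / θ) * f x ^ (1 / θ) := by
          rw [← ENNReal.rpow_add_of_nonneg _ _ e0 (by positivity)]; congr 1; ring
      _ ≤ _ := by gcongr
  unfold invNorm
  refine (ENNReal.rpow_le_rpow h1 hθ'.le).trans (le_of_eq ?_)
  rw [ENNReal.mul_rpow_of_nonneg _ _ hθ'.le, ← ENNReal.rpow_mul, ← ENNReal.rpow_mul]
  congr 2 <;> field_simp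

end InvNorm

/-! ### The heat semigroup on nonnegative functions -/

/-- The heat semigroup acting on `[0, ∞]`-valued functions, as a Lebesgue integral. -/
noncomputable def heatOp {n : ℕ} (t : ℝ) (f : Rn n → ℝ≥0∞) (x : Rn n) : ℝ≥0∞ :=
  ∫⁻ y, ENNReal.ofReal (heatKernel n t (x - y)) * f y

section HeatKernel

variable {n : ℕ}

theorem heatKernel_nonneg {t : ℝ} (ht : 0 ≤ t) (x : Rn n) : 0 ≤ heatKernel n t x := by
  unfold heatKernel; positivity

theorem heatKernel_le {t : ℝ} (ht : 0 < t) (x : Rn n) :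
    heatKernel n t x ≤ t ^ (-((n : ℝ) / 2)) := by
  unfold heatKernel
  have h1 : Real.exp (-(‖x‖ ^ 2 / (4 * t))) ≤ 1 := by
    rw [Real.exp_le_one_iff]
    have : 0 ≤ ‖x‖ ^ 2 / (4 * t) := by positivity
    linarith
  have h2 : (4 * Real.pi * t) ^ (-((n : ℝ) / 2)) ≤ t ^ (-((n : ℝ) / 2)) := by
    refine Real.rpow_le_rpow_of_nonpos ht ?_ (by simp; positivity)
    nlinarith [Real.pi_gt_three]
  calc _ ≤ (4 * Real.pi * t) ^ (-((n : ℝ) / 2)) * 1 := by gcongr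
    _ ≤ _ := by rw [mul_one]; exact h2

theorem heatKernel_sub_comm (t : ℝ) (x y : Rn n) :
    heatKernel n t (x - y) = heatKernel n t (y - x) := by
  unfold heatKernel; rw [norm_sub_rev]

theorem measurable_heatKernel : Measurable fun p : ℝ × Rn n => heatKernel n p.1 p.2 := by
  unfold heatKernel
  fun_prop

theorem lintegral_exp_neg_mul_sq {k : ℝ} (hk : 0 < k) (c : Rn n) :
    ∫⁻ y : Rn n, ENNReal.ofReal (Real.exp (-k * ‖y - c‖ ^ 2)) =
      ENNReal.ofReal ((Real.pi / k) ^ ((n : ℝ) / 2)) := by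
  rw [lintegral_sub_right_eq_self (fun y : Rn n => ENNReal.ofReal (Real.exp (-k * ‖y‖ ^ 2))) c]
  have h := GaussianFourier.integral_rexp_neg_mul_sq_norm (V := Rn n) hk
  rw [finrank_euclideanSpace_fin] at h
  rw [← h, ofReal_integral_eq_lintegral_ofReal]
  · by_contra hni
    rw [integral_undef hni] at h
    have : 0 < (Real.pi / k) ^ ((n : ℝ) / 2) := by positivity
    linarith
  · exact Eventually.of_forall fun y => (Real.exp_pos _).le

/-- The Chapman–Kolmogorov identity for the heat kernel. -/
theorem lintegral_heatKernel_mul {a b : ℝ} (ha : 0 < a) (hb : 0 < b) (x z : Rn n) :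
    ∫⁻ y, ENNReal.ofReal (heatKernel n a (x - y)) * ENNReal.ofReal (heatKernel n b (y - z)) =
      ENNReal.ofReal (heatKernel n (a + b) (x - z)) := by
  set c : Rn n := (b / (a + b)) • x + (a / (a + b)) • z with hc
  set k : ℝ := (a + b) / (4 * a * b) with hk
  have hab : 0 < a + b := by positivity
  have hk0 : 0 < k := by positivity
  have hsq : ∀ y : Rn n, ‖x - y‖ ^ 2 / (4 * a) + ‖y - z‖ ^ 2 / (4 * b) =
      ‖x - z‖ ^ 2 / (4 * (a + b)) + k * ‖y - c‖ ^ 2 := by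
    intro y
    have e1 : y - c = (b / (a + b)) • (y - x) + (a / (a + b)) • (y - z) := by
      have h1 : (b / (a + b)) + (a / (a + b)) = 1 := by field_simp; ring
      have h2 : y = ((b / (a + b)) + (a / (a + b))) • y := by rw [h1, one_smul]
      conv_lhs => rw [h2]
      rw [hc]; module
    have e2 : x - z = (y - z) - (y - x) := by abel
    rw [e1, e2, norm_sub_rev x y, norm_add_sq_real, norm_sub_sq_real (y - z) (y - x),
      norm_smul, norm_smul, real_inner_smul_left, real_inner_smul_right, Real.norm_eq_abs, Real.norm_eq_abs, mul_pow,
      mul_pow, sq_abs, sq_abs, real_inner_comm (y - x) (y - z), hk]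
    field_simp
    ring
  have hprod : ∀ y, ENNReal.ofReal (heatKernel n a (x - y)) *
      ENNReal.ofReal (heatKernel n b (y - z)) =
      ENNReal.ofReal ((4 * Real.pi * a) ^ (-((n : ℝ) / 2)) * (4 * Real.pi * b) ^ (-((n : ℝ) / 2)) *
        Real.exp (-(‖x - z‖ ^ 2 / (4 * (a + b))))) *
      ENNReal.ofReal (Real.exp (-k * ‖y - c‖ ^ 2)) := by
    intro y
    rw [← ENNReal.ofReal_mul (heatKernel_nonneg ha.le _), ← ENNReal.ofReal_mul (by positivity)]
    congr 1
    unfold heatKernel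
    have : Real.exp (-(‖x - y‖ ^ 2 / (4 * a))) * Real.exp (-(‖y - z‖ ^ 2 / (4 * b))) =
        Real.exp (-(‖x - z‖ ^ 2 / (4 * (a + b)))) * Real.exp (-k * ‖y - c‖ ^ 2) := by
      rw [← Real.exp_add, ← Real.exp_add]
      congr 1
      linarith [hsq y]
    linear_combination ((4 * Real.pi * a) ^ (-((n : ℝ) / 2)) *
      (4 * Real.pi * b) ^ (-((n : ℝ) / 2))) * this
  simp_rw [hprod]
  rw [lintegral_const_mul _ (by fun_prop), lintegral_exp_neg_mul_sq hk0,
    ← ENNReal.ofReal_mul (by positivity)]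
  congr 1
  unfold heatKernel
  rw [mul_right_comm]
  congr 1
  rw [Real.rpow_neg (by positivity), Real.rpow_neg (by positivity), Real.rpow_neg (by positivity),
    ← Real.inv_rpow (by positivity), ← Real.inv_rpow (by positivity),
    ← Real.inv_rpow (by positivity), ← Real.mul_rpow (by positivity) (by positivity),
    ← Real.mul_rpow (by positivity) (by positivity), hk]
  congr 1
  have := Real.pi_pos
  field_simp

theorem lintegral_heatKernel {t : ℝ} (ht : 0 < t) (x : Rn n) :
    ∫⁻ y, ENNReal.ofReal (heatKernel n t (y - x)) = 1 := by
  have hk : 0 < 1 / (4 * t) := by positivity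
  have e : ∀ y : Rn n, ENNReal.ofReal (heatKernel n t (y - x)) =
      ENNReal.ofReal ((4 * Real.pi * t) ^ (-((n : ℝ) / 2))) *
        ENNReal.ofReal (Real.exp (-(1 / (4 * t)) * ‖y - x‖ ^ 2)) := by
    intro y
    rw [← ENNReal.ofReal_mul (by positivity)]
    unfold heatKernel
    congr 3
    ring
  simp_rw [e]
  rw [lintegral_const_mul _ (by fun_prop), lintegral_exp_neg_mul_sq hk,
    ← ENNReal.ofReal_mul (by positivity), Real.rpow_neg (by positivity)]
  have : Real.pi / (1 / (4 * t)) = 4 * Real.pi * t := by field_simp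
  rw [this, inv_mul_cancel₀ (by positivity), ENNReal.ofReal_one]

theorem lintegral_heatKernel' {t : ℝ} (ht : 0 < t) (x : Rn n) :
    ∫⁻ y, ENNReal.ofReal (heatKernel n t (x - y)) = 1 := by
  simp_rw [heatKernel_sub_comm t x]
  exact lintegral_heatKernel ht x

end HeatKernel

section HeatOp

variable {n : ℕ}

theorem measurable_heatKernel_sub (t : ℝ) :
    Measurable fun p : Rn n × Rn n => ENNReal.ofReal (heatKernel n t (p.1 - p.2)) :=
  (measurable_heatKernel.comp
    (measurable_const.prodMk (measurable_fst.sub measurable_snd))).ennreal_ofReal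

theorem measurable_heatKernel_right (t : ℝ) (x : Rn n) :
    Measurable fun y : Rn n => ENNReal.ofReal (heatKernel n t (x - y)) := by
  unfold heatKernel
  fun_prop

theorem measurable_heatKernel_left (t : ℝ) (y : Rn n) :
    Measurable fun x : Rn n => ENNReal.ofReal (heatKernel n t (x - y)) := by
  unfold heatKernel
  fun_prop

theorem measurable_heatOp (t : ℝ) {f : Rn n → ℝ≥0∞} (hf : Measurable f) :
    Measurable (heatOp t f) := by
  have : Measurable fun p : Rn n × Rn n => ENNReal.ofReal (heatKernel n t (p.1 - p.2)) * f p.2 :=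
    (measurable_heatKernel_sub t).mul (hf.comp measurable_snd)
  exact this.lintegral_prod_right'

theorem heatOp_congr_ae (t : ℝ) {f g : Rn n → ℝ≥0∞} (h : ∀ᵐ x, f x = g x) (x : Rn n) :
    heatOp t f x = heatOp t g x := by
  refine lintegral_congr_ae ?_
  filter_upwards [h] with y hy
  rw [hy]

theorem heatOp_mono_ae (t : ℝ) {f g : Rn n → ℝ≥0∞} (h : ∀ᵐ x, f x ≤ g x) (x : Rn n) :
    heatOp t f x ≤ heatOp t g x := by
  refine lintegral_mono_ae ?_
  filter_upwards [h] with y hy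
  gcongr

theorem heatOp_add (t : ℝ) {f g : Rn n → ℝ≥0∞} (hf : Measurable f) (x : Rn n) :
    heatOp t (fun y => f y + g y) x = heatOp t f x + heatOp t g x := by
  unfold heatOp
  simp_rw [mul_add]
  exact lintegral_add_left ((measurable_heatKernel_right t x).mul hf) _

theorem lintegral_heatOp {t : ℝ} (ht : 0 < t) {f : Rn n → ℝ≥0∞} (hf : Measurable f) :
    ∫⁻ x, heatOp t f x = ∫⁻ x, f x := by
  unfold heatOp
  rw [lintegral_lintegral_swap]
  · refine lintegral_congr fun y => ?_
    rw [lintegral_mul_const _ (measurable_heatKernel_left t y), lintegral_heatKernel ht, one_mul]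
  · exact ((measurable_heatKernel_sub t).mul (hf.comp measurable_snd)).aemeasurable

/-- Jensen's inequality for the heat kernel. -/
theorem heatOp_rpow_le {t : ℝ} (ht : 0 < t) {θ : ℝ} (hθ : 0 < θ) (hθ1 : θ ≤ 1)
    {f : Rn n → ℝ≥0∞} (hf : Measurable f) (x : Rn n) :
    heatOp t f x ^ (1 / θ) ≤ heatOp t (fun y => f y ^ (1 / θ)) x := by
  have h := lintegral_mul_le_rpow (μ := (volume : Measure (Rn n))) hθ hθ1
    (measurable_heatKernel_right t x).aemeasurable hf.aemeasurable
  rw [lintegral_heatKernel' ht, ENNReal.one_rpow, mul_one] at h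
  refine (ENNReal.rpow_le_rpow h (by positivity)).trans (le_of_eq ?_)
  rw [← ENNReal.rpow_mul, mul_one_div_cancel hθ.ne', ENNReal.rpow_one]
  rfl

theorem ofReal_rpow_mul {t : ℝ} (ht : 0 < t) (a b : ℝ) :
    ENNReal.ofReal (t ^ a) ^ b = ENNReal.ofReal (t ^ (a * b)) := by
  rw [ENNReal.ofReal_rpow_of_pos (by positivity), ← Real.rpow_mul ht.le]

/-- The smoothing estimate `L^{1/θ} → L^∞`, valid at every point. -/
theorem heatOp_le {t : ℝ} (ht : 0 < t) {θ : ℝ} (hθ : 0 < θ) (hθ1 : θ ≤ 1)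
    {f : Rn n → ℝ≥0∞} (hf : Measurable f) (x : Rn n) :
    heatOp t f x ≤ ENNReal.ofReal (t ^ (-((n : ℝ) / 2 * θ))) * invNorm θ f := by
  have h1 := heatOp_rpow_le ht hθ hθ1 hf x
  have h2 : heatOp t (fun y => f y ^ (1 / θ)) x ≤
      ENNReal.ofReal (t ^ (-((n : ℝ) / 2))) * ∫⁻ y, f y ^ (1 / θ) := by
    rw [← lintegral_const_mul _ (hf.pow_const _)]
    refine lintegral_mono fun y => ?_
    gcongr
    exact heatKernel_le ht _
  have h3 := ENNReal.rpow_le_rpow (h1.trans h2) hθ.le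
  rw [← ENNReal.rpow_mul, one_div_mul_cancel hθ.ne', ENNReal.rpow_one,
    ENNReal.mul_rpow_of_nonneg _ _ hθ.le, ofReal_rpow_mul ht] at h3
  rw [← neg_mul]
  exact h3

theorem invNorm_heatOp_le_self {t : ℝ} (ht : 0 < t) {θ : ℝ} (hθ : 0 < θ) (hθ1 : θ ≤ 1)
    {f : Rn n → ℝ≥0∞} (hf : Measurable f) :
    invNorm θ (heatOp t f) ≤ invNorm θ f := by
  unfold invNorm
  refine ENNReal.rpow_le_rpow ?_ hθ.le
  refine (lintegral_mono fun x => heatOp_rpow_le ht hθ hθ1 hf x).trans (le_of_eq ?_)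
  exact lintegral_heatOp ht (hf.pow_const _)

/-- The smoothing estimate `L^{1/θ} → L^{1/θ'}`. -/
theorem invNorm_heatOp_le {t : ℝ} (ht : 0 < t) {θ θ' : ℝ} (hθ' : 0 < θ') (h : θ' ≤ θ)
    (hθ1 : θ ≤ 1) {f : Rn n → ℝ≥0∞} (hf : Measurable f) :
    invNorm θ' (heatOp t f) ≤
      ENNReal.ofReal (t ^ (-((n : ℝ) / 2 * (θ - θ')))) * invNorm θ f := by
  have hθ : 0 < θ := hθ'.trans_le h
  have hq : 0 ≤ 1 - θ' / θ := sub_nonneg.2 ((div_le_one hθ).2 h)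
  have h1 := invNorm_le_of_le_const hθ' h
    (Eventually.of_forall fun x => heatOp_le ht hθ hθ1 hf x) (measurable_heatOp t hf).aemeasurable
  refine h1.trans ?_
  calc _ ≤ (ENNReal.ofReal (t ^ (-((n : ℝ) / 2 * θ))) * invNorm θ f) ^ (1 - θ' / θ) *
        invNorm θ f ^ (θ' / θ) := by
        gcongr
        exact invNorm_heatOp_le_self ht hθ hθ1 hf
    _ = _ := by
        rw [ENNReal.mul_rpow_of_nonneg _ _ hq, ofReal_rpow_mul ht, mul_assoc,
          ← ENNReal.rpow_add_of_nonneg _ _ hq (by positivity), sub_add_cancel, ENNReal.rpow_one]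
        congr 3
        field_simp

theorem heatOp_heatOp {a b : ℝ} (ha : 0 < a) (hb : 0 < b) {f : Rn n → ℝ≥0∞}
    (hf : Measurable f) (x : Rn n) :
    heatOp a (heatOp b f) x = heatOp (a + b) f x := by
  unfold heatOp
  have e : ∀ y, ENNReal.ofReal (heatKernel n a (x - y)) *
      ∫⁻ z, ENNReal.ofReal (heatKernel n b (y - z)) * f z =
      ∫⁻ z, ENNReal.ofReal (heatKernel n a (x - y)) *
        ENNReal.ofReal (heatKernel n b (y - z)) * f z := by
    intro y
    have h := lintegral_const_mul (μ := (volume : Measure (Rn n)))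
      (ENNReal.ofReal (heatKernel n a (x - y))) ((measurable_heatKernel_right b y).mul hf)
    simp only [Pi.mul_apply] at h
    simp_rw [mul_assoc]
    exact h.symm
  simp_rw [e]
  rw [lintegral_lintegral_swap]
  · refine lintegral_congr fun z => ?_
    rw [lintegral_mul_const, lintegral_heatKernel_mul ha hb]
    exact (measurable_heatKernel_right a x).mul (measurable_heatKernel_left b z)
  · exact ((((measurable_heatKernel_right a x).comp measurable_fst).mul
      (measurable_heatKernel_sub b)).mul (hf.comp measurable_snd)).aemeasurable

end HeatOp

/-! ### Weakly singular time integrals and the Duhamel integral -/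

section TimeIntegrals

theorem lintegral_Ioo_rpow_neg {a x : ℝ} (ha : a < 1) (hx : 0 ≤ x) :
    ∫⁻ s in Set.Ioo 0 x, ENNReal.ofReal (s ^ (-a)) = ENNReal.ofReal (x ^ (1 - a) / (1 - a)) := by
  have hint : IntegrableOn (fun s : ℝ => s ^ (-a)) (Set.Ioo 0 x) := by
    have h := intervalIntegral.intervalIntegrable_rpow' (a := 0) (b := x) (r := -a) (by linarith)
    rw [intervalIntegrable_iff_integrableOn_Ioo_of_le hx] at h
    exact h
  rw [← ofReal_integral_eq_lintegral_ofReal hint]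
  · congr 1
    rw [← integral_Ioc_eq_integral_Ioo, ← intervalIntegral.integral_of_le hx,
      integral_rpow (Or.inl (by linarith)), Real.zero_rpow (by linarith), sub_zero,
      neg_add_eq_sub]
  · filter_upwards [ae_restrict_mem measurableSet_Ioo] with s hs
    exact Real.rpow_nonneg hs.1.le _

theorem lintegral_Ioo_sub_left (τ t : ℝ) (f : ℝ → ℝ≥0∞) :
    ∫⁻ s in Set.Ioo τ t, f (t - s) = ∫⁻ s in Set.Ioo 0 (t - τ), f s := by
  rw [← lintegral_indicator measurableSet_Ioo, ← lintegral_indicator measurableSet_Ioo,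
    ← lintegral_sub_left_eq_self _ t]
  refine lintegral_congr fun s => ?_
  simp only [Set.indicator, Set.mem_Ioo, sub_sub_cancel]
  congr 1
  apply propext
  constructor <;> rintro ⟨h1, h2⟩ <;> constructor <;> linarith

theorem lintegral_Ioo_sub_rpow_neg {a τ t : ℝ} (ha : a < 1) (h : τ ≤ t) :
    ∫⁻ s in Set.Ioo τ t, ENNReal.ofReal ((t - s) ^ (-a)) =
      ENNReal.ofReal ((t - τ) ^ (1 - a) / (1 - a)) := by
  rw [lintegral_Ioo_sub_left τ t fun s => ENNReal.ofReal (s ^ (-a)),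
    lintegral_Ioo_rpow_neg ha (sub_nonneg.2 h)]

theorem lintegral_Ioo_mul_le {a τ t K : ℝ} (ha : a < 1) (h : τ ≤ t) {ψ : ℝ → ℝ}
    (hψ : ∀ s ∈ Set.Ioo τ t, ψ s ≤ K) :
    ∫⁻ s in Set.Ioo τ t, ENNReal.ofReal ((t - s) ^ (-a) * ψ s) ≤
      ENNReal.ofReal ((t - τ) ^ (1 - a) / (1 - a) * K) := by
  have h1 : ∫⁻ s in Set.Ioo τ t, ENNReal.ofReal ((t - s) ^ (-a) * ψ s) ≤
      ∫⁻ s in Set.Ioo τ t, ENNReal.ofReal ((t - s) ^ (-a)) * ENNReal.ofReal K := by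
    refine setLIntegral_mono' measurableSet_Ioo fun s hs => ?_
    have : 0 ≤ t - s := by linarith [hs.2]
    rw [← ENNReal.ofReal_mul (by positivity)]
    refine ENNReal.ofReal_le_ofReal ?_
    have := hψ s hs
    gcongr
  refine h1.trans (le_of_eq ?_)
  have hm : Measurable fun s : ℝ => ENNReal.ofReal ((t - s) ^ (-a)) := by fun_prop
  have hp : 0 ≤ (t - τ) ^ (1 - a) / (1 - a) :=
    div_nonneg (Real.rpow_nonneg (by linarith) _) (by linarith)
  rw [lintegral_mul_const _ hm, lintegral_Ioo_sub_rpow_neg ha h, ← ENNReal.ofReal_mul hp]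

/-- Weakly singular time integrals: on the first half the kernel is bounded, on the second half
the density is. -/
theorem lintegral_Ioo_zero_mul_le {a t K₁ K₂ : ℝ} (ha0 : 0 ≤ a) (ha : a < 1) (ht : 0 < t)
    {ψ : ℝ → ℝ} (hK₁ : 0 ≤ K₁) (hK₂ : 0 ≤ K₂)
    (h₁ : ∫⁻ s in Set.Ioo 0 (t / 2), ENNReal.ofReal (ψ s) ≤ ENNReal.ofReal K₁)
    (h₂ : ∀ s ∈ Set.Ico (t / 2) t, ψ s ≤ K₂) :
    ∫⁻ s in Set.Ioo 0 t, ENNReal.ofReal ((t - s) ^ (-a) * ψ s) ≤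
      ENNReal.ofReal ((t / 2) ^ (-a) * K₁ + (t / 2) ^ (1 - a) / (1 - a) * K₂) := by
  have hsub : Set.Ioo 0 t ⊆ Set.Ioo 0 (t / 2) ∪ Set.Ico (t / 2) t := by
    intro s hs
    rcases lt_or_ge s (t / 2) with h | h
    · exact Or.inl ⟨hs.1, h⟩
    · exact Or.inr ⟨h, hs.2⟩
  have h1a : 0 < 1 - a := by linarith
  refine (lintegral_mono_set hsub).trans ((lintegral_union_le _ _ _).trans ?_)
  rw [ENNReal.ofReal_add (by positivity) (by positivity)]
  refine add_le_add ?_ ?_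
  · calc ∫⁻ s in Set.Ioo 0 (t / 2), ENNReal.ofReal ((t - s) ^ (-a) * ψ s)
        ≤ ∫⁻ s in Set.Ioo 0 (t / 2), ENNReal.ofReal ((t / 2) ^ (-a)) * ENNReal.ofReal (ψ s) := by
          refine setLIntegral_mono' measurableSet_Ioo fun s hs => ?_
          have h0 : t / 2 ≤ t - s := by linarith [hs.2]
          have h0' : 0 ≤ t - s := by linarith
          rw [ENNReal.ofReal_mul (by positivity)]
          gcongr ?_ * _
          exact ENNReal.ofReal_le_ofReal
            (Real.rpow_le_rpow_of_nonpos (by linarith) h0 (by linarith))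
      _ ≤ ENNReal.ofReal ((t / 2) ^ (-a)) * ENNReal.ofReal K₁ := by
          rw [lintegral_const_mul' _ _ ENNReal.ofReal_ne_top]
          gcongr
      _ = _ := by rw [← ENNReal.ofReal_mul (by positivity)]
  · rw [← setLIntegral_congr (Ioo_ae_eq_Ico (μ := volume) (a := t / 2) (b := t))]
    have h := lintegral_Ioo_mul_le ha (τ := t / 2) (t := t) (by linarith)
      (fun s hs => h₂ s ⟨hs.1.le, hs.2⟩)
    rwa [sub_half] at h

/-- The bound for the Beta-type integral of `(t - s)^{-a} s^{-c}`. -/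
theorem lintegral_Ioo_rpow_mul_rpow_le {a c t : ℝ} (ha0 : 0 ≤ a) (ha : a < 1) (hc0 : 0 ≤ c)
    (hc : c < 1) (ht : 0 < t) :
    ∫⁻ s in Set.Ioo 0 t, ENNReal.ofReal ((t - s) ^ (-a) * s ^ (-c)) ≤
      ENNReal.ofReal ((1 / (1 - c) + 1 / (1 - a)) * (t / 2) ^ (1 - a - c)) := by
  have h1a : 0 < 1 - a := by linarith
  have h1c : 0 < 1 - c := by linarith
  have h2 : 0 < t / 2 := by linarith
  refine (lintegral_Ioo_zero_mul_le (K₁ := (t / 2) ^ (1 - c) / (1 - c)) (K₂ := (t / 2) ^ (-c))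
    ha0 ha ht (by positivity) (by positivity) (le_of_eq (lintegral_Ioo_rpow_neg hc (by linarith)))
    ?_).trans (ENNReal.ofReal_le_ofReal (le_of_eq ?_))
  · intro s hs
    exact Real.rpow_le_rpow_of_nonpos h2 hs.1 (by linarith)
  · have e1 : (t / 2) ^ (1 - a - c) = (t / 2) ^ (-a) * (t / 2) ^ (1 - c) := by
      rw [← Real.rpow_add h2]; ring_nf
    have e2 : (t / 2) ^ (1 - a - c) = (t / 2) ^ (1 - a) * (t / 2) ^ (-c) := by
      rw [← Real.rpow_add h2]; ring_nf
    rw [add_mul]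
    nth_rewrite 1 [e1]
    rw [e2]
    ring

theorem lintegral_Ioi_rpow_neg {c x : ℝ} (hc : 1 < c) (hx : 0 < x) :
    ∫⁻ s in Set.Ioi x, ENNReal.ofReal (s ^ (-c)) = ENNReal.ofReal (x ^ (1 - c) / (c - 1)) := by
  have hint := integrableOn_Ioi_rpow_of_lt (a := -c) (by linarith) hx
  rw [← ofReal_integral_eq_lintegral_ofReal hint]
  · congr 1
    rw [integral_Ioi_rpow_of_lt (by linarith) hx]
    have : -c + 1 ≠ 0 := by linarith
    have : c - 1 ≠ 0 := by linarith
    rw [show -c + 1 = 1 - c by ring, neg_div, ← div_neg, neg_sub]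
  · filter_upwards [ae_restrict_mem measurableSet_Ioi] with s hs
    exact Real.rpow_nonneg (hx.le.trans (le_of_lt hs)) _

end TimeIntegrals

/-- The Duhamel integral `∫_τ^t e^{(t-s)Δ} g(s) ds` of a `[0, ∞]`-valued source. -/
noncomputable def duhamelOp {n : ℕ} (τ t : ℝ) (g : ℝ → Rn n → ℝ≥0∞) (x : Rn n) : ℝ≥0∞ :=
  ∫⁻ s in Set.Ioo τ t, heatOp (t - s) (g s) x

section Duhamel

variable {n : ℕ}

theorem measurable_slice {g : ℝ → Rn n → ℝ≥0∞} (hg : Measurable (Function.uncurry g)) (s : ℝ) :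
    Measurable (g s) := hg.comp (measurable_const.prodMk measurable_id)

theorem measurable_heatOp_sub {g : ℝ → Rn n → ℝ≥0∞} (hg : Measurable (Function.uncurry g)) :
    Measurable fun q : (ℝ × ℝ) × Rn n => heatOp (q.1.1 - q.1.2) (g q.1.2) q.2 := by
  have h1 : Measurable fun q : ((ℝ × ℝ) × Rn n) × Rn n =>
      ENNReal.ofReal (heatKernel n (q.1.1.1 - q.1.1.2) (q.1.2 - q.2)) := by
    unfold heatKernel
    fun_prop
  have h2 : Measurable fun q : ((ℝ × ℝ) × Rn n) × Rn n => g q.1.1.2 q.2 :=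
    hg.comp (f := fun q : ((ℝ × ℝ) × Rn n) × Rn n => (q.1.1.2, q.2)) (by fun_prop)
  exact (h1.mul h2).lintegral_prod_right'

theorem measurable_heatOp_sub_const {g : ℝ → Rn n → ℝ≥0∞} (hg : Measurable (Function.uncurry g))
    (t : ℝ) : Measurable fun q : ℝ × Rn n => heatOp (t - q.1) (g q.1) q.2 :=
  (measurable_heatOp_sub hg).comp (f := fun q : ℝ × Rn n => ((t, q.1), q.2)) (by fun_prop)

theorem measurable_duhamelOp {g : ℝ → Rn n → ℝ≥0∞} (hg : Measurable (Function.uncurry g))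
    (τ t : ℝ) : Measurable (duhamelOp τ t g) := by
  have h : Measurable fun q : Rn n × ℝ => heatOp (t - q.2) (g q.2) q.1 :=
    (measurable_heatOp_sub_const hg t).comp (f := fun q : Rn n × ℝ => (q.2, q.1)) (by fun_prop)
  exact h.lintegral_prod_right'

theorem measurable_uncurry_duhamelOp {g : ℝ → Rn n → ℝ≥0∞}
    (hg : Measurable (Function.uncurry g)) (τ : ℝ) :
    Measurable (Function.uncurry fun t => duhamelOp τ t g) := by
  have hS : MeasurableSet {q : (ℝ × Rn n) × ℝ | τ < q.2 ∧ q.2 < q.1.1} := by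
    exact (measurableSet_lt measurable_const measurable_snd).inter
      (measurableSet_lt measurable_snd (measurable_fst.comp measurable_fst))
  have h : Measurable fun q : (ℝ × Rn n) × ℝ => heatOp (q.1.1 - q.2) (g q.2) q.1.2 :=
    (measurable_heatOp_sub hg).comp
      (f := fun q : (ℝ × Rn n) × ℝ => ((q.1.1, q.2), q.1.2)) (by fun_prop)
  have h2 := (h.indicator hS).lintegral_prod_right' (ν := (volume : Measure ℝ))
  convert h2 using 1
  funext p
  obtain ⟨t, x⟩ := p
  simp only [Function.uncurry, duhamelOp]
  rw [← lintegral_indicator measurableSet_Ioo]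
  rfl

theorem duhamelOp_congr {τ t : ℝ} {g g' : ℝ → Rn n → ℝ≥0∞}
    (h : ∀ s ∈ Set.Ioo τ t, ∀ᵐ x, g s x = g' s x) (x : Rn n) :
    duhamelOp τ t g x = duhamelOp τ t g' x :=
  setLIntegral_congr_fun measurableSet_Ioo fun s hs => heatOp_congr_ae _ (h s hs) x

theorem duhamelOp_mono {τ t : ℝ} {g g' : ℝ → Rn n → ℝ≥0∞}
    (h : ∀ s ∈ Set.Ioo τ t, ∀ᵐ x, g s x ≤ g' s x) (x : Rn n) :
    duhamelOp τ t g x ≤ duhamelOp τ t g' x :=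
  setLIntegral_mono' measurableSet_Ioo fun s hs => heatOp_mono_ae _ (h s hs) x

theorem duhamelOp_add {τ t : ℝ} {g g' : ℝ → Rn n → ℝ≥0∞}
    (hg : Measurable (Function.uncurry g)) (x : Rn n) :
    duhamelOp τ t (fun s y => g s y + g' s y) x = duhamelOp τ t g x + duhamelOp τ t g' x := by
  unfold duhamelOp
  rw [← lintegral_add_left]
  · exact lintegral_congr fun s => heatOp_add _ (measurable_slice hg s) x
  · exact (measurable_heatOp_sub_const hg t).comp (f := fun s : ℝ => (s, x)) (by fun_prop)

/-- Smoothing estimate for the Duhamel integral, from a bound on the source at each time. -/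
theorem invNorm_duhamelOp_le {τ t θ θ' : ℝ} (hθ' : 0 < θ') (h : θ' ≤ θ) (hθ1 : θ ≤ 1)
    {g : ℝ → Rn n → ℝ≥0∞} (hg : Measurable (Function.uncurry g)) {a : ℝ → ℝ}
    (ha : Measurable a) (ha0 : ∀ s ∈ Set.Ioo τ t, 0 < a s)
    (hb : ∀ s ∈ Set.Ioo τ t, invNorm θ (g s) ≤ ENNReal.ofReal (a s)) :
    invNorm θ' (duhamelOp τ t g) ≤
      ∫⁻ s in Set.Ioo τ t, ENNReal.ofReal ((t - s) ^ (-((n : ℝ) / 2 * (θ - θ'))) * a s) := by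
  refine invNorm_lintegral_le (μ := volume.restrict (Set.Ioo τ t)) hθ' (h.trans hθ1)
    (measurable_heatOp_sub_const hg t) (by fun_prop) ?_ ?_ ?_
  · filter_upwards [ae_restrict_mem measurableSet_Ioo] with s hs
    have h1 : 0 < t - s := by linarith [hs.2]
    have h2 := ha0 s hs
    rw [Ne, ENNReal.ofReal_eq_zero, not_le]
    positivity
  · exact Eventually.of_forall fun s => ENNReal.ofReal_ne_top
  · filter_upwards [ae_restrict_mem measurableSet_Ioo] with s hs
    have h1 : 0 < t - s := by linarith [hs.2]
    refine (invNorm_heatOp_le h1 hθ' h hθ1 (measurable_slice hg s)).trans ?_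
    rw [ENNReal.ofReal_mul (by positivity)]
    gcongr
    exact hb s hs

theorem duhamelOp_le {τ t θ : ℝ} (hθ : 0 < θ) (hθ1 : θ ≤ 1)
    {g : ℝ → Rn n → ℝ≥0∞} (hg : Measurable (Function.uncurry g)) {a : ℝ → ℝ}
    (hb : ∀ s ∈ Set.Ioo τ t, invNorm θ (g s) ≤ ENNReal.ofReal (a s)) (x : Rn n) :
    duhamelOp τ t g x ≤
      ∫⁻ s in Set.Ioo τ t, ENNReal.ofReal ((t - s) ^ (-((n : ℝ) / 2 * θ)) * a s) := by
  refine setLIntegral_mono' measurableSet_Ioo fun s hs => ?_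
  have h1 : 0 < t - s := by linarith [hs.2]
  refine (heatOp_le h1 hθ hθ1 (measurable_slice hg s) x).trans ?_
  rw [ENNReal.ofReal_mul (by positivity)]
  gcongr
  exact hb s hs

theorem heatOp_duhamelOp {τ t : ℝ} (h : τ < t) {g : ℝ → Rn n → ℝ≥0∞}
    (hg : Measurable (Function.uncurry g)) (x : Rn n) :
    heatOp (t - τ) (duhamelOp 0 τ g) x = ∫⁻ s in Set.Ioo 0 τ, heatOp (t - s) (g s) x := by
  have hm : Measurable (Function.uncurry fun (y : Rn n) (s : ℝ) =>
      ENNReal.ofReal (heatKernel n (t - τ) (x - y)) * heatOp (τ - s) (g s) y) := by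
    have h1 : Measurable fun q : Rn n × ℝ => heatOp (τ - q.2) (g q.2) q.1 :=
      (measurable_heatOp_sub_const hg τ).comp (f := fun q : Rn n × ℝ => (q.2, q.1)) (by fun_prop)
    exact ((measurable_heatKernel_right (t - τ) x).comp measurable_fst).mul h1
  calc heatOp (t - τ) (duhamelOp 0 τ g) x
      = ∫⁻ y, ∫⁻ s in Set.Ioo 0 τ,
          ENNReal.ofReal (heatKernel n (t - τ) (x - y)) * heatOp (τ - s) (g s) y := by
        refine lintegral_congr fun y => ?_
        rw [lintegral_const_mul' _ _ ENNReal.ofReal_ne_top]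
        rfl
    _ = ∫⁻ s in Set.Ioo 0 τ, ∫⁻ y,
          ENNReal.ofReal (heatKernel n (t - τ) (x - y)) * heatOp (τ - s) (g s) y :=
        lintegral_lintegral_swap hm.aemeasurable
    _ = _ := by
        refine setLIntegral_congr_fun measurableSet_Ioo fun s hs => ?_
        have := heatOp_heatOp (a := t - τ) (b := τ - s) (by linarith) (by linarith [hs.2])
          (measurable_slice hg s) x
        rw [sub_add_sub_cancel] at this
        exact this

/-- A mild solution can be restarted at any intermediate time. -/
theorem restart {Φ : Rn n → ℝ≥0∞} {U g : ℝ → Rn n → ℝ≥0∞} (hΦ : Measurable Φ)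
    (hg : Measurable (Function.uncurry g))
    (h : ∀ t, 0 < t → ∀ᵐ x, U t x = heatOp t Φ x + duhamelOp 0 t g x)
    {τ t : ℝ} (hτ : 0 < τ) (ht : τ < t) :
    ∀ᵐ x, U t x = heatOp (t - τ) (U τ) x + duhamelOp τ t g x := by
  filter_upwards [h t (hτ.trans ht)] with x hx
  rw [hx, heatOp_congr_ae _ (h τ hτ), heatOp_add _ (measurable_heatOp τ hΦ),
    heatOp_heatOp (by linarith) hτ hΦ, sub_add_cancel, heatOp_duhamelOp ht hg, add_assoc]
  congr 1
  have hu : Set.Ioo 0 t =ᵐ[volume] (Set.Ioo 0 τ ∪ Set.Ioo τ t : Set ℝ) := by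
    have h1 : Set.Ioo 0 t = Set.Ioo 0 τ ∪ Set.Ico τ t :=
      (Set.Ioo_union_Ico_eq_Ioo hτ ht.le).symm
    rw [h1]
    exact (ae_eq_refl _).union Ioo_ae_eq_Ico.symm
  unfold duhamelOp
  rw [setLIntegral_congr hu, lintegral_union measurableSet_Ioo]
  exact Set.disjoint_left.2 fun s h1 h2 => lt_asymm h1.2 h2.1

end Duhamel

/-! ### Small solutions and bounds from the exponential modular -/

/-- The factor `v^{4/n} e^{v²}` of the nonlinearity `v^{4/n} e^{v²} · v`, seen as a potential. -/
noncomputable def potential (n : ℕ) (v : ℝ≥0∞) : ℝ≥0∞ :=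
  ENNReal.ofReal (v.toReal ^ ((4 : ℝ) / n) * Real.exp (v.toReal ^ 2))

theorem measurable_potential (n : ℕ) : Measurable (potential n) := by
  unfold potential
  fun_prop

/-- The elementary inequality behind the embeddings of `exp L²`: powers `α ≥ 2` with a small
exponential are dominated by `e^{y²} - 1`. -/
theorem rpow_mul_exp_le {α : ℝ} (hα : 2 ≤ α) :
    ∃ C : ℝ, 0 < C ∧ ∀ y : ℝ, 0 ≤ y →
      y ^ α * Real.exp (y ^ 2 / 4) ≤ C * (Real.exp (y ^ 2) - 1) := by
  set m := ⌈α⌉₊ with hm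
  refine ⟨1 + 4 ^ m * m.factorial, by positivity, fun y hy => ?_⟩
  have h1 : y ^ α ≤ y ^ 2 * (1 + (y ^ 2) ^ m) := by
    rcases le_total y 1 with h | h
    · rcases hy.eq_or_lt with h0 | h0
      · rw [← h0, Real.zero_rpow (by linarith)]; positivity
      · calc y ^ α ≤ y ^ (2 : ℝ) := Real.rpow_le_rpow_of_exponent_ge h0 h hα
          _ = y ^ 2 * 1 := by rw [mul_one]; exact_mod_cast Real.rpow_natCast y 2
          _ ≤ _ := by gcongr; exact le_add_of_nonneg_right (by positivity)
    · calc y ^ α ≤ y ^ (m : ℝ) := Real.rpow_le_rpow_of_exponent_le h (Nat.le_ceil α)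
        _ = y ^ m := Real.rpow_natCast y m
        _ ≤ 1 * (y ^ m * y ^ m) := by
            rw [one_mul]; exact le_mul_of_one_le_right (by positivity) (one_le_pow₀ h)
        _ ≤ y ^ 2 * (y ^ m * y ^ m) := by gcongr; exact one_le_pow₀ h
        _ ≤ _ := by
            rw [← pow_add, ← two_mul, ← pow_mul]
            gcongr
            exact le_add_of_nonneg_left zero_le_one
  set z := y ^ 2 with hz
  have hz0 : 0 ≤ z := by positivity
  have h2 : 1 ≤ Real.exp (z / 4) := Real.one_le_exp (by positivity)
  have h3 : z ^ m ≤ 4 ^ m * m.factorial * Real.exp (z / 4) := by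
    have := Real.pow_div_factorial_le_exp (z / 4) (by positivity) m
    rw [div_le_iff₀ (by positivity), div_pow, div_le_iff₀ (by positivity)] at this
    linarith
  have h4 : z * Real.exp (z / 2) ≤ Real.exp z - 1 := by
    have := Real.self_le_sinh_iff.2 (show 0 ≤ z / 2 by positivity)
    rw [Real.sinh_eq] at this
    have e1 : Real.exp (z / 2) * Real.exp (z / 2) = Real.exp z := by
      rw [← Real.exp_add, add_halves]
    have e2 : Real.exp (z / 2) * Real.exp (-(z / 2)) = 1 := by
      rw [← Real.exp_add, add_neg_cancel, Real.exp_zero]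
    nlinarith [Real.exp_pos (z / 2)]
  have e3 : Real.exp (z / 4) * Real.exp (z / 4) = Real.exp (z / 2) := by
    rw [← Real.exp_add]; congr 1; ring
  calc y ^ α * Real.exp (z / 4) ≤ z * (1 + z ^ m) * Real.exp (z / 4) := by gcongr
    _ ≤ z * (Real.exp (z / 4) + 4 ^ m * m.factorial * Real.exp (z / 4)) * Real.exp (z / 4) := by
        gcongr
    _ = (1 + 4 ^ m * m.factorial) * (z * (Real.exp (z / 4) * Real.exp (z / 4))) := by ring
    _ ≤ _ := by rw [e3]; gcongr

/-- Powers and small exponentials are controlled by the `exp L²` modular. -/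
theorem invNorm_rpow_mul_exp_le {a c θ : ℝ} (hθ : 0 < θ) (ha : 2 * θ ≤ a) :
    ∃ C : ℝ, 0 < C ∧ ∀ {n : ℕ} {ε : ℝ} {f : Rn n → ℝ≥0∞}, 0 < ε → 16 * (c / θ) * ε ^ 2 ≤ 1 →
      (∫⁻ x, ENNReal.ofReal (Real.exp (((f x).toReal / (2 * ε)) ^ 2) - 1)) ≤ 1 →
      invNorm θ (fun x => ENNReal.ofReal ((f x).toReal ^ a * Real.exp (c * (f x).toReal ^ 2))) ≤
        ENNReal.ofReal (C * ε ^ a) := by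
  obtain ⟨C, hC, h⟩ := rpow_mul_exp_le (α := a / θ) ((le_div_iff₀ hθ).2 ha)
  refine ⟨2 ^ a * C ^ θ, by positivity, fun {n ε f} hε hcε hf => ?_⟩
  have hp : ∀ v : ℝ, 0 ≤ v → (v ^ a * Real.exp (c * v ^ 2)) ^ (1 / θ) ≤
      (2 * ε) ^ (a / θ) * C * (Real.exp ((v / (2 * ε)) ^ 2) - 1) := by
    intro v hv
    set y := v / (2 * ε) with hy
    have hy0 : 0 ≤ y := by positivity
    have hvy : v = 2 * ε * y := by rw [hy]; field_simp
    rw [Real.mul_rpow (by positivity) (by positivity), ← Real.rpow_mul hv, ← Real.exp_mul,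
      mul_one_div, mul_one_div]
    have h1 : Real.exp (c * v ^ 2 / θ) ≤ Real.exp (y ^ 2 / 4) := by
      apply Real.exp_le_exp.2
      have : c * v ^ 2 / θ = 16 * (c / θ) * ε ^ 2 * (y ^ 2 / 4) := by rw [hvy]; ring
      rw [this]
      exact mul_le_of_le_one_left (by positivity) hcε
    calc v ^ (a / θ) * Real.exp (c * v ^ 2 / θ)
        ≤ v ^ (a / θ) * Real.exp (y ^ 2 / 4) := by gcongr
      _ = (2 * ε) ^ (a / θ) * (y ^ (a / θ) * Real.exp (y ^ 2 / 4)) := by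
          rw [hvy, Real.mul_rpow (by positivity) hy0]; ring
      _ ≤ (2 * ε) ^ (a / θ) * (C * (Real.exp (y ^ 2) - 1)) := by
          exact mul_le_mul_of_nonneg_left (h y hy0) (by positivity)
      _ = _ := by ring
  have hint : ∫⁻ x, ENNReal.ofReal
      ((f x).toReal ^ a * Real.exp (c * (f x).toReal ^ 2)) ^ (1 / θ) ≤
      ENNReal.ofReal ((2 * ε) ^ (a / θ) * C) := by
    calc _ ≤ ∫⁻ x, ENNReal.ofReal ((2 * ε) ^ (a / θ) * C) *
          ENNReal.ofReal (Real.exp (((f x).toReal / (2 * ε)) ^ 2) - 1) := by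
          refine lintegral_mono fun x => ?_
          dsimp only
          rw [ENNReal.ofReal_rpow_of_nonneg (by positivity) (by positivity),
            ← ENNReal.ofReal_mul (by positivity)]
          exact ENNReal.ofReal_le_ofReal (hp _ ENNReal.toReal_nonneg)
      _ ≤ ENNReal.ofReal ((2 * ε) ^ (a / θ) * C) * 1 := by
          rw [lintegral_const_mul' _ _ ENNReal.ofReal_ne_top]
          gcongr
      _ = _ := mul_one _
  unfold invNorm
  refine (ENNReal.rpow_le_rpow hint hθ.le).trans (le_of_eq ?_)
  rw [ENNReal.ofReal_rpow_of_pos (by positivity), Real.mul_rpow (by positivity) hC.le,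
    ← Real.rpow_mul (by positivity), div_mul_cancel₀ _ hθ.ne', Real.mul_rpow (by positivity) hε.le]
  congr 1; ring

/-- The shift `1 / (n + 2)` between the inverse exponent of the data and that of the Kato norm. -/
noncomputable def gainExp (n : ℕ) : ℝ := 1 / ((n : ℝ) + 2)

/-- The number `n / (2 (n + 2))`: it is both the inverse exponent and the power of time in the
Kato norm `sup_t t^{b} ‖u(t)‖_{L^{1/b}}` associated with data in `L²`. -/
noncomputable def katoExp (n : ℕ) : ℝ := 1 / 2 - gainExp n

theorem gainExp_pos (n : ℕ) : 0 < gainExp n := by unfold gainExp; positivity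

theorem gainExp_le {n : ℕ} (hn : 1 ≤ n) : gainExp n ≤ 1 / 3 := by
  have : (1 : ℝ) ≤ n := by exact_mod_cast hn
  unfold gainExp
  exact one_div_le_one_div_of_le (by norm_num) (by linarith)

theorem katoExp_pos {n : ℕ} (hn : 1 ≤ n) : 0 < katoExp n := by
  have := gainExp_le hn
  unfold katoExp
  linarith

theorem katoExp_lt (n : ℕ) : katoExp n < 1 / 2 := by
  have := gainExp_pos n
  unfold katoExp
  linarith

theorem half_mul_gainExp (n : ℕ) : (n : ℝ) / 2 * gainExp n = katoExp n := by
  unfold katoExp gainExp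
  field_simp
  ring

theorem gainExp_eq (n : ℕ) : gainExp n = 1 / 2 - katoExp n := by unfold katoExp; ring

/-- A nonnegative mild solution with small `exp L²` norm, as a jointly measurable function that is
`[0, ∞]`-valued in type but finite everywhere. The size `ε` bounds the `L²` norm of the data and
half the Luxemburg norm of `U(t)`; of the continuity in time only the upper semicontinuity of the
`L^{1/b}` norm, `b = katoExp n`, is kept. -/
structure SmallMild (n : ℕ) (ε : ℝ) (Φ : Rn n → ℝ≥0∞) (U : ℝ → Rn n → ℝ≥0∞) : Prop where
  pos : 0 < ε
  meas_init : Measurable Φ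
  init_le : invNorm (1 / 2) Φ ≤ ENNReal.ofReal ε
  meas : Measurable (Function.uncurry U)
  ne_top : ∀ t x, U t x ≠ ∞
  eqn : ∀ t, 0 < t → ∀ᵐ x,
    U t x = heatOp t Φ x + duhamelOp 0 t (fun s y => potential n (U s y) * U s y) x
  modular : ∀ t, 0 < t →
    ∫⁻ x, ENNReal.ofReal (Real.exp (((U t x).toReal / (2 * ε)) ^ 2) - 1) ≤ 1
  usc : ∀ T, 0 < T → ∀ η : ℝ, 0 < η → ∀ᶠ s in 𝓝 T,
    invNorm (katoExp n) (U s) ≤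
      invNorm (katoExp n) (U T) + ENNReal.ofReal η

section

variable {n : ℕ}

theorem SmallMild.invNorm_le {θ : ℝ} (hθ : 0 < θ) (h : θ ≤ 1 / 2) :
    ∃ C : ℝ, 0 < C ∧ ∀ {n : ℕ} {ε : ℝ} {Φ : Rn n → ℝ≥0∞} {U : ℝ → Rn n → ℝ≥0∞},
      SmallMild n ε Φ U → ∀ t, 0 < t → invNorm θ (U t) ≤ ENNReal.ofReal (C * ε) := by
  obtain ⟨C, hC, hb⟩ := invNorm_rpow_mul_exp_le (a := 1) (c := 0) hθ (by linarith)
  refine ⟨C, hC, fun {n ε Φ U} hU t ht => ?_⟩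
  have := hb (f := U t) hU.pos (by simp) (hU.modular t ht)
  simpa [ENNReal.ofReal_toReal (hU.ne_top t _)] using this

theorem SmallMild.invNorm_potential_le (hn : 1 ≤ n) {θ : ℝ} (hθ : 0 < θ) (h : θ ≤ 2 / n) :
    ∃ C : ℝ, 0 < C ∧ ∀ {ε : ℝ} {Φ : Rn n → ℝ≥0∞} {U : ℝ → Rn n → ℝ≥0∞},
      SmallMild n ε Φ U → 16 * (1 / θ) * ε ^ 2 ≤ 1 → ∀ t, 0 < t →
        invNorm θ (fun x => potential n (U t x)) ≤ ENNReal.ofReal (C * ε ^ ((4 : ℝ) / n)) := by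
  have hn' : (0 : ℝ) < n := by exact_mod_cast hn
  obtain ⟨C, hC, hb⟩ := invNorm_rpow_mul_exp_le (a := 4 / (n : ℝ)) (c := 1) hθ (by
    calc 2 * θ ≤ 2 * (2 / n) := by gcongr
      _ = 4 / n := by ring)
  refine ⟨C, hC, fun {ε Φ U} hU hε t ht => ?_⟩
  have := hb (f := U t) hU.pos hε (hU.modular t ht)
  simp only [one_mul] at this
  exact this

theorem SmallMild.invNorm_source_le (hn : 1 ≤ n) :
    ∃ C : ℝ, 0 < C ∧ ∀ {ε : ℝ} {Φ : Rn n → ℝ≥0∞} {U : ℝ → Rn n → ℝ≥0∞},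
      SmallMild n ε Φ U → 16 * (n : ℝ) * ε ^ 2 ≤ 1 → ∀ t, 0 < t →
        invNorm (1 / n) (fun x => potential n (U t x) * U t x) ≤
          ENNReal.ofReal (C * ε ^ (1 + (4 : ℝ) / n)) := by
  have hn' : (1 : ℝ) ≤ n := by exact_mod_cast hn
  obtain ⟨C, hC, hb⟩ := invNorm_rpow_mul_exp_le (θ := 1 / (n : ℝ)) (a := 1 + 4 / (n : ℝ)) (c := 1)
    (by positivity) (by
      have : 2 * (1 / (n : ℝ)) ≤ 4 / n := by rw [mul_one_div]; gcongr; norm_num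
      linarith)
  refine ⟨C, hC, fun {ε Φ U} hU hε t ht => ?_⟩
  have := hb (f := U t) hU.pos (by simpa using hε) (hU.modular t ht)
  refine le_trans (le_of_eq (invNorm_congr_ae (Eventually.of_forall fun x => ?_))) this
  unfold potential
  nth_rewrite 3 [← ENNReal.ofReal_toReal (hU.ne_top t x)]
  rw [← ENNReal.ofReal_mul (by positivity), one_mul,
    Real.rpow_add_of_nonneg ENNReal.toReal_nonneg zero_le_one (by positivity), Real.rpow_one]
  congr 1; ring

theorem SmallMild.meas_slice {ε : ℝ} {Φ : Rn n → ℝ≥0∞} {U : ℝ → Rn n → ℝ≥0∞}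
    (hU : SmallMild n ε Φ U) (t : ℝ) : Measurable (U t) := measurable_slice hU.meas t

theorem SmallMild.meas_potential {ε : ℝ} {Φ : Rn n → ℝ≥0∞} {U : ℝ → Rn n → ℝ≥0∞}
    (hU : SmallMild n ε Φ U) : Measurable (Function.uncurry fun s y => potential n (U s y)) :=
  (measurable_potential n).comp hU.meas

theorem SmallMild.meas_source {ε : ℝ} {Φ : Rn n → ℝ≥0∞} {U : ℝ → Rn n → ℝ≥0∞}
    (hU : SmallMild n ε Φ U) :
    Measurable (Function.uncurry fun s y => potential n (U s y) * U s y) :=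
  hU.meas_potential.mul hU.meas

theorem potential_le {v : ℝ≥0∞} (hv : v ≠ ∞) {K : ℝ} (hK : Real.exp (v.toReal ^ 2) ≤ K) :
    potential n v ≤ ENNReal.ofReal K * v ^ ((4 : ℝ) / n) := by
  have e : v ^ ((4 : ℝ) / n) = ENNReal.ofReal (v.toReal ^ ((4 : ℝ) / n)) := by
    rw [← ENNReal.ofReal_rpow_of_nonneg ENNReal.toReal_nonneg (by positivity),
      ENNReal.ofReal_toReal hv]
  have hK0 : 0 ≤ K := (Real.exp_pos _).le.trans hK
  rw [e, ← ENNReal.ofReal_mul hK0, mul_comm K]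
  unfold potential
  refine ENNReal.ofReal_le_ofReal ?_
  gcongr

end

/-! ### Critical potentials and crude supremum bounds -/

section

variable {n : ℕ}

/-- Bound for the linear Duhamel operator with a potential `V`, from bounds on `V` and `w` at each
time. -/
theorem invNorm_duhamelOp_mul_le {τ t θ₁ θ₂ θ' : ℝ} (h₁ : 0 < θ₁) (h₂ : 0 < θ₂) (hθ' : 0 < θ')
    (h : θ' ≤ θ₁ + θ₂) (h1 : θ₁ + θ₂ ≤ 1) {V w : ℝ → Rn n → ℝ≥0∞}
    (hV : Measurable (Function.uncurry V)) (hw : Measurable (Function.uncurry w)) {a c : ℝ → ℝ}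
    (ha : Measurable a) (hc : Measurable c) (ha0 : ∀ s ∈ Set.Ioo τ t, 0 < a s)
    (hc0 : ∀ s ∈ Set.Ioo τ t, 0 < c s)
    (hVa : ∀ s ∈ Set.Ioo τ t, invNorm θ₁ (V s) ≤ ENNReal.ofReal (a s))
    (hwc : ∀ s ∈ Set.Ioo τ t, invNorm θ₂ (w s) ≤ ENNReal.ofReal (c s)) :
    invNorm θ' (duhamelOp τ t (fun s y => V s y * w s y)) ≤
      ∫⁻ s in Set.Ioo τ t,
        ENNReal.ofReal ((t - s) ^ (-((n : ℝ) / 2 * (θ₁ + θ₂ - θ'))) * (a s * c s)) := by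
  refine invNorm_duhamelOp_le hθ' h h1 (g := fun s y => V s y * w s y) (hV.mul hw)
    (a := fun s => a s * c s) (ha.mul hc)
    (fun s hs => mul_pos (ha0 s hs) (hc0 s hs)) fun s hs => ?_
  refine (invNorm_mul_le h₁ h₂ (measurable_slice hV s).aemeasurable
    (measurable_slice hw s).aemeasurable).trans ?_
  rw [ENNReal.ofReal_mul (ha0 s hs).le]
  exact mul_le_mul' (hVa s hs) (hwc s hs)

theorem rpow_half_neg_le {t b : ℝ} (ht : 0 < t) (hb : b ≤ 1) :
    (t / 2) ^ (-b) ≤ 2 * t ^ (-b) := by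
  rw [Real.div_rpow ht.le (by norm_num), Real.rpow_neg (by norm_num : (0 : ℝ) ≤ 2), div_inv_eq_mul,
    mul_comm]
  gcongr
  calc (2 : ℝ) ^ b ≤ 2 ^ (1 : ℝ) := Real.rpow_le_rpow_of_exponent_le (by norm_num) hb
    _ = 2 := Real.rpow_one 2

/-- The scale-invariant estimate: a potential with the critical bound
`‖V(s)‖_{L^{(n+2)/2}} ≤ κ s^{-2/(n+2)}` acts on the Kato space with weight `t^b`. -/
theorem duhamelOp_critical_le (hn : 1 ≤ n) :
    ∃ B : ℝ, 0 < B ∧ ∀ {V w : ℝ → Rn n → ℝ≥0∞} {t θ κ A : ℝ},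
      Measurable (Function.uncurry V) → Measurable (Function.uncurry w) →
      0 < t → 1 / 2 ≤ θ → θ ≤ 1 - gainExp n → 0 < κ → 0 < A →
      (∀ s ∈ Set.Ioo 0 t,
        invNorm (2 * gainExp n) (V s) ≤ ENNReal.ofReal (κ * s ^ (-(2 * gainExp n)))) →
      (∀ s ∈ Set.Ioo 0 t,
        invNorm (θ - gainExp n) (w s) ≤ ENNReal.ofReal (A * s ^ (-katoExp n))) →
      invNorm (θ - gainExp n) (duhamelOp 0 t (fun s y => V s y * w s y)) ≤
        ENNReal.ofReal (B * κ * A * t ^ (-katoExp n)) ∧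
      invNorm θ (duhamelOp 0 t (fun s y => V s y * w s y)) ≤ ENNReal.ofReal (B * κ * A) := by
  have hd := gainExp_pos n
  have hd3 := gainExp_le hn
  have hb := katoExp_pos hn
  have hb2 := katoExp_lt n
  have hdb := gainExp_eq n
  have hnd := half_mul_gainExp n
  set d := gainExp n
  set b := katoExp n
  set B₁ := 1 / b + 1 / (1 - 2 * b) with hB₁
  set B₂ := 1 / b + 1 / (1 - b) with hB₂
  have h1b : 0 < 1 - b := by linarith
  have h2b : 0 < 1 - 2 * b := by linarith
  have hB₁0 : 0 < B₁ := by positivity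
  have hB₂0 : 0 < B₂ := by positivity
  refine ⟨2 * B₁ + B₂, by positivity, fun {V w t θ κ A} hV hw ht hθ hθ1 hκ hA hVa hwA => ?_⟩
  have hs0 : ∀ s ∈ Set.Ioo 0 t, ∀ c K : ℝ, 0 < K → 0 < K * s ^ c := fun s hs c K hK =>
    mul_pos hK (Real.rpow_pos_of_pos hs.1 _)
  have hgen : ∀ θ' a : ℝ, 0 < θ' → θ' ≤ θ → 0 ≤ a → a < 1 → (n : ℝ) / 2 * (θ + d - θ') = a →
      invNorm θ' (duhamelOp 0 t (fun s y => V s y * w s y)) ≤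
        ENNReal.ofReal (κ * A * ((1 / b + 1 / (1 - a)) * (t / 2) ^ (b - a))) := by
    intro θ' a hθ' hθθ ha0 ha1 hna
    refine (invNorm_duhamelOp_mul_le (θ₁ := 2 * d) (θ₂ := θ - d) (by linarith) (by linarith)
      hθ' (by linarith) (by linarith) hV hw (a := fun s => κ * s ^ (-(2 * d)))
      (c := fun s => A * s ^ (-b)) (by fun_prop) (by fun_prop) (fun s hs => hs0 s hs _ _ hκ)
      (fun s hs => hs0 s hs _ _ hA) hVa hwA).trans ?_
    have e : ∀ s ∈ Set.Ioo 0 t, ENNReal.ofReal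
        ((t - s) ^ (-((n : ℝ) / 2 * (2 * d + (θ - d) - θ'))) *
          (κ * s ^ (-(2 * d)) * (A * s ^ (-b)))) =
        ENNReal.ofReal (κ * A) * ENNReal.ofReal ((t - s) ^ (-a) * s ^ (-(1 - b))) := by
      intro s hs
      have e1 : s ^ (-(1 - b)) = s ^ (-(2 * d)) * s ^ (-b) := by
        rw [← Real.rpow_add hs.1]; congr 1; linarith
      have e2 : 2 * d + (θ - d) - θ' = θ + d - θ' := by ring
      rw [← ENNReal.ofReal_mul (by positivity), e1, e2, hna]
      congr 1; ring
    rw [setLIntegral_congr_fun measurableSet_Ioo e, lintegral_const_mul' _ _ ENNReal.ofReal_ne_top,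
      ENNReal.ofReal_mul (p := κ * A) (by positivity)]
    have := lintegral_Ioo_rpow_mul_rpow_le (a := a) (c := 1 - b) ha0 ha1 h1b.le (by linarith) ht
    rw [sub_sub_cancel, show 1 - a - (1 - b) = b - a by ring] at this
    exact mul_le_mul' le_rfl this
  constructor
  · refine (hgen (θ - d) (2 * b) (by linarith) (by linarith) (by linarith) (by linarith) ?_).trans
      (ENNReal.ofReal_le_ofReal ?_)
    · rw [show θ + d - (θ - d) = 2 * d by ring]; linarith
    · have h := rpow_half_neg_le ht (b := b) (by linarith)
      rw [show b - 2 * b = -b by ring, ← hB₁]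
      have ht' : 0 < t ^ (-b) := Real.rpow_pos_of_pos ht _
      calc κ * A * (B₁ * (t / 2) ^ (-b)) ≤ κ * A * (B₁ * (2 * t ^ (-b))) := by gcongr
        _ = (2 * B₁) * κ * A * t ^ (-b) := by ring
        _ ≤ _ := by gcongr; linarith
  · refine (hgen θ b (by linarith) le_rfl hb.le (by linarith) ?_).trans
      (ENNReal.ofReal_le_ofReal ?_)
    · rw [show θ + d - θ = d by ring]; exact hnd
    · rw [sub_self, Real.rpow_zero, ← hB₂, mul_one]
      calc κ * A * B₂ = B₂ * κ * A := by ring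
        _ ≤ _ := by gcongr; linarith

/-- Over a time interval of length at most one the source, bounded in `L^n`, contributes `O(ε)` to
the supremum, since the kernel then has the integrable singularity `(t - s)^{-1/2}`. -/
theorem SmallMild.duhamelOp_short_le (hn : 1 ≤ n) :
    ∃ C : ℝ, 0 < C ∧ ∀ {ε : ℝ} {Φ : Rn n → ℝ≥0∞} {U : ℝ → Rn n → ℝ≥0∞},
      SmallMild n ε Φ U → 16 * (n : ℝ) * ε ^ 2 ≤ 1 → ∀ τ t, 0 ≤ τ → τ < t → t ≤ τ + 1 → ∀ x,
        duhamelOp τ t (fun s y => potential n (U s y) * U s y) x ≤ ENNReal.ofReal (C * ε) := by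
  have hn' : (1 : ℝ) ≤ n := by exact_mod_cast hn
  obtain ⟨C, hC, h⟩ := SmallMild.invNorm_source_le hn
  refine ⟨2 * C, by positivity, fun {ε Φ U} hU hε τ t hτ hτt ht x => ?_⟩
  have hε0 := hU.pos
  have hε1 : ε ≤ 1 := by nlinarith
  refine (duhamelOp_le (θ := 1 / n) (by positivity) ((div_le_one (by positivity)).2 hn')
    hU.meas_source (a := fun _ => C * ε ^ (1 + (4 : ℝ) / n))
    (fun s hs => h hU hε s (hτ.trans_lt hs.1)) x).trans ?_
  have e : (n : ℝ) / 2 * (1 / n) = 1 / 2 := by field_simp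
  rw [e]
  refine (lintegral_Ioo_mul_le (a := 1 / 2) (by norm_num) hτt.le (K := C * ε) fun s hs => ?_).trans
    (ENNReal.ofReal_le_ofReal ?_)
  · gcongr
    calc ε ^ (1 + (4 : ℝ) / n) ≤ ε ^ (1 : ℝ) :=
          Real.rpow_le_rpow_of_exponent_ge hε0 hε1 (le_add_of_nonneg_right (by positivity))
      _ = ε := Real.rpow_one ε
  · have h1 : (t - τ) ^ ((1 : ℝ) - 1 / 2) ≤ 1 :=
      Real.rpow_le_one (by linarith) (by linarith) (by norm_num)
    calc (t - τ) ^ ((1 : ℝ) - 1 / 2) / (1 - 1 / 2) * (C * ε) ≤ 1 / (1 - 1 / 2) * (C * ε) := by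
          gcongr
      _ = 2 * C * ε := by ring

theorem SmallMild.sup_le_of_le_one (hn : 1 ≤ n) :
    ∃ C : ℝ, 0 < C ∧ ∀ {ε : ℝ} {Φ : Rn n → ℝ≥0∞} {U : ℝ → Rn n → ℝ≥0∞},
      SmallMild n ε Φ U → 16 * (n : ℝ) * ε ^ 2 ≤ 1 → ∀ θ t, 0 < θ → θ ≤ 1 → 0 < t → t ≤ 1 →
        ∀ᵐ x, U t x ≤ ENNReal.ofReal (t ^ (-((n : ℝ) / 2 * θ))) * invNorm θ Φ +
          ENNReal.ofReal (C * ε) := by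
  obtain ⟨C, hC, h⟩ := SmallMild.duhamelOp_short_le hn
  refine ⟨C, hC, fun {ε Φ U} hU hε θ t hθ hθ1 ht ht1 => ?_⟩
  filter_upwards [hU.eqn t ht] with x hx
  rw [hx]
  exact add_le_add (heatOp_le ht hθ hθ1 hU.meas_init x) (h hU hε 0 t le_rfl ht (by linarith) x)

theorem SmallMild.sup_le_of_one_le (hn : 1 ≤ n) :
    ∃ C : ℝ, 0 < C ∧ ∀ {ε : ℝ} {Φ : Rn n → ℝ≥0∞} {U : ℝ → Rn n → ℝ≥0∞},
      SmallMild n ε Φ U → 16 * (n : ℝ) * ε ^ 2 ≤ 1 → ∀ t, 1 ≤ t →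
        ∀ᵐ x, U t x ≤ ENNReal.ofReal (C * ε) := by
  obtain ⟨C, hC, h⟩ := SmallMild.duhamelOp_short_le hn
  obtain ⟨C₂, hC₂, h₂⟩ := SmallMild.invNorm_le (θ := 1 / 2) (by norm_num) le_rfl
  refine ⟨(1 / 2 : ℝ) ^ (-((n : ℝ) / 2 * (1 / 2))) * C₂ + C, by positivity,
    fun {ε Φ U} hU hε t ht => ?_⟩
  have hε0 := hU.pos
  filter_upwards [restart hU.meas_init hU.meas_source hU.eqn (τ := t - 1 / 2) (t := t)
    (by linarith) (by linarith)] with x hx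
  rw [hx, sub_sub_cancel, add_mul, mul_assoc, ENNReal.ofReal_add (by positivity) (by positivity),
    ENNReal.ofReal_mul (by positivity)]
  refine add_le_add ((heatOp_le (θ := 1 / 2) (by norm_num) (by norm_num) (by norm_num)
    (hU.meas_slice _) x).trans ?_) (h hU hε _ t (by linarith) (by linarith) (by linarith) x)
  gcongr
  exact h₂ hU _ (by linarith)

/-- For `t ≥ 1` the exponential factor of the nonlinearity is harmless. -/
theorem SmallMild.potential_le_of_one_le (hn : 1 ≤ n) :
    ∃ δ : ℝ, 0 < δ ∧ ∀ {ε : ℝ} {Φ : Rn n → ℝ≥0∞} {U : ℝ → Rn n → ℝ≥0∞},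
      SmallMild n ε Φ U → ε ≤ δ → ∀ t, 1 ≤ t →
        ∀ᵐ x, potential n (U t x) ≤ 2 * U t x ^ ((4 : ℝ) / n) := by
  obtain ⟨C, hC, h⟩ := SmallMild.sup_le_of_one_le hn
  have hn' : (1 : ℝ) ≤ n := by exact_mod_cast hn
  refine ⟨min (1 / (4 * n)) (1 / (2 * C)), by positivity, fun {ε Φ U} hU hε t ht => ?_⟩
  have hε0 := hU.pos
  have h1 : ε ≤ 1 / (4 * n) := hε.trans (min_le_left _ _)
  have h2 : ε ≤ 1 / (2 * C) := hε.trans (min_le_right _ _)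
  rw [le_div_iff₀ (by positivity)] at h1 h2
  have h3 : 16 * (n : ℝ) * ε ^ 2 ≤ 1 := by
    have h5 : (ε * (4 * n)) ^ 2 ≤ 1 := by
      rw [sq_le_one_iff₀ (by positivity)]; exact h1
    nlinarith [sq_nonneg ε, mul_nonneg (sq_nonneg ε) (by linarith : (0 : ℝ) ≤ n)]
  filter_upwards [h hU h3 t ht] with x hx
  have hv : (U t x).toReal ≤ C * ε := by
    rw [← ENNReal.toReal_ofReal (by positivity : 0 ≤ C * ε)]
    exact ENNReal.toReal_mono ENNReal.ofReal_ne_top hx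
  have hv2 : (U t x).toReal ≤ 1 / 2 := by linarith
  have hv3 : (U t x).toReal ^ 2 ≤ 1 / 2 := by
    have := ENNReal.toReal_nonneg (a := U t x)
    nlinarith
  have := potential_le (n := n) (hU.ne_top t x) (K := 2) (by
    calc Real.exp ((U t x).toReal ^ 2) ≤ Real.exp (1 / 2) := Real.exp_le_exp.2 hv3
      _ ≤ 2 := by
        have h6 := Real.exp_one_lt_d9
        have h7 : Real.exp (1 / 2) * Real.exp (1 / 2) = Real.exp 1 := by
          rw [← Real.exp_add]; norm_num
        nlinarith [Real.exp_pos (1 / 2 : ℝ)])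
  simpa using this

end

/-! ### Smallness of the Kato norm and linear Volterra equations -/

theorem exists_forall_mul_rpow_le_one {a K : ℝ} (ha : 0 < a) (hK : 0 < K) :
    ∃ δ : ℝ, 0 < δ ∧ ∀ ε : ℝ, 0 < ε → ε ≤ δ → K * ε ^ a ≤ 1 := by
  refine ⟨(1 / K) ^ (1 / a), by positivity, fun ε hε h => ?_⟩
  have h1 : ε ^ a ≤ 1 / K := by
    calc ε ^ a ≤ ((1 / K) ^ (1 / a)) ^ a := Real.rpow_le_rpow hε.le h ha.le
      _ = 1 / K := by rw [← Real.rpow_mul (by positivity), one_div_mul_cancel ha.ne', Real.rpow_one]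
  rw [le_div_iff₀ hK] at h1
  linarith

section

variable {n : ℕ}

theorem two_gainExp_div (hn : 1 ≤ n) : 2 * gainExp n / ((4 : ℝ) / n) = katoExp n := by
  have hn' : (0 : ℝ) < n := by exact_mod_cast hn
  rw [← half_mul_gainExp]
  field_simp
  ring

/-- A bound on the Kato norm at time `s` gives the critical bound on the potential. For `s ≤ 1` the
weight is at least one and the `exp L²` norm suffices. -/
theorem SmallMild.potential_critical_of_kato (hn : 1 ≤ n) :
    ∃ δ : ℝ, 0 < δ ∧ ∃ C : ℝ, 0 < C ∧
      ∀ {ε : ℝ} {Φ : Rn n → ℝ≥0∞} {U : ℝ → Rn n → ℝ≥0∞}, SmallMild n ε Φ U → ε ≤ δ →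
        ∀ s, 0 < s → invNorm (katoExp n) (U s) ≤ ENNReal.ofReal (4 * ε * s ^ (-katoExp n)) →
          invNorm (2 * gainExp n) (fun x => potential n (U s x)) ≤
            ENNReal.ofReal (C * ε ^ ((4 : ℝ) / n) * s ^ (-(2 * gainExp n))) := by
  have hn' : (0 : ℝ) < n := by exact_mod_cast hn
  have hd := gainExp_pos n
  have h2d : 2 * gainExp n ≤ 2 / n := by
    unfold gainExp
    rw [mul_one_div]
    gcongr
    linarith
  obtain ⟨C, hC, hp⟩ := SmallMild.invNorm_potential_le hn (θ := 2 * gainExp n) (by positivity) h2d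
  obtain ⟨δ₁, hδ₁, hp1⟩ := SmallMild.potential_le_of_one_le hn
  obtain ⟨δ₂, hδ₂, hs2⟩ := exists_forall_mul_rpow_le_one (a := 2)
    (K := 16 * (1 / (2 * gainExp n))) (by norm_num) (by positivity)
  refine ⟨min δ₁ δ₂, by positivity, C + 2 * 4 ^ ((4 : ℝ) / n), by positivity,
    fun {ε Φ U} hU hε s hs hK => ?_⟩
  have hε0 := hU.pos
  have hs' : 0 < s ^ (-(2 * gainExp n)) := Real.rpow_pos_of_pos hs _
  rcases le_total s 1 with h1 | h1
  · have h3 := hs2 ε hε0 (hε.trans (min_le_right _ _))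
    rw [Real.rpow_two] at h3
    refine (hp hU h3 s hs).trans (ENNReal.ofReal_le_ofReal ?_)
    have h4 : 1 ≤ s ^ (-(2 * gainExp n)) :=
      Real.one_le_rpow_of_pos_of_le_one_of_nonpos hs h1 (by linarith)
    calc C * ε ^ ((4 : ℝ) / n) ≤ (C + 2 * 4 ^ ((4 : ℝ) / n)) * ε ^ ((4 : ℝ) / n) := by
          gcongr; exact le_add_of_nonneg_right (by positivity)
      _ ≤ _ := le_mul_of_one_le_right (by positivity) h4
  · refine (invNorm_mono_ae (by positivity) (hp1 hU (hε.trans (min_le_left _ _)) s h1)).trans ?_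
    rw [invNorm_const_mul (by positivity) _ ((hU.meas_slice s).pow_const _).aemeasurable,
      invNorm_rpow (by positivity), two_gainExp_div hn]
    calc 2 * invNorm (katoExp n) (U s) ^ ((4 : ℝ) / n)
        ≤ 2 * ENNReal.ofReal (4 * ε * s ^ (-katoExp n)) ^ ((4 : ℝ) / n) := by gcongr
      _ = ENNReal.ofReal (2 * 4 ^ ((4 : ℝ) / n) * ε ^ ((4 : ℝ) / n) * s ^ (-(2 * gainExp n))) := by
          rw [ENNReal.ofReal_rpow_of_nonneg (by positivity) (by positivity),
            Real.mul_rpow (by positivity) (by positivity), Real.mul_rpow (by positivity) hε0.le,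
            ← Real.rpow_mul hs.le, ← two_gainExp_div hn]
          have : -(2 * gainExp n / (4 / (n : ℝ))) * (4 / n) = -(2 * gainExp n) := by
            field_simp
          rw [this, show (2 : ℝ≥0∞) = ENNReal.ofReal 2 by simp, ← ENNReal.ofReal_mul (by norm_num)]
          congr 1; ring
      _ ≤ _ := by
          apply ENNReal.ofReal_le_ofReal
          gcongr
          exact le_add_of_nonneg_left hC.le

/-- Smallness of the scale-invariant norm `sup_t t^b ‖u(t)‖_{L^{1/b}}` for all times. A first-exit
argument: the norm starts below the threshold `4ε`, is upper semicontinuous in time, and by the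
integral equation a bound by `4ε` before time `T` improves to `2ε` at time `T`. -/
theorem SmallMild.kato_le (hn : 1 ≤ n) :
    ∃ δ : ℝ, 0 < δ ∧ ∀ {ε : ℝ} {Φ : Rn n → ℝ≥0∞} {U : ℝ → Rn n → ℝ≥0∞},
      SmallMild n ε Φ U → ε ≤ δ → ∀ t, 0 < t →
        invNorm (katoExp n) (U t) ≤ ENNReal.ofReal (4 * ε * t ^ (-katoExp n)) := by
  have hd := gainExp_pos n
  have hd3 := gainExp_le hn
  have hb := katoExp_pos hn
  have hb2 := katoExp_lt n
  have hdb := gainExp_eq n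
  have hn' : (0 : ℝ) < n := by exact_mod_cast hn
  obtain ⟨δ₁, hδ₁, C, hC, hV⟩ := SmallMild.potential_critical_of_kato hn
  obtain ⟨B, hB, hcrit⟩ := duhamelOp_critical_le hn
  obtain ⟨δ₂, hδ₂, hs2⟩ := exists_forall_mul_rpow_le_one (a := (4 : ℝ) / n) (K := B * C * 4)
    (by positivity) (by positivity)
  obtain ⟨C₁, hC₁, h₁⟩ := SmallMild.invNorm_le (θ := katoExp n) hb hb2.le
  have hbd : 1 / 2 - gainExp n = katoExp n := by linarith
  refine ⟨min δ₁ δ₂, by positivity, fun {ε Φ U} hU hε => ?_⟩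
  have hε0 := hU.pos
  have himp : ∀ T, 0 < T →
      (∀ s ∈ Set.Ioo 0 T, invNorm (katoExp n) (U s) ≤ ENNReal.ofReal (4 * ε * s ^ (-katoExp n))) →
      invNorm (katoExp n) (U T) ≤ ENNReal.ofReal (2 * ε * T ^ (-katoExp n)) := by
    intro T hT hbefore
    have hT' : 0 < T ^ (-katoExp n) := Real.rpow_pos_of_pos hT _
    have h2 := (hcrit (θ := 1 / 2) (κ := C * ε ^ ((4 : ℝ) / n)) (A := 4 * ε)
      hU.meas_potential hU.meas hT le_rfl (by linarith) (by positivity) (by positivity)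
      (fun s hs => hV hU (hε.trans (min_le_left _ _)) s hs.1 (hbefore s hs))
      (by rw [hbd]; exact hbefore)).1
    rw [hbd] at h2
    rw [invNorm_congr_ae (hU.eqn T hT)]
    refine (invNorm_add_le hb (by linarith) (measurable_heatOp T hU.meas_init).aemeasurable
      (measurable_duhamelOp hU.meas_source 0 T).aemeasurable).trans ?_
    rw [show 2 * ε * T ^ (-katoExp n) = T ^ (-katoExp n) * ε + ε * T ^ (-katoExp n) by ring,
      ENNReal.ofReal_add (by positivity) (by positivity)]
    refine add_le_add ?_ (h2.trans (ENNReal.ofReal_le_ofReal ?_))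
    · refine (invNorm_heatOp_le hT hb hb2.le (by norm_num) hU.meas_init).trans ?_
      rw [ENNReal.ofReal_mul hT'.le, ← hdb, half_mul_gainExp]
      gcongr
      exact hU.init_le
    · have h3 := hs2 ε hε0 (hε.trans (min_le_right _ _))
      calc B * (C * ε ^ ((4 : ℝ) / n)) * (4 * ε) * T ^ (-katoExp n)
          = B * C * 4 * ε ^ ((4 : ℝ) / n) * (ε * T ^ (-katoExp n)) := by ring
        _ ≤ 1 * (ε * T ^ (-katoExp n)) := by gcongr
        _ = _ := one_mul _
  by_contra hcon
  push Not at hcon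
  set S : Set ℝ := {t | 0 < t ∧ ENNReal.ofReal (4 * ε * t ^ (-katoExp n)) <
    invNorm (katoExp n) (U t)} with hS
  have hSne : S.Nonempty := by
    obtain ⟨t, ht, h⟩ := hcon
    exact ⟨t, ht, h⟩
  have hlow : ∀ t ∈ S, (4 / C₁) ^ (1 / katoExp n) ≤ t := by
    rintro t ⟨ht, h⟩
    by_contra hlt
    push Not at hlt
    refine absurd (h₁ hU t ht) (not_le.2 (lt_of_le_of_lt (ENNReal.ofReal_le_ofReal ?_) h))
    have h5 : t ^ katoExp n ≤ 4 / C₁ := by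
      calc t ^ katoExp n ≤ ((4 / C₁) ^ (1 / katoExp n)) ^ katoExp n :=
            Real.rpow_le_rpow ht.le hlt.le hb.le
        _ = 4 / C₁ := by
            rw [← Real.rpow_mul (by positivity), one_div_mul_cancel hb.ne', Real.rpow_one]
    rw [Real.rpow_neg ht.le]
    have h6 : 0 < t ^ katoExp n := Real.rpow_pos_of_pos ht _
    rw [le_div_iff₀ hC₁] at h5
    rw [← div_eq_mul_inv, le_div_iff₀ h6]
    nlinarith
  have hbdd : BddBelow S := ⟨_, hlow⟩
  set T := sInf S with hT
  have hT0 : 0 < T := lt_of_lt_of_le (by positivity) (le_csInf hSne hlow)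
  have hbefore : ∀ s ∈ Set.Ioo 0 T,
      invNorm (katoExp n) (U s) ≤ ENNReal.ofReal (4 * ε * s ^ (-katoExp n)) := by
    intro s hs
    by_contra h
    exact absurd (csInf_le hbdd (show s ∈ S from ⟨hs.1, not_le.1 h⟩)) (not_le.2 hs.2)
  have hTb := himp T hT0 hbefore
  have hT' : 0 < T ^ (-katoExp n) := Real.rpow_pos_of_pos hT0 _
  have hcont : ∀ᶠ s in 𝓝 T, 3 * ε * T ^ (-katoExp n) < 4 * ε * s ^ (-katoExp n) := by
    have h7 : ContinuousAt (fun s : ℝ => 4 * ε * s ^ (-katoExp n)) T :=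
      continuousAt_const.mul (Real.continuousAt_rpow_const _ _ (Or.inl hT0.ne'))
    refine h7.eventually_const_lt ?_
    have : 0 < ε * T ^ (-katoExp n) := by positivity
    linarith
  have hev := (hU.usc T hT0 (ε * T ^ (-katoExp n)) (by positivity)).and hcont
  obtain ⟨r, hr, hball⟩ := Metric.eventually_nhds_iff.1 hev
  obtain ⟨s, hsS, hs⟩ := exists_lt_of_csInf_lt hSne (show sInf S < T + r by linarith)
  have hTs : T ≤ s := csInf_le hbdd hsS
  obtain ⟨h8, h9⟩ := hball (y := s) (by rw [Real.dist_eq, abs_of_nonneg (by linarith)]; linarith)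
  refine absurd hsS.2 (not_lt.2 (h8.trans ?_))
  calc invNorm (katoExp n) (U T) + ENNReal.ofReal (ε * T ^ (-katoExp n))
      ≤ ENNReal.ofReal (2 * ε * T ^ (-katoExp n)) + ENNReal.ofReal (ε * T ^ (-katoExp n)) := by
        gcongr
    _ = ENNReal.ofReal (3 * ε * T ^ (-katoExp n)) := by
        rw [← ENNReal.ofReal_add (by positivity) (by positivity)]; congr 1; ring
    _ ≤ _ := ENNReal.ofReal_le_ofReal h9.le

/-- The critical bound on the potential of a small solution. -/
theorem SmallMild.potential_critical_le (hn : 1 ≤ n) :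
    ∃ δ : ℝ, 0 < δ ∧ ∃ C : ℝ, 0 < C ∧
      ∀ {ε : ℝ} {Φ : Rn n → ℝ≥0∞} {U : ℝ → Rn n → ℝ≥0∞}, SmallMild n ε Φ U → ε ≤ δ →
        ∀ s, 0 < s → invNorm (2 * gainExp n) (fun x => potential n (U s x)) ≤
            ENNReal.ofReal (C * ε ^ ((4 : ℝ) / n) * s ^ (-(2 * gainExp n))) := by
  obtain ⟨δ₁, hδ₁, C, hC, hV⟩ := SmallMild.potential_critical_of_kato hn
  obtain ⟨δ₂, hδ₂, hK⟩ := SmallMild.kato_le hn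
  exact ⟨min δ₁ δ₂, by positivity, C, hC, fun {ε Φ U} hU hε s hs =>
    hV hU (hε.trans (min_le_left _ _)) s hs (hK hU (hε.trans (min_le_right _ _)) s hs)⟩

/-- A solution `u = h + T u` of a linear Volterra equation with nonnegative kernel inherits the
bounds of `h` in any norm in which `T` is a contraction, as soon as `T` is also a contraction in
some norm in which `u` is known to be finite: `u` is then the sum of the Neumann series
`∑ T^k h`. No finiteness of `u` in the first norm is presupposed. -/
theorem volterra_bound {V U H : ℝ → Rn n → ℝ≥0∞} {b θ θ₂ A A₂ : ℝ}
    (hV : Measurable (Function.uncurry V)) (hUm : Measurable (Function.uncurry U))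
    (hHm : Measurable (Function.uncurry H)) (hθ : 0 < θ) (hθ1 : θ ≤ 1) (hθ₂ : 0 < θ₂)
    (hA : 0 < A) (hA₂ : 0 < A₂)
    (heq : ∀ t, 0 < t → ∀ᵐ x, U t x = H t x + duhamelOp 0 t (fun s y => V s y * U s y) x)
    (hH : ∀ t, 0 < t → invNorm θ (H t) ≤ ENNReal.ofReal (A * t ^ (-b)))
    (hU : ∀ t, 0 < t → invNorm θ₂ (U t) ≤ ENNReal.ofReal (A₂ * t ^ (-b)))
    (hT : ∀ {w : ℝ → Rn n → ℝ≥0∞} {K : ℝ}, Measurable (Function.uncurry w) → 0 < K →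
      (∀ t, 0 < t → invNorm θ (w t) ≤ ENNReal.ofReal (K * t ^ (-b))) → ∀ t, 0 < t →
        invNorm θ (duhamelOp 0 t (fun s y => V s y * w s y)) ≤ ENNReal.ofReal (K / 2 * t ^ (-b)))
    (hT₂ : ∀ {w : ℝ → Rn n → ℝ≥0∞} {K : ℝ}, Measurable (Function.uncurry w) → 0 < K →
      (∀ t, 0 < t → invNorm θ₂ (w t) ≤ ENNReal.ofReal (K * t ^ (-b))) → ∀ t, 0 < t →
        invNorm θ₂ (duhamelOp 0 t (fun s y => V s y * w s y)) ≤ ENNReal.ofReal (K / 2 * t ^ (-b))) :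
    ∀ t, 0 < t → invNorm θ (U t) ≤ ENNReal.ofReal (2 * A * t ^ (-b)) := by
  -- the partial sums of the Neumann series, and the remainders
  let T : (ℝ → Rn n → ℝ≥0∞) → ℝ → Rn n → ℝ≥0∞ := fun w t =>
    duhamelOp 0 t (fun s y => V s y * w s y)
  let S : ℕ → ℝ → Rn n → ℝ≥0∞ := fun k => Nat.rec (fun _ _ => 0) (fun _ w t x => H t x + T w t x) k
  let R : ℕ → ℝ → Rn n → ℝ≥0∞ := fun k => Nat.rec U (fun _ w => T w) k
  have hTm : ∀ w, Measurable (Function.uncurry w) → Measurable (Function.uncurry (T w)) :=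
    fun w hw => measurable_uncurry_duhamelOp (g := fun s y => V s y * w s y) (hV.mul hw) 0
  have hSm : ∀ k, Measurable (Function.uncurry (S k)) := by
    intro k
    induction k with
    | zero => exact measurable_const
    | succ k ih => exact hHm.add (hTm _ ih)
  have hRm : ∀ k, Measurable (Function.uncurry (R k)) := by
    intro k
    induction k with
    | zero => exact hUm
    | succ k ih => exact hTm _ ih
  have hsum : ∀ k t, 0 < t → ∀ᵐ x, U t x = S k t x + R k t x := by
    intro k
    induction k with
    | zero => exact fun t ht => Eventually.of_forall fun x => (zero_add _).symm
    | succ k ih =>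
      intro t ht
      filter_upwards [heq t ht] with x hx
      have e1 : duhamelOp 0 t (fun s y => V s y * U s y) x =
          duhamelOp 0 t (fun s y => V s y * S k s y + V s y * R k s y) x := by
        refine duhamelOp_congr (fun s hs => ?_) x
        filter_upwards [ih s hs.1] with y hy
        rw [hy, mul_add]
      rw [hx, e1, duhamelOp_add (g := fun s y => V s y * S k s y) (hV.mul (hSm k)), ← add_assoc]
  have hmono : ∀ k t x, S k t x ≤ S (k + 1) t x := by
    intro k
    induction k with
    | zero => exact fun t x => zero_le
    | succ k ih =>
      intro t x
      refine add_le_add le_rfl (duhamelOp_mono (fun s hs => Eventually.of_forall fun y => ?_) x)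
      exact mul_le_mul' le_rfl (ih s y)
  have hSb : ∀ k t, 0 < t → invNorm θ (S k t) ≤ ENNReal.ofReal (2 * A * t ^ (-b)) := by
    intro k
    induction k with
    | zero =>
      intro t ht
      have : invNorm θ (S 0 t) = 0 := by
        have e0 : ∀ x, S 0 t x = 0 := fun x => rfl
        unfold invNorm
        simp only [e0]
        rw [ENNReal.zero_rpow_of_pos (by positivity), lintegral_zero, ENNReal.zero_rpow_of_pos hθ]
      rw [this]; exact zero_le
    | succ k ih =>
      intro t ht
      have ht' : 0 < t ^ (-b) := Real.rpow_pos_of_pos ht _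
      refine (invNorm_add_le hθ hθ1 (measurable_slice hHm t).aemeasurable
        (measurable_slice (hTm _ (hSm k)) t).aemeasurable).trans ?_
      refine (add_le_add (hH t ht) (hT (hSm k) (by positivity) ih t ht)).trans (le_of_eq ?_)
      rw [← ENNReal.ofReal_add (by positivity) (by positivity)]
      congr 1; ring
  have hRb : ∀ k t, 0 < t → invNorm θ₂ (R k t) ≤ ENNReal.ofReal (A₂ / 2 ^ k * t ^ (-b)) := by
    intro k
    induction k with
    | zero =>
      intro t ht
      rw [pow_zero, div_one]
      exact hU t ht
    | succ k ih =>
      intro t ht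
      refine (hT₂ (hRm k) (by positivity) ih t ht).trans (le_of_eq ?_)
      rw [pow_succ, div_div]
  intro t ht
  have hRslice : ∀ k, Measurable (R k t) := fun k => measurable_slice (hRm k) t
  -- the remainders vanish along a subsequence
  have hlim : ∀ᵐ x, liminf (fun k => R k t x ^ (1 / θ₂)) atTop = 0 := by
    have hm : ∀ k, Measurable fun x => R k t x ^ (1 / θ₂) := fun k => (hRslice k).pow_const _
    refine (lintegral_eq_zero_iff (Measurable.liminf hm)).1 ?_
    refine le_antisymm ((lintegral_liminf_le hm).trans ?_) zero_le
    have h0 : Tendsto (fun k : ℕ => ENNReal.ofReal (A₂ / 2 ^ k * t ^ (-b)) ^ (1 / θ₂)) atTop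
        (𝓝 0) := by
      have h1 : Tendsto (fun k : ℕ => A₂ / 2 ^ k * t ^ (-b)) atTop (𝓝 0) := by
        have := (tendsto_pow_atTop_nhds_zero_of_lt_one (r := (1 / 2 : ℝ)) (by norm_num)
          (by norm_num)).const_mul (A₂ * t ^ (-b))
        rw [mul_zero] at this
        refine this.congr fun k => ?_
        rw [one_div, inv_pow]; ring
      have h2 := (ENNReal.continuous_rpow_const (y := 1 / θ₂)).tendsto 0 |>.comp
        (ENNReal.tendsto_ofReal h1 |>.trans (by simp))
      rw [ENNReal.zero_rpow_of_pos (by positivity)] at h2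
      exact h2
    refine (liminf_le_liminf (Eventually.of_forall fun k => ?_)).trans (le_of_eq h0.liminf_eq)
    rw [← invNorm_rpow_inv hθ₂]
    exact ENNReal.rpow_le_rpow (hRb k t ht) (by positivity)
  have hle : ∀ᵐ x, U t x ≤ ⨆ k, S k t x := by
    filter_upwards [hlim, ae_all_iff.2 fun k => hsum k t ht] with x hx hs
    refine ENNReal.le_of_forall_pos_le_add fun η hη _ => ?_
    have hfr : ∃ k, R k t x ≤ η := by
      by_contra! hcon
      have : (η : ℝ≥0∞) ^ (1 / θ₂) ≤ liminf (fun k => R k t x ^ (1 / θ₂)) atTop :=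
        le_liminf_of_le (by isBoundedDefault)
          (Eventually.of_forall fun k => ENNReal.rpow_le_rpow (hcon k).le (by positivity))
      rw [hx, nonpos_iff_eq_zero, ENNReal.rpow_eq_zero_iff_of_pos (by positivity)] at this
      exact hη.ne' (by exact_mod_cast this)
    obtain ⟨k, hk⟩ := hfr
    rw [hs k]
    exact add_le_add (le_iSup (fun k => S k t x) k) hk
  refine (invNorm_mono_ae hθ hle).trans ?_
  have e : ∫⁻ x, (⨆ k, S k t x) ^ (1 / θ) = ⨆ k, ∫⁻ x, S k t x ^ (1 / θ) := by
    rw [← lintegral_iSup (fun k => (measurable_slice (hSm k) t).pow_const _)]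
    · refine lintegral_congr fun x => ?_
      exact (ENNReal.orderIsoRpow (1 / θ) (by positivity)).map_iSup _
    · refine monotone_nat_of_le_succ fun k x => ?_
      exact ENNReal.rpow_le_rpow (hmono k t x) (by positivity)
  have h3 : ∫⁻ x, (⨆ k, S k t x) ^ (1 / θ) ≤ ENNReal.ofReal (2 * A * t ^ (-b)) ^ (1 / θ) := by
    rw [e]
    refine iSup_le fun k => ?_
    rw [← invNorm_rpow_inv hθ]
    exact ENNReal.rpow_le_rpow (hSb k t ht) (by positivity)
  unfold invNorm
  refine (ENNReal.rpow_le_rpow h3 hθ.le).trans (le_of_eq ?_)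
  rw [← ENNReal.rpow_mul, one_div_mul_cancel hθ.ne', ENNReal.rpow_one]

end

/-! ### Data in an exponent near two, and supremum decay -/

section

variable {n : ℕ}

/-- Interpolation between two Lebesgue norms, with a harmless factor `2`. -/
theorem invNorm_le_of_between {α : Type*} [MeasureSpace α] {θ₁ θ θ₂ A : ℝ} (h₁ : 0 < θ₁)
    (h : θ₁ ≤ θ) (h' : θ ≤ θ₂) (hθ1 : θ ≤ 1) (hA : 0 < A) {f : α → ℝ≥0∞} (hf : Measurable f)
    (hf₁ : invNorm θ₁ f ≤ ENNReal.ofReal A) (hf₂ : invNorm θ₂ f ≤ ENNReal.ofReal A) :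
    invNorm θ f ≤ ENNReal.ofReal (2 * A) := by
  have hθ : 0 < θ := h₁.trans_le h
  have hθ₂ : 0 < θ₂ := hθ.trans_le h'
  set c := ENNReal.ofReal A with hc
  have hc0 : c ≠ 0 := by rw [hc, Ne, ENNReal.ofReal_eq_zero, not_le]; exact hA
  have hct : c ≠ ∞ := ENNReal.ofReal_ne_top
  set g : α → ℝ≥0∞ := fun x => c⁻¹ * f x with hg
  have hgm : Measurable g := hf.const_mul _
  have hone : ∀ θ', 0 < θ' → invNorm θ' f ≤ c → ∫⁻ x, g x ^ (1 / θ') ≤ 1 := by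
    intro θ' hθ' hle
    rw [← invNorm_rpow_inv hθ', hg, invNorm_const_mul hθ' _ hf.aemeasurable]
    refine ENNReal.rpow_le_one ?_ (by positivity)
    calc c⁻¹ * invNorm θ' f ≤ c⁻¹ * c := by gcongr
      _ = 1 := ENNReal.inv_mul_cancel hc0 hct
  have hpt : ∀ x, g x ^ (1 / θ) ≤ g x ^ (1 / θ₁) + g x ^ (1 / θ₂) := by
    intro x
    rcases le_total (g x) 1 with h1 | h1
    · exact (ENNReal.rpow_le_rpow_of_exponent_ge h1 (one_div_le_one_div_of_le hθ h')).trans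
        le_add_self
    · exact (ENNReal.rpow_le_rpow_of_exponent_le h1 (one_div_le_one_div_of_le h₁ h)).trans
        le_self_add
  have hg2 : invNorm θ g ≤ 2 := by
    have : ∫⁻ x, g x ^ (1 / θ) ≤ 2 := by
      calc _ ≤ ∫⁻ x, (g x ^ (1 / θ₁) + g x ^ (1 / θ₂)) := lintegral_mono hpt
        _ = (∫⁻ x, g x ^ (1 / θ₁)) + ∫⁻ x, g x ^ (1 / θ₂) :=
            lintegral_add_left (hgm.pow_const _) _
        _ ≤ 1 + 1 := add_le_add (hone _ h₁ hf₁) (hone _ hθ₂ hf₂)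
        _ = 2 := one_add_one_eq_two
    unfold invNorm
    calc _ ≤ (2 : ℝ≥0∞) ^ θ := ENNReal.rpow_le_rpow this hθ.le
      _ ≤ 2 ^ (1 : ℝ) := ENNReal.rpow_le_rpow_of_exponent_le (by norm_num) hθ1
      _ = 2 := ENNReal.rpow_one 2
  rw [hg, invNorm_const_mul hθ _ hf.aemeasurable] at hg2
  calc invNorm θ f = c * (c⁻¹ * invNorm θ f) := by
        rw [← mul_assoc, ENNReal.mul_inv_cancel hc0 hct, one_mul]
    _ ≤ c * 2 := by gcongr
    _ = ENNReal.ofReal (2 * A) := by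
        rw [ENNReal.ofReal_mul (by norm_num), mul_comm]; simp [hc]

/-- Contraction of the Duhamel operator in the Kato space for data in `L^{1/θ}` propagates the
`L^{1/θ}` norm. -/
theorem SmallMild.invNorm_le_of_contraction (hn : 1 ≤ n) {ε θ A : ℝ} {Φ : Rn n → ℝ≥0∞}
    {U : ℝ → Rn n → ℝ≥0∞} (hU : SmallMild n ε Φ U) (hθ : 1 / 2 ≤ θ) (hθ1 : θ ≤ 1) (hA : 0 < A)
    (hΦ : invNorm θ Φ ≤ ENNReal.ofReal A)
    (hkato : ∀ t, 0 < t →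
      invNorm (katoExp n) (U t) ≤ ENNReal.ofReal (4 * ε * t ^ (-katoExp n)))
    (hT₂ : ∀ {w : ℝ → Rn n → ℝ≥0∞} {K : ℝ}, Measurable (Function.uncurry w) → 0 < K →
      (∀ t, 0 < t → invNorm (katoExp n) (w t) ≤ ENNReal.ofReal (K * t ^ (-katoExp n))) →
      ∀ t, 0 < t → invNorm (katoExp n) (duhamelOp 0 t (fun s y => potential n (U s y) * w s y)) ≤
        ENNReal.ofReal (K / 2 * t ^ (-katoExp n)))
    (hT : ∀ {w : ℝ → Rn n → ℝ≥0∞} {K : ℝ}, Measurable (Function.uncurry w) → 0 < K →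
      (∀ t, 0 < t → invNorm (θ - gainExp n) (w t) ≤ ENNReal.ofReal (K * t ^ (-katoExp n))) →
      ∀ t, 0 < t →
        invNorm (θ - gainExp n) (duhamelOp 0 t (fun s y => potential n (U s y) * w s y)) ≤
          ENNReal.ofReal (K / 2 * t ^ (-katoExp n)) ∧
        invNorm θ (duhamelOp 0 t (fun s y => potential n (U s y) * w s y)) ≤
          ENNReal.ofReal (K / 2)) :
    ∀ t, 0 < t → invNorm θ (U t) ≤ ENNReal.ofReal (2 * A) := by
  have hd := gainExp_pos n
  have hd3 := gainExp_le hn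
  have hε0 := hU.pos
  have hHm : Measurable (Function.uncurry fun (t : ℝ) => heatOp (n := n) t Φ) := by
    have h := (measurable_heatOp_sub (g := fun _ : ℝ => Φ) (hU.meas_init.comp measurable_snd)).comp
      (f := fun q : ℝ × Rn n => ((q.1, (0 : ℝ)), q.2)) (by fun_prop)
    simp only [Function.comp_def, sub_zero] at h
    exact h
  have hX := volterra_bound (θ := θ - gainExp n) (θ₂ := katoExp n) (b := katoExp n) (A := A)
    (A₂ := 4 * ε) hU.meas_potential hU.meas hHm (by linarith) (by linarith) (katoExp_pos hn) hA
    (by positivity) hU.eqn (fun t ht => ?_) hkato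
    (fun hw hK h t ht => (hT hw hK h t ht).1) hT₂
  · intro t ht
    rw [invNorm_congr_ae (hU.eqn t ht)]
    refine (invNorm_add_le (by linarith) hθ1 (measurable_heatOp t hU.meas_init).aemeasurable
      (measurable_duhamelOp hU.meas_source 0 t).aemeasurable).trans ?_
    rw [two_mul, ENNReal.ofReal_add hA.le hA.le]
    refine add_le_add ((invNorm_heatOp_le_self ht (by linarith) hθ1 hU.meas_init).trans hΦ) ?_
    have := (hT hU.meas (by positivity) hX t ht).2
    rwa [mul_div_cancel_left₀ _ (by norm_num)] at this
  · have ht' : 0 < t ^ (-katoExp n) := Real.rpow_pos_of_pos ht _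
    refine (invNorm_heatOp_le ht (by linarith) (by linarith) hθ1 hU.meas_init).trans ?_
    rw [sub_sub_cancel, half_mul_gainExp, mul_comm A, ENNReal.ofReal_mul ht'.le]
    gcongr

/-- Contraction in the Kato spaces for data in `L^{1/θ}`, `1/2 ≤ θ ≤ 1 - 1/(n+2)`. -/
theorem SmallMild.critical_contraction (hn : 1 ≤ n) :
    ∃ δ : ℝ, 0 < δ ∧ ∀ {ε : ℝ} {Φ : Rn n → ℝ≥0∞} {U : ℝ → Rn n → ℝ≥0∞},
      SmallMild n ε Φ U → ε ≤ δ → ∀ θ, 1 / 2 ≤ θ → θ ≤ 1 - gainExp n →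
      ∀ {w : ℝ → Rn n → ℝ≥0∞} {K : ℝ}, Measurable (Function.uncurry w) → 0 < K →
      (∀ t, 0 < t → invNorm (θ - gainExp n) (w t) ≤ ENNReal.ofReal (K * t ^ (-katoExp n))) →
      ∀ t, 0 < t →
        invNorm (θ - gainExp n) (duhamelOp 0 t (fun s y => potential n (U s y) * w s y)) ≤
          ENNReal.ofReal (K / 2 * t ^ (-katoExp n)) ∧
        invNorm θ (duhamelOp 0 t (fun s y => potential n (U s y) * w s y)) ≤
          ENNReal.ofReal (K / 2) := by
  have hn' : (0 : ℝ) < n := by exact_mod_cast hn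
  obtain ⟨δ₁, hδ₁, C, hC, hV⟩ := SmallMild.potential_critical_le hn
  obtain ⟨B, hB, hcrit⟩ := duhamelOp_critical_le hn
  obtain ⟨δ₂, hδ₂, hs2⟩ := exists_forall_mul_rpow_le_one (a := (4 : ℝ) / n) (K := 2 * (B * C))
    (by positivity) (by positivity)
  refine ⟨min δ₁ δ₂, by positivity, fun {ε Φ U} hU hε θ hθ hθ1 {w K} hw hK hwK t ht => ?_⟩
  have hε0 := hU.pos
  have h := hcrit (κ := C * ε ^ ((4 : ℝ) / n)) hU.meas_potential hw ht hθ hθ1 (by positivity) hK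
    (fun s hs => hV hU (hε.trans (min_le_left _ _)) s hs.1) (fun s hs => hwK s hs.1)
  have h3 := hs2 ε hε0 (hε.trans (min_le_right _ _))
  have h4 : B * (C * ε ^ ((4 : ℝ) / n)) * K ≤ K / 2 := by nlinarith
  have ht' : 0 < t ^ (-katoExp n) := Real.rpow_pos_of_pos ht _
  exact ⟨h.1.trans (ENNReal.ofReal_le_ofReal (by gcongr)),
    h.2.trans (ENNReal.ofReal_le_ofReal h4)⟩

theorem SmallMild.critical_contraction_kato (hn : 1 ≤ n) :
    ∃ δ : ℝ, 0 < δ ∧ ∀ {ε : ℝ} {Φ : Rn n → ℝ≥0∞} {U : ℝ → Rn n → ℝ≥0∞},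
      SmallMild n ε Φ U → ε ≤ δ →
      ∀ {w : ℝ → Rn n → ℝ≥0∞} {K : ℝ}, Measurable (Function.uncurry w) → 0 < K →
      (∀ t, 0 < t → invNorm (katoExp n) (w t) ≤ ENNReal.ofReal (K * t ^ (-katoExp n))) →
      ∀ t, 0 < t → invNorm (katoExp n) (duhamelOp 0 t (fun s y => potential n (U s y) * w s y)) ≤
        ENNReal.ofReal (K / 2 * t ^ (-katoExp n)) := by
  obtain ⟨δ, hδ, h⟩ := SmallMild.critical_contraction hn
  refine ⟨δ, hδ, fun {ε Φ U} hU hε {w K} hw hK hwK t ht => ?_⟩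
  have e : 1 / 2 - gainExp n = katoExp n := rfl
  have := (h hU hε (1 / 2) le_rfl (by linarith [gainExp_le hn]) hw hK (by rwa [e]) t ht).1
  rwa [e] at this

theorem SmallMild.invNorm_le_of_le_one_sub (hn : 1 ≤ n) :
    ∃ δ : ℝ, 0 < δ ∧ ∀ {ε : ℝ} {Φ : Rn n → ℝ≥0∞} {U : ℝ → Rn n → ℝ≥0∞},
      SmallMild n ε Φ U → ε ≤ δ → ∀ θ A, 1 / 2 ≤ θ → θ ≤ 1 - gainExp n → 0 < A →
        invNorm θ Φ ≤ ENNReal.ofReal A → ∀ t, 0 < t → invNorm θ (U t) ≤ ENNReal.ofReal (2 * A) := by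
  obtain ⟨δ₁, hδ₁, h₁⟩ := SmallMild.critical_contraction hn
  obtain ⟨δ₂, hδ₂, h₂⟩ := SmallMild.critical_contraction_kato hn
  obtain ⟨δ₃, hδ₃, h₃⟩ := SmallMild.kato_le hn
  refine ⟨min δ₁ (min δ₂ δ₃), by positivity, fun {ε Φ U} hU hε θ A hθ hθ1 hA hΦ => ?_⟩
  have e1 : ε ≤ δ₁ := hε.trans (min_le_left _ _)
  have e2 : ε ≤ δ₂ := hε.trans ((min_le_right _ _).trans (min_le_left _ _))
  have e3 : ε ≤ δ₃ := hε.trans ((min_le_right _ _).trans (min_le_right _ _))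
  exact hU.invNorm_le_of_contraction hn hθ (by linarith [gainExp_pos n]) hA hΦ (h₃ hU e3)
    (h₂ hU e2) (h₁ hU e1 θ hθ hθ1)

theorem rpow_half_neg_le_two_pow {t θ : ℝ} (ht : 0 < t) (hθ1 : θ ≤ 1) :
    (t / 2) ^ (-((n : ℝ) / 2 * θ)) ≤ 2 ^ n * t ^ (-((n : ℝ) / 2 * θ)) := by
  rw [Real.div_rpow ht.le (by norm_num), Real.rpow_neg (by norm_num : (0 : ℝ) ≤ 2), div_inv_eq_mul,
    mul_comm]
  gcongr
  rw [← Real.rpow_natCast]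
  refine Real.rpow_le_rpow_of_exponent_le (by norm_num) ?_
  have : (0 : ℝ) ≤ n := Nat.cast_nonneg n
  nlinarith

/-- Decay of the supremum norm from a uniform bound in `L^{1/θ}`: restarting at `t / 2`, a bound
`K t^{-nθ/2}` improves to `(2^n A + K / 2) t^{-nθ/2}`. -/
theorem SmallMild.sup_decay (hn : 1 ≤ n) :
    ∃ δ : ℝ, 0 < δ ∧ ∃ C : ℝ, 0 < C ∧ ∀ {ε : ℝ} {Φ : Rn n → ℝ≥0∞} {U : ℝ → Rn n → ℝ≥0∞},
      SmallMild n ε Φ U → ε ≤ δ → ∀ θ A, 0 < θ → θ ≤ 1 → 0 < A →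
        invNorm θ Φ ≤ ENNReal.ofReal A → (∀ t, 0 < t → invNorm θ (U t) ≤ ENNReal.ofReal A) →
        ∀ t, 0 < t → ∀ᵐ x, U t x ≤ ENNReal.ofReal (C * A * t ^ (-((n : ℝ) / 2 * θ))) := by
  have hn' : (1 : ℝ) ≤ n := by exact_mod_cast hn
  have hd := gainExp_pos n
  have hd3 := gainExp_le hn
  have hb := katoExp_pos hn
  have hdb := gainExp_eq n
  have hnd := half_mul_gainExp n
  obtain ⟨δ₁, hδ₁, C, hC, hV⟩ := SmallMild.potential_critical_le hn
  obtain ⟨C₁, hC₁, hle1⟩ := SmallMild.sup_le_of_le_one hn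
  obtain ⟨C₂, hC₂, hge1⟩ := SmallMild.sup_le_of_one_le hn
  obtain ⟨δ₂, hδ₂, hs2⟩ := exists_forall_mul_rpow_le_one (a := (4 : ℝ) / n)
    (K := 2 * (2 ^ n * C / (1 - 2 * katoExp n))) (by positivity) (by
      have : 0 < 1 - 2 * katoExp n := by linarith
      positivity)
  obtain ⟨δ₃, hδ₃, hs3⟩ := exists_forall_mul_rpow_le_one (a := 2) (K := 16 * (n : ℝ))
    (by norm_num) (by positivity)
  refine ⟨min δ₁ (min δ₂ δ₃), by positivity, 2 * 2 ^ n + 1, by positivity,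
    fun {ε Φ U} hU hε θ A hθ hθ1 hA hΦ hUA t₀ ht₀ => ?_⟩
  have hε0 := hU.pos
  have e1 : ε ≤ δ₁ := hε.trans (min_le_left _ _)
  have e2 := hs2 ε hε0 (hε.trans ((min_le_right _ _).trans (min_le_left _ _)))
  have e3 := hs3 ε hε0 (hε.trans ((min_le_right _ _).trans (min_le_right _ _)))
  rw [Real.rpow_two] at e3
  set γ := (n : ℝ) / 2 * θ with hγ
  have hγ0 : 0 < γ := by positivity
  set K₀ : ℝ := A + (C₁ + C₂) * ε * (1 + t₀) ^ γ with hK₀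
  -- a crude bound on the bounded time interval `(0, t₀]`
  have hcrude : ∀ t, 0 < t → t ≤ t₀ → ∀ᵐ x, U t x ≤ ENNReal.ofReal (K₀ * t ^ (-γ)) := by
    intro t ht htt
    have ht' : 0 < t ^ (-γ) := Real.rpow_pos_of_pos ht _
    have h1 : 1 ≤ (1 + t₀) ^ γ * t ^ (-γ) := by
      rw [Real.rpow_neg ht.le, ← div_eq_mul_inv, one_le_div (Real.rpow_pos_of_pos ht _)]
      exact Real.rpow_le_rpow ht.le (by linarith) hγ0.le
    have h2 : A * t ^ (-γ) + (C₁ + C₂) * ε ≤ K₀ * t ^ (-γ) := by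
      have : (C₁ + C₂) * ε * 1 ≤ (C₁ + C₂) * ε * ((1 + t₀) ^ γ * t ^ (-γ)) := by gcongr
      rw [hK₀]; nlinarith
    rcases le_total t 1 with h | h
    · filter_upwards [hle1 hU e3 θ t hθ hθ1 ht h] with x hx
      refine hx.trans (le_trans ?_ (ENNReal.ofReal_le_ofReal h2))
      rw [ENNReal.ofReal_add (by positivity) (by positivity), mul_comm A,
        ENNReal.ofReal_mul ht'.le]
      gcongr
      exact le_add_of_nonneg_right hC₂.le
    · filter_upwards [hge1 hU e3 t h] with x hx
      refine hx.trans (ENNReal.ofReal_le_ofReal (le_trans ?_ h2))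
      have : 0 < A * t ^ (-γ) := by positivity
      have : 0 < C₁ * ε := by positivity
      nlinarith
  have himp : ∀ K, 0 < K →
      (∀ t, 0 < t → t ≤ t₀ → ∀ᵐ x, U t x ≤ ENNReal.ofReal (K * t ^ (-γ))) →
      ∀ t, 0 < t → t ≤ t₀ → ∀ᵐ x, U t x ≤ ENNReal.ofReal ((2 ^ n * A + K / 2) * t ^ (-γ)) := by
    intro K hK hUK t ht htt
    have ht' : 0 < t ^ (-γ) := Real.rpow_pos_of_pos ht _
    have ht2 : 0 < t / 2 := by positivity
    have h2b : 0 < 1 - 2 * katoExp n := by linarith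
    filter_upwards [restart hU.meas_init hU.meas_source hU.eqn (τ := t / 2) (t := t) ht2
      (by linarith)] with x hx
    rw [hx, sub_half, add_mul, ENNReal.ofReal_add (by positivity) (by positivity)]
    refine add_le_add ?_ ?_
    · refine (heatOp_le ht2 hθ hθ1 (hU.meas_slice _) x).trans ?_
      rw [mul_right_comm, ENNReal.ofReal_mul (by positivity)]
      exact mul_le_mul' (ENNReal.ofReal_le_ofReal (rpow_half_neg_le_two_pow ht hθ1)) (hUA _ ht2)
    · have hsrc : ∀ s ∈ Set.Ioo (t / 2) t,
          invNorm (2 * gainExp n) (fun y => potential n (U s y) * U s y) ≤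
          ENNReal.ofReal (C * ε ^ ((4 : ℝ) / n) * s ^ (-(2 * gainExp n)) * (K * s ^ (-γ))) := by
        intro s hs
        have hs0 : 0 < s := ht2.trans hs.1
        have hs1 : 0 < s ^ (-(2 * gainExp n)) := Real.rpow_pos_of_pos hs0 _
        rw [mul_comm (C * ε ^ ((4 : ℝ) / n) * _), ENNReal.ofReal_mul (by positivity)]
        refine (invNorm_mono_ae (g := fun y => ENNReal.ofReal (K * s ^ (-γ)) * potential n (U s y))
          (by positivity) ?_).trans ?_
        · filter_upwards [hUK s hs0 (hs.2.le.trans htt)] with y hy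
          rw [mul_comm]
          gcongr
        · rw [invNorm_const_mul (by positivity) _
            (measurable_slice hU.meas_potential s).aemeasurable]
          exact mul_le_mul' le_rfl (hV hU e1 s hs0)
      refine (duhamelOp_le (by positivity) (by linarith) hU.meas_source hsrc x).trans ?_
      rw [show (n : ℝ) / 2 * (2 * gainExp n) = 2 * katoExp n by linarith]
      refine (lintegral_Ioo_mul_le (by linarith) (by linarith)
        (K := C * ε ^ ((4 : ℝ) / n) * (t / 2) ^ (-(2 * gainExp n)) * (K * (t / 2) ^ (-γ)))
        fun s hs => ?_).trans (ENNReal.ofReal_le_ofReal ?_)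
      · have hs0 : 0 < s := ht2.trans hs.1
        gcongr ?_ * ?_
        · gcongr ?_ * ?_
          exact Real.rpow_le_rpow_of_nonpos ht2 hs.1.le (by linarith)
        · gcongr ?_ * ?_
          exact Real.rpow_le_rpow_of_nonpos ht2 hs.1.le (by linarith)
      · rw [sub_half]
        have h5 : (t / 2) ^ (1 - 2 * katoExp n) * (t / 2) ^ (-(2 * gainExp n)) = 1 := by
          rw [← Real.rpow_add ht2, show 1 - 2 * katoExp n + -(2 * gainExp n) = 0 by linarith,
            Real.rpow_zero]
        calc (t / 2) ^ (1 - 2 * katoExp n) / (1 - 2 * katoExp n) *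
              (C * ε ^ ((4 : ℝ) / n) * (t / 2) ^ (-(2 * gainExp n)) * (K * (t / 2) ^ (-γ)))
            = ((t / 2) ^ (1 - 2 * katoExp n) * (t / 2) ^ (-(2 * gainExp n))) *
              (C / (1 - 2 * katoExp n) * ε ^ ((4 : ℝ) / n) * K * (t / 2) ^ (-γ)) := by ring
          _ ≤ C / (1 - 2 * katoExp n) * ε ^ ((4 : ℝ) / n) * K * (2 ^ n * t ^ (-γ)) := by
              rw [h5, one_mul]
              gcongr
              exact rpow_half_neg_le_two_pow ht hθ1
          _ = 2 * (2 ^ n * C / (1 - 2 * katoExp n)) * ε ^ ((4 : ℝ) / n) * (K / 2 * t ^ (-γ)) := by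
              ring
          _ ≤ 1 * (K / 2 * t ^ (-γ)) := by gcongr
          _ = _ := one_mul _
  have hiter : ∀ k : ℕ, ∀ t, 0 < t → t ≤ t₀ →
      ∀ᵐ x, U t x ≤ ENNReal.ofReal ((2 * 2 ^ n * A + K₀ / 2 ^ k) * t ^ (-γ)) := by
    have hK₀0 : 0 < K₀ := by positivity
    intro k
    induction k with
    | zero =>
      intro t ht htt
      filter_upwards [hcrude t ht htt] with x hx
      refine hx.trans (ENNReal.ofReal_le_ofReal ?_)
      rw [pow_zero, div_one]
      gcongr
      exact le_add_of_nonneg_left (by positivity)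
    | succ k ih =>
      intro t ht htt
      have := himp _ (by positivity) ih t ht htt
      filter_upwards [this] with x hx
      refine hx.trans (le_of_eq ?_)
      congr 2
      rw [pow_succ]; ring
  obtain ⟨k, hk⟩ : ∃ k : ℕ, K₀ / 2 ^ k ≤ A := by
    obtain ⟨k, hk⟩ := pow_unbounded_of_one_lt (K₀ / A) (one_lt_two (α := ℝ))
    refine ⟨k, ?_⟩
    rw [div_lt_iff₀ hA] at hk
    rw [div_le_iff₀ (by positivity)]
    linarith
  filter_upwards [hiter k t₀ ht₀ le_rfl] with x hx
  refine hx.trans (ENNReal.ofReal_le_ofReal ?_)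
  have : 0 < t₀ ^ (-γ) := Real.rpow_pos_of_pos ht₀ _
  gcongr
  linarith

end

/-! ### Data in Lebesgue exponents down to one -/

section

variable {n : ℕ}

/-- The weight `min(1, s^{-(4/3 - b)})`: the rate at which the potential of a solution with data in
`L^{3/2}` decays in `L^{n+2}`. The inverse exponent `2/3` satisfies `2/3 ≤ 1 - 1/(n+2)` in every
dimension `n ≥ 1`, and it exceeds `1/2`, which makes the decay integrable after multiplication by
`s^{-b}`. -/
noncomputable def superWeight (n : ℕ) (s : ℝ) : ℝ := min 1 (s ^ (-(4 / 3 - katoExp n)))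

theorem superWeight_pos {s : ℝ} (hs : 0 < s) : 0 < superWeight n s :=
  lt_min one_pos (Real.rpow_pos_of_pos hs _)

theorem measurable_superWeight : Measurable (superWeight n) := by
  unfold superWeight
  fun_prop

theorem superWeight_mul_le_left {s : ℝ} (hs : 0 < s) :
    superWeight n s * s ^ (-katoExp n) ≤ s ^ (-katoExp n) :=
  mul_le_of_le_one_left (Real.rpow_nonneg hs.le _) (min_le_left _ _)

theorem superWeight_mul_le_right {s : ℝ} (hs : 0 < s) :
    superWeight n s * s ^ (-katoExp n) ≤ s ^ (-(4 / 3) : ℝ) := by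
  calc superWeight n s * s ^ (-katoExp n)
      ≤ s ^ (-(4 / 3 - katoExp n)) * s ^ (-katoExp n) := by
        gcongr
        exact min_le_right _ _
    _ = s ^ (-(4 / 3) : ℝ) := by
        rw [← Real.rpow_add hs]; congr 1; ring

theorem superWeight_mul_le_inv {s : ℝ} (hs : 0 < s) :
    superWeight n s * s ^ (-katoExp n) ≤ s ^ (-1 : ℝ) := by
  have hb2 := katoExp_lt n
  rcases le_total s 1 with h | h
  · exact (superWeight_mul_le_left hs).trans
      (Real.rpow_le_rpow_of_exponent_ge hs h (by linarith))
  · exact (superWeight_mul_le_right hs).trans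
      (Real.rpow_le_rpow_of_exponent_le h (by norm_num))

theorem lintegral_superWeight_le (x : ℝ) :
    ∫⁻ s in Set.Ioo 0 x, ENNReal.ofReal (superWeight n s * s ^ (-katoExp n)) ≤
      ENNReal.ofReal (1 / (1 - katoExp n) + 3) := by
  have hb2 := katoExp_lt n
  have hsub : Set.Ioo 0 x ⊆ Set.Ioo 0 1 ∪ Set.Ici 1 := by
    intro s hs
    rcases lt_or_ge s 1 with h | h
    · exact Or.inl ⟨hs.1, h⟩
    · exact Or.inr h
  have h1b : 0 < 1 - katoExp n := by linarith
  refine (lintegral_mono_set hsub).trans ((lintegral_union_le _ _ _).trans ?_)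
  rw [ENNReal.ofReal_add (by positivity) (by norm_num)]
  refine add_le_add ?_ ?_
  · have h := lintegral_Ioo_rpow_neg (a := katoExp n) (x := 1) (by linarith) zero_le_one
    rw [Real.one_rpow] at h
    rw [← h]
    exact setLIntegral_mono' measurableSet_Ioo fun s hs =>
      ENNReal.ofReal_le_ofReal (superWeight_mul_le_left hs.1)
  · have h := lintegral_Ioi_rpow_neg (c := 4 / 3) (x := 1) (by norm_num) one_pos
    rw [Real.one_rpow, show (1 : ℝ) / (4 / 3 - 1) = 3 by norm_num] at h
    rw [← h, setLIntegral_congr (Ioi_ae_eq_Ici (μ := volume) (a := (1 : ℝ))).symm]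
    exact setLIntegral_mono' measurableSet_Ioi fun s hs =>
      ENNReal.ofReal_le_ofReal (superWeight_mul_le_right (one_pos.trans hs))

/-- A potential that is integrable in time at infinity acts on the Kato spaces for data in
`L^{1/θ}` up to `θ = 1`. -/
theorem duhamelOp_supercritical_le (hn : 1 ≤ n) :
    ∃ B : ℝ, 0 < B ∧ ∀ {V w : ℝ → Rn n → ℝ≥0∞} {t θ κ A : ℝ},
      Measurable (Function.uncurry V) → Measurable (Function.uncurry w) →
      0 < t → 1 / 2 ≤ θ → θ ≤ 1 → 0 < κ → 0 < A →
      (∀ s ∈ Set.Ioo 0 t, invNorm (gainExp n) (V s) ≤ ENNReal.ofReal (κ * superWeight n s)) →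
      (∀ s ∈ Set.Ioo 0 t,
        invNorm (θ - gainExp n) (w s) ≤ ENNReal.ofReal (A * s ^ (-katoExp n))) →
      invNorm (θ - gainExp n) (duhamelOp 0 t (fun s y => V s y * w s y)) ≤
        ENNReal.ofReal (B * κ * A * t ^ (-katoExp n)) ∧
      invNorm θ (duhamelOp 0 t (fun s y => V s y * w s y)) ≤ ENNReal.ofReal (B * κ * A) := by
  have hd := gainExp_pos n
  have hd3 := gainExp_le hn
  have hb := katoExp_pos hn
  have hb2 := katoExp_lt n
  have hnd := half_mul_gainExp n
  have hψ := lintegral_superWeight_le (n := n)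
  set d := gainExp n
  set b := katoExp n
  have h1b : 0 < 1 - b := by linarith
  set B₁ := 1 / (1 - b) + 3 with hB₁
  have hB₁0 : 0 < B₁ := by positivity
  refine ⟨2 * (B₁ + 1 / (1 - b)), by positivity,
    fun {V w t θ κ A} hV hw ht hθ hθ1 hκ hA hVa hwA => ?_⟩
  have hgen : ∀ θ', 0 < θ' → θ' ≤ θ →
      invNorm θ' (duhamelOp 0 t (fun s y => V s y * w s y)) ≤ ENNReal.ofReal (κ * A) *
        ∫⁻ s in Set.Ioo 0 t, ENNReal.ofReal
          ((t - s) ^ (-((n : ℝ) / 2 * (θ - θ'))) * (superWeight n s * s ^ (-b))) := by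
    intro θ' hθ' hθθ
    refine (invNorm_duhamelOp_mul_le (θ₁ := d) (θ₂ := θ - d) (by linarith) (by linarith)
      hθ' (by linarith) (by linarith) hV hw (a := fun s => κ * superWeight n s)
      (c := fun s => A * s ^ (-b)) (measurable_superWeight.const_mul κ) (by fun_prop)
      (fun s hs => mul_pos hκ (superWeight_pos hs.1))
      (fun s hs => mul_pos hA (Real.rpow_pos_of_pos hs.1 _)) hVa hwA).trans (le_of_eq ?_)
    rw [← lintegral_const_mul' _ _ ENNReal.ofReal_ne_top]
    refine lintegral_congr fun s => ?_
    rw [← ENNReal.ofReal_mul (by positivity), add_sub_cancel]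
    congr 1; ring
  constructor
  · refine (hgen (θ - d) (by linarith) (by linarith)).trans ?_
    rw [sub_sub_cancel, hnd]
    have h2 : 0 < t / 2 := by linarith
    have hI := lintegral_Ioo_zero_mul_le (a := b) (t := t) (K₁ := B₁) (K₂ := (t / 2) ^ (-1 : ℝ))
      (ψ := fun s => superWeight n s * s ^ (-b)) hb.le (by linarith) ht hB₁0.le (by positivity)
      (hψ _) (fun s hs => (superWeight_mul_le_inv (h2.trans_le hs.1)).trans
        (Real.rpow_le_rpow_of_nonpos h2 hs.1 (by norm_num)))
    refine (mul_le_mul' le_rfl hI).trans ?_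
    rw [← ENNReal.ofReal_mul (by positivity)]
    apply ENNReal.ofReal_le_ofReal
    have e : (t / 2) ^ (1 - b) / (1 - b) * (t / 2) ^ (-1 : ℝ) = 1 / (1 - b) * (t / 2) ^ (-b) := by
      rw [show -b = 1 - b + -1 by ring, Real.rpow_add h2]; ring
    rw [e]
    have h := rpow_half_neg_le ht (b := b) (by linarith)
    calc κ * A * ((t / 2) ^ (-b) * B₁ + 1 / (1 - b) * (t / 2) ^ (-b))
        = κ * A * (B₁ + 1 / (1 - b)) * (t / 2) ^ (-b) := by ring
      _ ≤ κ * A * (B₁ + 1 / (1 - b)) * (2 * t ^ (-b)) := by gcongr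
      _ = _ := by ring
  · refine (hgen θ (by linarith) le_rfl).trans ?_
    simp only [sub_self, mul_zero, neg_zero, Real.rpow_zero, one_mul]
    refine (mul_le_mul' le_rfl (hψ t)).trans ?_
    rw [← ENNReal.ofReal_mul (by positivity)]
    apply ENNReal.ofReal_le_ofReal
    have : 0 < 1 / (1 - b) := by positivity
    calc κ * A * B₁ = B₁ * κ * A := by ring
      _ ≤ _ := by gcongr; linarith

theorem gainExp_div (hn : 1 ≤ n) : gainExp n / ((4 : ℝ) / n) = katoExp n / 2 := by
  rw [← two_gainExp_div hn]; ring

/-- For data in `L^{3/2}` the potential decays at a rate that is integrable in time. -/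
theorem SmallMild.potential_supercritical_le (hn : 1 ≤ n) :
    ∃ δ : ℝ, 0 < δ ∧ ∃ C : ℝ, 0 < C ∧
      ∀ {ε : ℝ} {Φ : Rn n → ℝ≥0∞} {U : ℝ → Rn n → ℝ≥0∞}, SmallMild n ε Φ U → ε ≤ δ →
        invNorm (2 / 3) Φ ≤ ENNReal.ofReal (2 * ε) →
        ∀ s, 0 < s → invNorm (gainExp n) (fun x => potential n (U s x)) ≤
            ENNReal.ofReal (C * ε ^ ((4 : ℝ) / n) * superWeight n s) := by
  have hn' : (0 : ℝ) < n := by exact_mod_cast hn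
  have hd := gainExp_pos n
  have hd3 := gainExp_le hn
  have hb := katoExp_pos hn
  have hb2 := katoExp_lt n
  have hd2 : gainExp n ≤ 2 / n := by
    unfold gainExp
    gcongr
    · norm_num
    · linarith
  obtain ⟨C, hC, hp⟩ := SmallMild.invNorm_potential_le hn (θ := gainExp n) hd hd2
  obtain ⟨δ₁, hδ₁, hp1⟩ := SmallMild.potential_le_of_one_le hn
  obtain ⟨δ₂, hδ₂, hs2⟩ := exists_forall_mul_rpow_le_one (a := 2)
    (K := 16 * (1 / gainExp n)) (by norm_num) (by positivity)
  obtain ⟨δ₃, hδ₃, hle⟩ := SmallMild.invNorm_le_of_le_one_sub hn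
  obtain ⟨δ₄, hδ₄, C₁, hC₁, hsup⟩ := SmallMild.sup_decay hn
  set r : ℝ := katoExp n / 2 / (2 / 3) with hr
  have hr0 : 0 < r := by positivity
  have hr1 : 0 < 1 - r := by rw [hr]; linarith
  set C₂ : ℝ := 2 * ((4 * C₁) ^ (1 - r) * 4 ^ r) ^ ((4 : ℝ) / n) with hC₂
  refine ⟨min (min δ₁ δ₂) (min δ₃ δ₄), by positivity, C + C₂, by positivity,
    fun {ε Φ U} hU hε hΦ s hs => ?_⟩
  have hε0 := hU.pos
  have e1 : ε ≤ δ₁ := hε.trans ((min_le_left _ _).trans (min_le_left _ _))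
  have e2 := hs2 ε hε0 (hε.trans ((min_le_left _ _).trans (min_le_right _ _)))
  have e3 : ε ≤ δ₃ := hε.trans ((min_le_right _ _).trans (min_le_left _ _))
  have e4 : ε ≤ δ₄ := hε.trans ((min_le_right _ _).trans (min_le_right _ _))
  rw [Real.rpow_two] at e2
  have hεn : 0 < ε ^ ((4 : ℝ) / n) := Real.rpow_pos_of_pos hε0 _
  have hC₂0 : 0 < C₂ := by positivity
  rcases le_total s 1 with h1 | h1
  · refine (hp hU e2 s hs).trans (ENNReal.ofReal_le_ofReal ?_)
    have h4 : superWeight n s = 1 :=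
      min_eq_left (Real.one_le_rpow_of_pos_of_le_one_of_nonpos hs h1 (by linarith))
    rw [h4, mul_one]
    gcongr
    linarith
  · have h4 : superWeight n s = s ^ (-(4 / 3 - katoExp n)) :=
      min_eq_right (Real.rpow_le_one_of_one_le_of_nonpos h1 (by linarith))
    have hbd : ∀ t, 0 < t → invNorm (2 / 3) (U t) ≤ ENNReal.ofReal (4 * ε) := by
      intro t ht
      have := hle hU e3 (2 / 3) (2 * ε) (by norm_num) (by linarith) (by positivity) hΦ t ht
      rwa [← mul_assoc, show (2 : ℝ) * 2 = 4 by norm_num] at this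
    have hΦ' : invNorm (2 / 3) Φ ≤ ENNReal.ofReal (4 * ε) :=
      hΦ.trans (ENNReal.ofReal_le_ofReal (by linarith))
    have hsup' := hsup hU e4 (2 / 3) (4 * ε) (by norm_num) (by norm_num) (by positivity) hΦ'
      hbd s hs
    have hint := invNorm_le_of_le_const (θ := 2 / 3) (θ' := katoExp n / 2) (by positivity)
      (by linarith) hsup' (hU.meas_slice s).aemeasurable
    rw [← hr] at hint
    set P : ℝ := s ^ (-((n : ℝ) / 2 * (2 / 3))) with hP
    have hP0 : 0 < P := Real.rpow_pos_of_pos hs _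
    refine (invNorm_mono_ae hd (hp1 hU e1 s h1)).trans ?_
    rw [invNorm_const_mul hd _ ((hU.meas_slice s).pow_const _).aemeasurable,
      invNorm_rpow (by positivity), gainExp_div hn]
    have hint2 : invNorm (katoExp n / 2) (U s) ≤
        ENNReal.ofReal ((4 * C₁) ^ (1 - r) * 4 ^ r * ε * P ^ (1 - r)) := by
      refine hint.trans ?_
      calc ENNReal.ofReal (C₁ * (4 * ε) * P) ^ (1 - r) * invNorm (2 / 3) (U s) ^ r
          ≤ ENNReal.ofReal (C₁ * (4 * ε) * P) ^ (1 - r) * ENNReal.ofReal (4 * ε) ^ r := by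
            gcongr
            exact hbd s hs
        _ = _ := by
            rw [ENNReal.ofReal_rpow_of_pos (by positivity), ENNReal.ofReal_rpow_of_pos
              (by positivity), ← ENNReal.ofReal_mul (by positivity)]
            congr 1
            rw [show C₁ * (4 * ε) * P = 4 * C₁ * ε * P by ring,
              Real.mul_rpow (by positivity) hP0.le, Real.mul_rpow (by positivity) hε0.le,
              Real.mul_rpow (by norm_num) hε0.le]
            have : ε ^ (1 - r) * ε ^ r = ε := by
              rw [← Real.rpow_add hε0, sub_add_cancel, Real.rpow_one]
            linear_combination ((4 * C₁) ^ (1 - r) * 4 ^ r * P ^ (1 - r)) * this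
    have hPe : (P ^ (1 - r)) ^ ((4 : ℝ) / n) = s ^ (-(4 / 3 - katoExp n)) := by
      rw [hP, ← Real.rpow_mul hs.le, ← Real.rpow_mul hs.le, hr]
      congr 1
      field_simp
      ring
    calc 2 * invNorm (katoExp n / 2) (U s) ^ ((4 : ℝ) / n)
        ≤ 2 * ENNReal.ofReal ((4 * C₁) ^ (1 - r) * 4 ^ r * ε * P ^ (1 - r)) ^ ((4 : ℝ) / n) := by
          gcongr
      _ = ENNReal.ofReal (C₂ * ε ^ ((4 : ℝ) / n) * superWeight n s) := by
          rw [ENNReal.ofReal_rpow_of_nonneg (by positivity) (by positivity),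
            Real.mul_rpow (by positivity) (by positivity), Real.mul_rpow (by positivity) hε0.le,
            hPe, h4, show (2 : ℝ≥0∞) = ENNReal.ofReal 2 by simp, ← ENNReal.ofReal_mul (by norm_num),
            hC₂]
          congr 1; ring
      _ ≤ _ := by
          apply ENNReal.ofReal_le_ofReal
          have := superWeight_pos (n := n) hs
          gcongr
          linarith

/-- Contraction in the Kato spaces for data in `L^{1/θ}` for all `1/2 ≤ θ ≤ 1`. -/
theorem SmallMild.supercritical_contraction (hn : 1 ≤ n) :
    ∃ δ : ℝ, 0 < δ ∧ ∀ {ε : ℝ} {Φ : Rn n → ℝ≥0∞} {U : ℝ → Rn n → ℝ≥0∞},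
      SmallMild n ε Φ U → ε ≤ δ → invNorm (2 / 3) Φ ≤ ENNReal.ofReal (2 * ε) →
      ∀ θ, 1 / 2 ≤ θ → θ ≤ 1 →
      ∀ {w : ℝ → Rn n → ℝ≥0∞} {K : ℝ}, Measurable (Function.uncurry w) → 0 < K →
      (∀ t, 0 < t → invNorm (θ - gainExp n) (w t) ≤ ENNReal.ofReal (K * t ^ (-katoExp n))) →
      ∀ t, 0 < t →
        invNorm (θ - gainExp n) (duhamelOp 0 t (fun s y => potential n (U s y) * w s y)) ≤
          ENNReal.ofReal (K / 2 * t ^ (-katoExp n)) ∧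
        invNorm θ (duhamelOp 0 t (fun s y => potential n (U s y) * w s y)) ≤
          ENNReal.ofReal (K / 2) := by
  have hn' : (0 : ℝ) < n := by exact_mod_cast hn
  obtain ⟨δ₁, hδ₁, C, hC, hV⟩ := SmallMild.potential_supercritical_le hn
  obtain ⟨B, hB, hsuper⟩ := duhamelOp_supercritical_le hn
  obtain ⟨δ₂, hδ₂, hs2⟩ := exists_forall_mul_rpow_le_one (a := (4 : ℝ) / n) (K := 2 * (B * C))
    (by positivity) (by positivity)
  refine ⟨min δ₁ δ₂, by positivity, fun {ε Φ U} hU hε hΦ θ hθ hθ1 {w K} hw hK hwK t ht => ?_⟩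
  have hε0 := hU.pos
  have h := hsuper (κ := C * ε ^ ((4 : ℝ) / n)) hU.meas_potential hw ht hθ hθ1 (by positivity) hK
    (fun s hs => hV hU (hε.trans (min_le_left _ _)) hΦ s hs.1) (fun s hs => hwK s hs.1)
  have h3 := hs2 ε hε0 (hε.trans (min_le_right _ _))
  have h4 : B * (C * ε ^ ((4 : ℝ) / n)) * K ≤ K / 2 := by nlinarith
  have ht' : 0 < t ^ (-katoExp n) := Real.rpow_pos_of_pos ht _
  exact ⟨h.1.trans (ENNReal.ofReal_le_ofReal (by gcongr)),
    h.2.trans (ENNReal.ofReal_le_ofReal h4)⟩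

/-- The `L^{1/θ}` norm of a small solution stays bounded, for all `1/2 ≤ θ ≤ 1` and with a
threshold independent of `θ`. -/
theorem SmallMild.invNorm_le_init (hn : 1 ≤ n) :
    ∃ δ : ℝ, 0 < δ ∧ ∀ {ε : ℝ} {Φ : Rn n → ℝ≥0∞} {U : ℝ → Rn n → ℝ≥0∞},
      SmallMild n ε Φ U → ε ≤ δ → ∀ θ, 1 / 2 ≤ θ → θ ≤ 1 →
        invNorm θ Φ ≤ ENNReal.ofReal ε → ∀ t, 0 < t →
          invNorm θ (U t) ≤ ENNReal.ofReal (2 * ε) := by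
  have hd3 := gainExp_le hn
  obtain ⟨δ₀, hδ₀, h₀⟩ := SmallMild.invNorm_le_of_le_one_sub hn
  obtain ⟨δ₁, hδ₁, h₁⟩ := SmallMild.supercritical_contraction hn
  obtain ⟨δ₂, hδ₂, h₂⟩ := SmallMild.critical_contraction_kato hn
  obtain ⟨δ₃, hδ₃, h₃⟩ := SmallMild.kato_le hn
  refine ⟨min (min δ₀ δ₁) (min δ₂ δ₃), by positivity, fun {ε Φ U} hU hε θ hθ hθ1 hΦ => ?_⟩
  have e0 : ε ≤ δ₀ := hε.trans ((min_le_left _ _).trans (min_le_left _ _))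
  have e1 : ε ≤ δ₁ := hε.trans ((min_le_left _ _).trans (min_le_right _ _))
  have e2 : ε ≤ δ₂ := hε.trans ((min_le_right _ _).trans (min_le_left _ _))
  have e3 : ε ≤ δ₃ := hε.trans ((min_le_right _ _).trans (min_le_right _ _))
  rcases le_total θ (2 / 3) with h | h
  · exact h₀ hU e0 θ ε hθ (by linarith) hU.pos hΦ
  · refine hU.invNorm_le_of_contraction hn hθ hθ1 hU.pos hΦ (h₃ hU e3) (h₂ hU e2)
      (h₁ hU e1 ?_ θ hθ hθ1)
    exact invNorm_le_of_between (θ₁ := 1 / 2) (θ₂ := θ) (by norm_num) (by norm_num) h (by norm_num)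
      hU.pos hU.meas_init hU.init_le hΦ

/-- The decay of the supremum norm of a small solution, with constants independent of `θ`. -/
theorem SmallMild.sup_le (hn : 1 ≤ n) :
    ∃ δ : ℝ, 0 < δ ∧ ∃ C : ℝ, 0 < C ∧ ∀ {ε : ℝ} {Φ : Rn n → ℝ≥0∞} {U : ℝ → Rn n → ℝ≥0∞},
      SmallMild n ε Φ U → ε ≤ δ → ∀ θ, 1 / 2 ≤ θ → θ ≤ 1 →
        invNorm θ Φ ≤ ENNReal.ofReal ε → ∀ t, 0 < t →
          ∀ᵐ x, U t x ≤ ENNReal.ofReal (C * ε * t ^ (-((n : ℝ) / 2 * θ))) := by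
  obtain ⟨δ₁, hδ₁, h₁⟩ := SmallMild.invNorm_le_init hn
  obtain ⟨δ₂, hδ₂, C, hC, h₂⟩ := SmallMild.sup_decay hn
  refine ⟨min δ₁ δ₂, by positivity, C * 2, by positivity, fun {ε Φ U} hU hε θ hθ hθ1 hΦ => ?_⟩
  have hε0 := hU.pos
  have := h₂ hU (hε.trans (min_le_right _ _)) θ (2 * ε) (by linarith) hθ1 (by positivity)
    (hΦ.trans (ENNReal.ofReal_le_ofReal (by linarith)))
    (h₁ hU (hε.trans (min_le_left _ _)) θ hθ hθ1 hΦ)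
  rwa [← mul_assoc] at this

end

/-! ### Decay rates and large-time behaviour -/

section

variable {n : ℕ}

/-- Interpolation between `L^{1/θ}` and a decaying supremum bound, in real form. -/
theorem invNorm_le_of_decay {θ θ' a c t : ℝ} (hθ' : 0 < θ') (h : θ' ≤ θ) (ha : 0 < a) (hc : 0 < c)
    (ht : 0 < t) {f : Rn n → ℝ≥0∞} (hf : Measurable f)
    (hsup : ∀ᵐ x, f x ≤ ENNReal.ofReal (a * t ^ (-((n : ℝ) / 2 * θ))))
    (hnorm : invNorm θ f ≤ ENNReal.ofReal c) :
    invNorm θ' f ≤ ENNReal.ofReal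
      (a ^ (1 - θ' / θ) * c ^ (θ' / θ) * t ^ (-((n : ℝ) / 2 * (θ - θ')))) := by
  have hθ : 0 < θ := hθ'.trans_le h
  have ht' : 0 < t ^ (-((n : ℝ) / 2 * θ)) := Real.rpow_pos_of_pos ht _
  refine (invNorm_le_of_le_const hθ' h hsup hf.aemeasurable).trans ?_
  calc _ ≤ ENNReal.ofReal (a * t ^ (-((n : ℝ) / 2 * θ))) ^ (1 - θ' / θ) *
        ENNReal.ofReal c ^ (θ' / θ) := by gcongr
    _ = _ := by
        rw [ENNReal.ofReal_rpow_of_pos (by positivity), ENNReal.ofReal_rpow_of_pos hc,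
          ← ENNReal.ofReal_mul (by positivity), Real.mul_rpow ha.le ht'.le, ← Real.rpow_mul ht.le]
        have : -((n : ℝ) / 2 * θ) * (1 - θ' / θ) = -((n : ℝ) / 2 * (θ - θ')) := by
          field_simp
        rw [this]
        congr 1; ring

/-- The decay of all Lebesgue norms, with constants depending only on the dimension. -/
theorem SmallMild.invNorm_decay (hn : 1 ≤ n) :
    ∃ δ : ℝ, 0 < δ ∧ ∃ C : ℝ, 0 < C ∧ ∀ {ε : ℝ} {Φ : Rn n → ℝ≥0∞} {U : ℝ → Rn n → ℝ≥0∞},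
      SmallMild n ε Φ U → ε ≤ δ → ∀ θ θ', 1 / 2 ≤ θ → θ ≤ 1 → 0 < θ' → θ' ≤ θ →
        invNorm θ Φ ≤ ENNReal.ofReal ε → ∀ t, 0 < t →
          invNorm θ' (U t) ≤ ENNReal.ofReal (C * ε * t ^ (-((n : ℝ) / 2 * (θ - θ')))) := by
  obtain ⟨δ₁, hδ₁, h₁⟩ := SmallMild.invNorm_le_init hn
  obtain ⟨δ₂, hδ₂, C, hC, h₂⟩ := SmallMild.sup_le hn
  refine ⟨min δ₁ δ₂, by positivity, C + 2, by positivity,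
    fun {ε Φ U} hU hε θ θ' hθ hθ1 hθ' hθθ hΦ t ht => ?_⟩
  have hε0 := hU.pos
  have hθ0 : 0 < θ := by linarith
  have ht' : 0 < t ^ (-((n : ℝ) / 2 * (θ - θ'))) := Real.rpow_pos_of_pos ht _
  have hr : 0 ≤ 1 - θ' / θ := sub_nonneg.2 ((div_le_one hθ0).2 hθθ)
  refine (invNorm_le_of_decay hθ' hθθ (by positivity) (by positivity) ht (hU.meas_slice t)
    (h₂ hU (hε.trans (min_le_right _ _)) θ hθ hθ1 hΦ t ht)
    (h₁ hU (hε.trans (min_le_left _ _)) θ hθ hθ1 hΦ t ht)).trans (ENNReal.ofReal_le_ofReal ?_)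
  refine mul_le_mul_of_nonneg_right ?_ ht'.le
  calc (C * ε) ^ (1 - θ' / θ) * (2 * ε) ^ (θ' / θ)
      ≤ ((C + 2) * ε) ^ (1 - θ' / θ) * ((C + 2) * ε) ^ (θ' / θ) := by
        gcongr <;> linarith
    _ = (C + 2) * ε := by
        rw [← Real.rpow_add (by positivity), sub_add_cancel, Real.rpow_one]

/-- The decay estimate without singularity at `t = 0`, for finite exponents. -/
theorem SmallMild.invNorm_decay_one_add (hn : 1 ≤ n) :
    ∃ δ : ℝ, 0 < δ ∧ ∀ θ', 0 < θ' → ∃ C : ℝ, 0 < C ∧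
      ∀ {ε : ℝ} {Φ : Rn n → ℝ≥0∞} {U : ℝ → Rn n → ℝ≥0∞},
      SmallMild n ε Φ U → ε ≤ δ → ∀ θ, 1 / 2 ≤ θ → θ ≤ 1 → θ' ≤ θ →
        invNorm θ Φ ≤ ENNReal.ofReal ε → ∀ t, 0 < t →
          invNorm θ' (U t) ≤ ENNReal.ofReal (C * ε * (1 + t) ^ (-((n : ℝ) / 2 * (θ - θ')))) := by
  obtain ⟨δ₁, hδ₁, h₁⟩ := SmallMild.invNorm_le_init hn
  obtain ⟨δ₂, hδ₂, C, hC, h₂⟩ := SmallMild.invNorm_decay hn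
  refine ⟨min δ₁ δ₂, by positivity, fun θ' hθ' => ?_⟩
  obtain ⟨C₁, hC₁, hlow⟩ : ∃ C₁ : ℝ, 0 < C₁ ∧
      ∀ {ε : ℝ} {Φ : Rn n → ℝ≥0∞} {U : ℝ → Rn n → ℝ≥0∞}, SmallMild n ε Φ U → ε ≤ δ₁ →
        ∀ θ, 1 / 2 ≤ θ → θ ≤ 1 → θ' ≤ θ → invNorm θ Φ ≤ ENNReal.ofReal ε → ∀ t, 0 < t →
          invNorm θ' (U t) ≤ ENNReal.ofReal (C₁ * ε) := by
    rcases le_total θ' (1 / 2) with h | h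
    · obtain ⟨C₁, hC₁, h⟩ := SmallMild.invNorm_le hθ' h
      exact ⟨C₁, hC₁, fun {ε Φ U} hU _ θ _ _ _ _ t ht => h hU t ht⟩
    · obtain ⟨C₁, hC₁, h3⟩ := SmallMild.invNorm_le (θ := 1 / 2) (by norm_num) le_rfl
      refine ⟨2 * (C₁ + 2), by positivity, fun {ε Φ U} hU hε θ hθ hθ1 hθθ hΦ t ht => ?_⟩
      have hε0 := hU.pos
      rw [mul_assoc]
      exact invNorm_le_of_between (by norm_num) h hθθ (hθθ.trans hθ1) (by positivity)
        (hU.meas_slice t)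
        ((h3 hU t ht).trans (ENNReal.ofReal_le_ofReal (by gcongr; linarith)))
        ((h₁ hU hε θ hθ hθ1 hΦ t ht).trans (ENNReal.ofReal_le_ofReal (by gcongr; linarith)))
  refine ⟨(C₁ + C) * 2 ^ n, by positivity, fun {ε Φ U} hU hε θ hθ hθ1 hθθ hΦ t ht => ?_⟩
  have hε0 := hU.pos
  set e : ℝ := (n : ℝ) / 2 * (θ - θ') with he
  have hn' : (0 : ℝ) ≤ n := Nat.cast_nonneg n
  have he0 : 0 ≤ e := mul_nonneg (by positivity) (by linarith)
  have hen : e ≤ n := by nlinarith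
  have h2e : (2 : ℝ) ^ e ≤ 2 ^ n := by
    rw [← Real.rpow_natCast]
    exact Real.rpow_le_rpow_of_exponent_le (by norm_num) hen
  -- `m = 1 + t` and `m = (1 + t) / t` compare `1` and `t ^ (-e)` with `(1 + t) ^ (-e)`
  have key : ∀ m : ℝ, 0 < m → m ≤ 2 → ((1 + t) / m) ^ (-e) ≤ 2 ^ n * (1 + t) ^ (-e) := by
    intro m hm hm2
    rw [Real.div_rpow (by positivity) hm.le, Real.rpow_neg hm.le, div_inv_eq_mul, mul_comm]
    gcongr
    exact (Real.rpow_le_rpow hm.le hm2 he0).trans h2e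
  have h1t : 0 < 1 + t := by linarith
  rcases le_total t 1 with h | h
  · refine (hlow hU (hε.trans (min_le_left _ _)) θ hθ hθ1 hθθ hΦ t ht).trans
      (ENNReal.ofReal_le_ofReal ?_)
    have h3 := key (1 + t) h1t (by linarith)
    rw [div_self h1t.ne', Real.one_rpow] at h3
    calc C₁ * ε ≤ (C₁ + C) * ε * 1 := by rw [mul_one]; gcongr; linarith
      _ ≤ (C₁ + C) * ε * (2 ^ n * (1 + t) ^ (-e)) := by gcongr
      _ = _ := by ring
  · refine (h₂ hU (hε.trans (min_le_right _ _)) θ θ' hθ hθ1 hθ' hθθ hΦ t ht).trans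
      (ENNReal.ofReal_le_ofReal ?_)
    have hm2 : (1 + t) / t ≤ 2 := by rw [div_le_iff₀ ht]; linarith
    have h3 := key ((1 + t) / t) (by positivity) hm2
    rw [div_div_cancel₀ h1t.ne'] at h3
    calc C * ε * t ^ (-e) ≤ (C₁ + C) * ε * (2 ^ n * (1 + t) ^ (-e)) := by
          gcongr
          linarith
      _ = _ := by ring

/-- The heat semigroup tends to zero strongly in `L^{1/θ}` for exponents `1 < 1/θ < ∞`. -/
theorem eventually_invNorm_heatOp_le {θ : ℝ} (hθ : 0 < θ) (hθ1 : θ < 1) {f : Rn n → ℝ≥0∞}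
    (hn : 1 ≤ n) (hf : Measurable f) (hfin : invNorm θ f ≠ ∞) {η : ℝ} (hη : 0 < η) :
    ∀ᶠ t : ℝ in atTop, invNorm θ (heatOp t f) ≤ ENNReal.ofReal η := by
  have hn' : (0 : ℝ) < n := by exact_mod_cast hn
  have hint : ∫⁻ x, f x ^ (1 / θ) ≠ ∞ := by
    rw [← invNorm_rpow_inv hθ]
    exact ENNReal.rpow_ne_top_of_nonneg (by positivity) hfin
  -- split off the tail of `f` outside a large ball
  have htail : Tendsto (fun k : ℕ => invNorm θ ((Metric.ball (0 : Rn n) k)ᶜ.indicator f)) atTop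
      (𝓝 0) := by
    have h1 : Tendsto (fun k : ℕ => ∫⁻ x,
        (Metric.ball (0 : Rn n) k)ᶜ.indicator f x ^ (1 / θ)) atTop (𝓝 (∫⁻ _ : Rn n, 0)) := by
      refine tendsto_lintegral_of_dominated_convergence (fun x => f x ^ (1 / θ))
        (fun k => (hf.indicator Metric.isOpen_ball.measurableSet.compl).pow_const _)
        (fun k => Eventually.of_forall fun x => ?_) hint (Eventually.of_forall fun x => ?_)
      · exact ENNReal.rpow_le_rpow (Set.indicator_le_self _ _ _) (by positivity)
      · refine tendsto_const_nhds.congr' ?_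
        obtain ⟨k₀, hk₀⟩ := exists_nat_gt ‖x‖
        filter_upwards [eventually_ge_atTop k₀] with k hk
        have : x ∉ (Metric.ball (0 : Rn n) k)ᶜ := by
          simp only [Set.mem_compl_iff, Metric.mem_ball, dist_zero_right, not_not]
          exact hk₀.trans_le (by exact_mod_cast hk)
        rw [Set.indicator_of_notMem this, ENNReal.zero_rpow_of_pos (by positivity)]
    rw [lintegral_zero] at h1
    have h2 := (ENNReal.continuous_rpow_const (y := θ)).tendsto 0 |>.comp h1
    rw [ENNReal.zero_rpow_of_pos hθ] at h2
    exact h2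
  obtain ⟨k, hk⟩ := (htail.eventually_le_const
    (show 0 < ENNReal.ofReal (η / 2) by rw [ENNReal.ofReal_pos]; positivity)).exists
  set B := Metric.ball (0 : Rn n) k with hB
  have hBm : MeasurableSet B := Metric.isOpen_ball.measurableSet
  set f₁ : Rn n → ℝ≥0∞ := B.indicator f with hf₁
  have hf₁m : Measurable f₁ := hf.indicator hBm
  have hf₁fin : invNorm 1 f₁ ≠ ∞ := by
    have h1 : invNorm (θ + (1 - θ)) (fun x => f x * B.indicator 1 x) ≤
        invNorm θ f * invNorm (1 - θ) (B.indicator 1) :=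
      invNorm_mul_le hθ (by linarith) hf.aemeasurable (measurable_one.indicator hBm).aemeasurable
    have e1 : ∀ x, f x * B.indicator 1 x = f₁ x := by
      intro x
      by_cases hx : x ∈ B <;> simp [hf₁, hx]
    rw [add_sub_cancel] at h1
    simp_rw [e1] at h1
    refine ne_top_of_le_ne_top (ENNReal.mul_ne_top hfin ?_) h1
    unfold invNorm
    refine ENNReal.rpow_ne_top_of_nonneg (by linarith) ?_
    have e2 : ∀ x, (B.indicator (1 : Rn n → ℝ≥0∞) x) ^ (1 / (1 - θ)) = B.indicator 1 x := by
      intro x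
      have : 0 < 1 / (1 - θ) := by
        have : 0 < 1 - θ := by linarith
        positivity
      by_cases hx : x ∈ B
      · simp [hx]
      · simp only [Set.indicator_of_notMem hx]
        exact ENNReal.zero_rpow_of_pos this
    simp_rw [e2]
    rw [lintegral_indicator_one hBm]
    exact measure_ball_lt_top.ne
  have hdecay : Tendsto (fun t : ℝ => ENNReal.ofReal (t ^ (-((n : ℝ) / 2 * (1 - θ)))) *
      invNorm 1 f₁) atTop (𝓝 0) := by
    have h1 : Tendsto (fun t : ℝ => t ^ (-((n : ℝ) / 2 * (1 - θ)))) atTop (𝓝 0) :=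
      tendsto_rpow_neg_atTop (mul_pos (by positivity) (by linarith))
    have h2 := ENNReal.Tendsto.mul_const (ENNReal.tendsto_ofReal h1) (Or.inr hf₁fin)
    simpa using h2
  filter_upwards [hdecay.eventually_le_const
    (show 0 < ENNReal.ofReal (η / 2) by rw [ENNReal.ofReal_pos]; positivity),
    eventually_gt_atTop 0] with t ht ht0
  have e3 : f = fun x => f₁ x + Bᶜ.indicator f x := by
    funext x
    exact (congrFun (Set.indicator_self_add_compl B f) x).symm
  have hcm : Measurable (Bᶜ.indicator f) := hf.indicator hBm.compl
  have e4 : invNorm θ (heatOp t f) =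
      invNorm θ (fun x => heatOp t f₁ x + heatOp t (Bᶜ.indicator f) x) := by
    refine invNorm_congr_ae (Eventually.of_forall fun x => ?_)
    conv_lhs => rw [e3]
    exact heatOp_add t hf₁m x
  rw [e4]
  refine (invNorm_add_le hθ hθ1.le (measurable_heatOp t hf₁m).aemeasurable
    (measurable_heatOp t hcm).aemeasurable).trans ?_
  calc _ ≤ ENNReal.ofReal (η / 2) + ENNReal.ofReal (η / 2) :=
        add_le_add ((invNorm_heatOp_le ht0 hθ hθ1.le le_rfl hf₁m).trans ht)
          ((invNorm_heatOp_le_self ht0 hθ hθ1.le hcm).trans hk)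
    _ = ENNReal.ofReal η := by
        rw [← ENNReal.ofReal_add (by positivity) (by positivity), add_halves]

theorem heatOp_const {t : ℝ} (ht : 0 < t) (c : ℝ≥0∞) (x : Rn n) :
    heatOp t (fun _ => c) x = c := by
  unfold heatOp
  rw [lintegral_mul_const _ (measurable_heatKernel_right t x), lintegral_heatKernel' ht, one_mul]

theorem duhamelOp_le_of_le_const {τ t : ℝ} {g : ℝ → Rn n → ℝ≥0∞} {c : ℝ≥0∞}
    (h : ∀ s ∈ Set.Ioo τ t, ∀ᵐ y, g s y ≤ c) (x : Rn n) :
    duhamelOp τ t g x ≤ c * ENNReal.ofReal (t - τ) := by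
  refine (duhamelOp_mono (g' := fun _ _ => c) h x).trans (le_of_eq ?_)
  unfold duhamelOp
  rw [setLIntegral_congr_fun (g := fun _ => c) measurableSet_Ioo
    fun s hs => heatOp_const (by linarith [hs.2]) c x, setLIntegral_const, Real.volume_Ioo]

/-- For data in `L^{1/θ}` the potential decays like `t^{-2θ}` in the supremum norm. -/
theorem SmallMild.potential_sup_le (hn : 1 ≤ n) :
    ∃ δ : ℝ, 0 < δ ∧ ∀ {ε : ℝ} {Φ : Rn n → ℝ≥0∞} {U : ℝ → Rn n → ℝ≥0∞},
      SmallMild n ε Φ U → ε ≤ δ → ∃ K : ℝ, 0 < K ∧ ∀ θ, 1 / 2 ≤ θ → θ ≤ 1 →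
        invNorm θ Φ ≤ ENNReal.ofReal ε → ∀ t, 1 ≤ t →
          ∀ᵐ x, potential n (U t x) ≤ ENNReal.ofReal (K * t ^ (-(2 * θ))) := by
  have hn' : (0 : ℝ) < n := by exact_mod_cast hn
  obtain ⟨δ₁, hδ₁, h₁⟩ := SmallMild.potential_le_of_one_le hn
  obtain ⟨δ₂, hδ₂, C, hC, h₂⟩ := SmallMild.sup_le hn
  refine ⟨min δ₁ δ₂, by positivity, fun {ε Φ U} hU hε => ?_⟩
  have hε0 := hU.pos
  refine ⟨2 * (C * ε) ^ ((4 : ℝ) / n), by positivity, fun θ hθ hθ1 hΦ t ht => ?_⟩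
  have ht0 : 0 < t := by linarith
  filter_upwards [h₁ hU (hε.trans (min_le_left _ _)) t ht,
    h₂ hU (hε.trans (min_le_right _ _)) θ hθ hθ1 hΦ t ht0] with x hx hx2
  refine hx.trans ?_
  calc 2 * U t x ^ ((4 : ℝ) / n)
      ≤ 2 * ENNReal.ofReal (C * ε * t ^ (-((n : ℝ) / 2 * θ))) ^ ((4 : ℝ) / n) := by gcongr
    _ = _ := by
        rw [ENNReal.ofReal_rpow_of_nonneg (by positivity) (by positivity),
          Real.mul_rpow (by positivity) (by positivity), ← Real.rpow_mul ht0.le,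
          show (2 : ℝ≥0∞) = ENNReal.ofReal 2 by simp, ← ENNReal.ofReal_mul (by norm_num)]
        have : -((n : ℝ) / 2 * θ) * (4 / n) = -(2 * θ) := by
          field_simp
          ring
        rw [this, mul_assoc]

/-- For data in `L^{1/θ}` with `1 < 1/θ < 2` the `L^{1/θ}` norm of the solution tends to zero. -/
theorem SmallMild.eventually_invNorm_le (hn : 1 ≤ n) :
    ∃ δ : ℝ, 0 < δ ∧ ∀ {ε : ℝ} {Φ : Rn n → ℝ≥0∞} {U : ℝ → Rn n → ℝ≥0∞},
      SmallMild n ε Φ U → ε ≤ δ → ∀ θ, 1 / 2 < θ → θ < 1 →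
        invNorm θ Φ ≤ ENNReal.ofReal ε → ∀ η : ℝ, 0 < η →
          ∀ᶠ t : ℝ in atTop, invNorm θ (U t) ≤ ENNReal.ofReal η := by
  obtain ⟨δ₁, hδ₁, h₁⟩ := SmallMild.invNorm_le_init hn
  obtain ⟨δ₂, hδ₂, h₂⟩ := SmallMild.potential_sup_le hn
  refine ⟨min δ₁ δ₂, by positivity, fun {ε Φ U} hU hε θ hθ hθ1 hΦ η hη => ?_⟩
  have hε0 := hU.pos
  have hθ0 : 0 < θ := by linarith
  obtain ⟨K, hK, hV⟩ := h₂ hU (hε.trans (min_le_right _ _))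
  have hnorm := h₁ hU (hε.trans (min_le_left _ _)) θ hθ.le hθ1.le hΦ
  have htail : Tendsto (fun τ : ℝ => K * (2 * ε) / (2 * θ - 1) * τ ^ (-(2 * θ - 1))) atTop
      (𝓝 0) := by
    have := (tendsto_rpow_neg_atTop (y := 2 * θ - 1) (by linarith)).const_mul
      (K * (2 * ε) / (2 * θ - 1))
    rwa [mul_zero] at this
  obtain ⟨τ, hτ, hτ1⟩ := ((htail.eventually_le_const (show 0 < η / 2 by positivity)).and
    (eventually_ge_atTop 1)).exists
  have hτ0 : 0 < τ := by linarith
  have hheat := eventually_invNorm_heatOp_le hθ0 hθ1 hn (hU.meas_slice τ)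
    (ne_top_of_le_ne_top ENNReal.ofReal_ne_top (hnorm τ hτ0)) (show 0 < η / 2 by positivity)
  have hshift : Tendsto (fun t : ℝ => t - τ) atTop atTop :=
    tendsto_atTop_add_const_right _ _ tendsto_id
  filter_upwards [hshift.eventually hheat, eventually_gt_atTop τ] with t ht htτ
  rw [invNorm_congr_ae (restart hU.meas_init hU.meas_source hU.eqn hτ0 htτ)]
  refine (invNorm_add_le hθ0 hθ1.le (measurable_heatOp _ (hU.meas_slice τ)).aemeasurable
    (measurable_duhamelOp hU.meas_source τ t).aemeasurable).trans ?_
  rw [show η = η / 2 + η / 2 by ring, ENNReal.ofReal_add (by positivity) (by positivity)]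
  refine add_le_add ht ?_
  refine (invNorm_duhamelOp_le hθ0 le_rfl hθ1.le hU.meas_source
    (a := fun s => K * (2 * ε) * s ^ (-(2 * θ))) (by fun_prop)
    (fun s hs => mul_pos (by positivity) (Real.rpow_pos_of_pos (hτ0.trans hs.1) _))
    fun s hs => ?_).trans ?_
  · have hs0 : 0 < s := hτ0.trans hs.1
    refine (invNorm_mono_ae (g := fun y => ENNReal.ofReal (K * s ^ (-(2 * θ))) * U s y) hθ0
      ?_).trans ?_
    · filter_upwards [hV θ hθ.le hθ1.le hΦ s (hτ1.trans hs.1.le)] with y hy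
      gcongr
    · have : 0 < s ^ (-(2 * θ)) := Real.rpow_pos_of_pos hs0 _
      rw [invNorm_const_mul hθ0 _ (hU.meas_slice s).aemeasurable,
        show K * (2 * ε) * s ^ (-(2 * θ)) = K * s ^ (-(2 * θ)) * (2 * ε) by ring,
        ENNReal.ofReal_mul (p := K * s ^ (-(2 * θ))) (by positivity)]
      exact mul_le_mul' le_rfl (hnorm s hs0)
  · simp only [sub_self, mul_zero, neg_zero, Real.rpow_zero, one_mul]
    calc ∫⁻ s in Set.Ioo τ t, ENNReal.ofReal (K * (2 * ε) * s ^ (-(2 * θ)))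
        ≤ ∫⁻ s in Set.Ioi τ, ENNReal.ofReal (K * (2 * ε)) * ENNReal.ofReal (s ^ (-(2 * θ))) := by
          refine (lintegral_mono_set Set.Ioo_subset_Ioi_self).trans (lintegral_mono fun s => ?_)
          rw [ENNReal.ofReal_mul (by positivity)]
      _ = ENNReal.ofReal (K * (2 * ε)) *
          ENNReal.ofReal (τ ^ (1 - 2 * θ) / (2 * θ - 1)) := by
          rw [lintegral_const_mul' _ _ ENNReal.ofReal_ne_top,
            lintegral_Ioi_rpow_neg (by linarith) hτ0]
      _ ≤ ENNReal.ofReal (η / 2) := by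
          rw [← ENNReal.ofReal_mul (by positivity)]
          refine ENNReal.ofReal_le_ofReal (le_trans (le_of_eq ?_) hτ)
          rw [neg_sub]; ring

/-- The supremum norm is `o(t^{-nθ/2})`: after a restart at `t / 2` the linear part is controlled by
the vanishing `L^{1/θ}` norm, and the nonlinear part gains the factor `t^{1-2θ}`. -/
theorem SmallMild.eventually_sup_le (hn : 1 ≤ n) :
    ∃ δ : ℝ, 0 < δ ∧ ∀ {ε : ℝ} {Φ : Rn n → ℝ≥0∞} {U : ℝ → Rn n → ℝ≥0∞},
      SmallMild n ε Φ U → ε ≤ δ → ∀ θ, 1 / 2 < θ → θ < 1 →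
        invNorm θ Φ ≤ ENNReal.ofReal ε → ∀ η : ℝ, 0 < η →
          ∀ᶠ t : ℝ in atTop, ∀ᵐ x, U t x ≤ ENNReal.ofReal (η * t ^ (-((n : ℝ) / 2 * θ))) := by
  obtain ⟨δ₁, hδ₁, h₁⟩ := SmallMild.eventually_invNorm_le hn
  obtain ⟨δ₂, hδ₂, h₂⟩ := SmallMild.potential_sup_le hn
  obtain ⟨δ₃, hδ₃, C, hC, h₃⟩ := SmallMild.sup_le hn
  refine ⟨min δ₁ (min δ₂ δ₃), by positivity, fun {ε Φ U} hU hε θ hθ hθ1 hΦ η hη => ?_⟩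
  have hε0 := hU.pos
  have hθ0 : 0 < θ := by linarith
  obtain ⟨K, hK, hV⟩ := h₂ hU (hε.trans ((min_le_right _ _).trans (min_le_left _ _)))
  have hsup := h₃ hU (hε.trans ((min_le_right _ _).trans (min_le_right _ _))) θ hθ.le hθ1.le hΦ
  have hnorm := h₁ hU (hε.trans (min_le_left _ _)) θ hθ hθ1 hΦ (η / 2 / 2 ^ n) (by positivity)
  have hhalf : Tendsto (fun t : ℝ => t / 2) atTop atTop := tendsto_id.atTop_div_const (by norm_num)
  have htail : Tendsto (fun τ : ℝ => K * (C * ε) * 2 ^ n * τ ^ (-(2 * θ - 1))) atTop (𝓝 0) := by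
    have := (tendsto_rpow_neg_atTop (y := 2 * θ - 1) (by linarith)).const_mul
      (K * (C * ε) * 2 ^ n)
    rwa [mul_zero] at this
  have hn0 : (0 : ℝ) ≤ n := Nat.cast_nonneg n
  set γ := (n : ℝ) / 2 * θ with hγ
  have hγ0 : 0 ≤ γ := by positivity
  filter_upwards [hhalf.eventually hnorm, hhalf.eventually (htail.eventually_le_const
    (show 0 < η / 2 by positivity)), eventually_ge_atTop 2] with t hn1 htl ht2
  have ht : 0 < t := by linarith
  have hth : 0 < t / 2 := by linarith
  have ht' : 0 < t ^ (-γ) := Real.rpow_pos_of_pos ht _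
  have hpow := rpow_half_neg_le_two_pow (n := n) ht hθ1.le
  rw [← hγ] at hpow
  filter_upwards [restart hU.meas_init hU.meas_source hU.eqn (τ := t / 2) (t := t) hth
    (by linarith)] with x hx
  rw [hx, sub_half, show η * t ^ (-γ) = η / 2 * t ^ (-γ) + η / 2 * t ^ (-γ) by ring,
    ENNReal.ofReal_add (by positivity) (by positivity)]
  refine add_le_add ?_ ?_
  · refine (heatOp_le hth hθ0 hθ1.le (hU.meas_slice _) x).trans ?_
    refine (mul_le_mul' (ENNReal.ofReal_le_ofReal hpow) hn1).trans ?_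
    rw [← ENNReal.ofReal_mul (by positivity)]
    refine ENNReal.ofReal_le_ofReal (le_of_eq ?_)
    field_simp
  · refine (duhamelOp_le_of_le_const
      (c := ENNReal.ofReal (K * (t / 2) ^ (-(2 * θ)) * (C * ε * (t / 2) ^ (-γ))))
      (fun s hs => ?_) x).trans ?_
    · have hs0 : 0 < s := hth.trans hs.1
      filter_upwards [hV θ hθ.le hθ1.le hΦ s (by linarith [hs.1]), hsup s hs0] with y hy1 hy2
      rw [ENNReal.ofReal_mul (by positivity)]
      refine mul_le_mul' (hy1.trans (ENNReal.ofReal_le_ofReal ?_))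
        (hy2.trans (ENNReal.ofReal_le_ofReal ?_))
      · gcongr ?_ * ?_
        exact Real.rpow_le_rpow_of_nonpos hth hs.1.le (by linarith)
      · gcongr ?_ * ?_
        exact Real.rpow_le_rpow_of_nonpos hth hs.1.le (by linarith)
    · rw [sub_half, ← ENNReal.ofReal_mul (by positivity)]
      apply ENNReal.ofReal_le_ofReal
      have e : (t / 2) ^ (-(2 * θ - 1)) = (t / 2) ^ (-(2 * θ)) * (t / 2) := by
        rw [neg_sub, sub_eq_neg_add, Real.rpow_add hth, Real.rpow_one]
      calc K * (t / 2) ^ (-(2 * θ)) * (C * ε * (t / 2) ^ (-γ)) * (t / 2)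
          = K * (C * ε) * (t / 2) ^ (-(2 * θ - 1)) * (t / 2) ^ (-γ) := by rw [e]; ring
        _ ≤ K * (C * ε) * (t / 2) ^ (-(2 * θ - 1)) * (2 ^ n * t ^ (-γ)) := by gcongr
        _ = K * (C * ε) * 2 ^ n * (t / 2) ^ (-(2 * θ - 1)) * t ^ (-γ) := by ring
        _ ≤ _ := by gcongr

theorem SmallMild.eventually_invNorm_decay (hn : 1 ≤ n) :
    ∃ δ : ℝ, 0 < δ ∧ ∀ {ε : ℝ} {Φ : Rn n → ℝ≥0∞} {U : ℝ → Rn n → ℝ≥0∞},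
      SmallMild n ε Φ U → ε ≤ δ → ∀ θ θ', 1 / 2 < θ → θ < 1 → 0 < θ' → θ' ≤ θ →
        invNorm θ Φ ≤ ENNReal.ofReal ε → ∀ η : ℝ, 0 < η → ∀ᶠ t : ℝ in atTop,
          invNorm θ' (U t) ≤ ENNReal.ofReal (η * t ^ (-((n : ℝ) / 2 * (θ - θ')))) := by
  obtain ⟨δ₁, hδ₁, h₁⟩ := SmallMild.eventually_invNorm_le hn
  obtain ⟨δ₂, hδ₂, h₂⟩ := SmallMild.eventually_sup_le hn
  refine ⟨min δ₁ δ₂, by positivity, fun {ε Φ U} hU hε θ θ' hθ hθ1 hθ' hθθ hΦ η hη => ?_⟩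
  filter_upwards [h₁ hU (hε.trans (min_le_left _ _)) θ hθ hθ1 hΦ η hη,
    h₂ hU (hε.trans (min_le_right _ _)) θ hθ hθ1 hΦ η hη, eventually_gt_atTop 0] with t h3 h4 ht
  have h5 := invNorm_le_of_decay hθ' hθθ hη hη ht (hU.meas_slice t) h4 h3
  rwa [← Real.rpow_add hη, sub_add_cancel, Real.rpow_one] at h5

end

/-! ### From mild solutions to jointly measurable nonnegative functions -/

section

variable {n : ℕ}

theorem expModular_le_one_of_lt {v : Rn n → ℝ} {lam : ℝ} (h : expL2Norm v < ENNReal.ofReal lam) :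
    expModular lam v ≤ 1 := by
  unfold expL2Norm at h
  simp only [iInf_lt_iff] at h
  obtain ⟨l, hl, hm, hlt⟩ := h
  have hll : l ≤ lam := by
    by_contra hcon
    exact absurd (ENNReal.ofReal_le_ofReal (not_le.1 hcon).le) (not_le.2 hlt)
  refine le_trans (lintegral_mono fun x => ENNReal.ofReal_le_ofReal ?_) hm
  have h1 : |v x| / lam ≤ |v x| / l := by gcongr
  have h2 : 0 ≤ |v x| / lam := div_nonneg (abs_nonneg _) (hl.le.trans hll)
  gcongr

theorem invNorm_half_le_of_expModular_le_one {v : Rn n → ℝ} {lam : ℝ} (hlam : 0 < lam)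
    (h : expModular lam v ≤ 1) :
    invNorm (1 / 2) (fun x => ENNReal.ofReal |v x|) ≤ ENNReal.ofReal lam := by
  have h1 : ∫⁻ x, ENNReal.ofReal |v x| ^ (1 / (1 / 2 : ℝ)) ≤ ENNReal.ofReal (lam ^ 2) := by
    calc ∫⁻ x, ENNReal.ofReal |v x| ^ (1 / (1 / 2 : ℝ))
        ≤ ∫⁻ x, ENNReal.ofReal (lam ^ 2) *
            ENNReal.ofReal (Real.exp ((|v x| / lam) ^ 2) - 1) := by
          refine lintegral_mono fun x => ?_
          dsimp only
          rw [ENNReal.ofReal_rpow_of_nonneg (abs_nonneg _) (by norm_num), one_div_one_div,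
            Real.rpow_two, ← ENNReal.ofReal_mul (by positivity)]
          refine ENNReal.ofReal_le_ofReal ?_
          have h2 := Real.add_one_le_exp ((|v x| / lam) ^ 2)
          calc |v x| ^ 2 = lam ^ 2 * (|v x| / lam) ^ 2 := by field_simp
            _ ≤ _ := by gcongr; linarith
      _ ≤ ENNReal.ofReal (lam ^ 2) * 1 := by
          rw [lintegral_const_mul' _ _ ENNReal.ofReal_ne_top]
          exact mul_le_mul' le_rfl h
      _ = _ := mul_one _
  unfold invNorm
  refine (ENNReal.rpow_le_rpow h1 (by norm_num)).trans (le_of_eq ?_)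
  rw [ENNReal.ofReal_rpow_of_pos (by positivity), ← Real.rpow_natCast, ← Real.rpow_mul hlam.le]
  norm_num

/-- The embedding of `exp L²` into `L^{1/θ}` for `0 < θ ≤ 1/2`. -/
theorem invNorm_le_expL2Norm {θ : ℝ} (hθ : 0 < θ) (h : θ ≤ 1 / 2) :
    ∃ C : ℝ, 0 < C ∧ ∀ {n : ℕ} {v : Rn n → ℝ},
      invNorm θ (fun x => ENNReal.ofReal |v x|) ≤ ENNReal.ofReal C * expL2Norm v := by
  obtain ⟨C, hC, hb⟩ := invNorm_rpow_mul_exp_le (a := 1) (c := 0) hθ (by linarith)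
  refine ⟨C, hC, fun {n v} => ?_⟩
  have hC0 : ENNReal.ofReal C ≠ 0 := by rw [Ne, ENNReal.ofReal_eq_zero, not_le]; exact hC
  rw [mul_comm, ← ENNReal.div_le_iff hC0 ENNReal.ofReal_ne_top]
  refine le_iInf fun l => le_iInf fun hl => le_iInf fun hm => ?_
  rw [ENNReal.div_le_iff hC0 ENNReal.ofReal_ne_top, mul_comm, ← ENNReal.ofReal_mul hC.le]
  have h1 := hb (n := n) (ε := l / 2) (f := fun x => ENNReal.ofReal |v x|) (by positivity) (by simp)
    (by
      simp only [ENNReal.toReal_ofReal (abs_nonneg _), mul_div_cancel₀ l (two_ne_zero' ℝ)]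
      exact hm)
  simp only [ENNReal.toReal_ofReal (abs_nonneg _), Real.rpow_one, zero_mul, Real.exp_zero,
    mul_one] at h1
  exact h1.trans (ENNReal.ofReal_le_ofReal (by gcongr; linarith))

/-- A family of functions that is continuous in time with values in `L²` has a version that is
jointly measurable in time and space: it is the limit of the functions that are constant on the
countably many pieces of time on which a member of a dense sequence is close. -/
theorem exists_measurable_version {u : ℝ → Rn n → ℝ}
    (hm : ∀ t, 0 < t → AEStronglyMeasurable (u t) volume)
    (hc : ∀ t, 0 < t →
      Tendsto (fun s => invNorm (1 / 2) (fun x => ENNReal.ofReal |u s x - u t x|)) (𝓝 t) (𝓝 0)) :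
    ∃ U : ℝ → Rn n → ℝ≥0∞, Measurable (Function.uncurry U) ∧ (∀ t x, U t x ≠ ∞) ∧
      ∀ t, 0 < t → ∀ᵐ x, U t x = ENNReal.ofReal (u t x) := by
  classical
  set D : ℝ → ℝ → ℝ≥0∞ := fun s t => invNorm (1 / 2) (fun x => ENNReal.ofReal |u s x - u t x|)
    with hD
  have hDsymm : ∀ s t, D s t = D t s := fun s t => by simp only [hD, abs_sub_comm]
  have hDm : ∀ s t, 0 < s → 0 < t → AEMeasurable fun x => ENNReal.ofReal |u s x - u t x| :=
    fun s t hs ht => ((hm s hs).sub (hm t ht)).norm.aemeasurable.ennreal_ofReal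
  have hDtri : ∀ r s t, 0 < r → 0 < s → 0 < t → D r t ≤ D r s + D s t := by
    intro r s t hr hs ht
    refine (invNorm_mono_ae (by norm_num) (Eventually.of_forall fun x => ?_)).trans
      (invNorm_add_le (by norm_num) (by norm_num) (hDm r s hr hs) (hDm s t hs ht))
    rw [← ENNReal.ofReal_add (abs_nonneg _) (abs_nonneg _)]
    exact ENNReal.ofReal_le_ofReal (abs_sub_le _ _ _)
  obtain ⟨r, hr⟩ := TopologicalSpace.exists_dense_seq (Set.Ioi (0 : ℝ))
  set e : ℕ → ℝ≥0∞ := fun k => ENNReal.ofReal ((1 / 2) ^ k) with he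
  have he0 : ∀ k, 0 < e k := fun k => ENNReal.ofReal_pos.2 (by positivity)
  set P : ℕ → ℝ → ℕ → Prop := fun k s j => 0 < s → D (r j) s < e k with hP
  have hex : ∀ k s, ∃ j, P k s j := by
    intro k s
    by_cases hs : 0 < s
    · have h1 : ∀ᶠ s' in 𝓝 s, D s' s < e k := (hc s hs).eventually_lt_const (he0 k)
      obtain ⟨ρ, hρ, hball⟩ := Metric.eventually_nhds_iff.1 h1
      obtain ⟨j, hj⟩ := hr.exists_dist_lt (⟨s, hs⟩ : Set.Ioi (0 : ℝ)) hρ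
      refine ⟨j, fun _ => hball ?_⟩
      rw [dist_comm]
      exact hj
    · exact ⟨0, fun h => absurd h hs⟩
  have hPm : ∀ k j, MeasurableSet {s | P k s j} := by
    intro k j
    have hopen : IsOpen {s | 0 < s ∧ D (r j) s < e k} := by
      rw [isOpen_iff_mem_nhds]
      rintro s ⟨hs, hlt⟩
      have h1 : Tendsto (fun s' => D (r j) s + D s' s) (𝓝 s) (𝓝 (D (r j) s + 0)) :=
        (hc s hs).const_add _
      rw [add_zero] at h1
      filter_upwards [h1.eventually_lt_const hlt, lt_mem_nhds hs] with s' h2 h3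
      refine ⟨h3, lt_of_le_of_lt (hDtri _ s s' (r j).2 hs h3) ?_⟩
      rwa [hDsymm s s']
    have : {s | P k s j} = Set.Iic 0 ∪ {s | 0 < s ∧ D (r j) s < e k} := by
      ext s
      simp only [hP, Set.mem_ofPred_eq, Set.mem_union, Set.mem_Iic]
      constructor
      · intro h
        by_cases hs : 0 < s
        · exact Or.inr ⟨hs, h hs⟩
        · exact Or.inl (not_lt.1 hs)
      · rintro (h | h) hs
        · exact absurd hs (not_lt.2 h)
        · exact h.2
    rw [this]
    exact measurableSet_Iic.union hopen.measurableSet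
  set N : ℕ → ℝ → ℕ := fun k s => Nat.find (hex k s) with hN
  have hNm : ∀ k, Measurable (N k) := fun k => measurable_find (hex k) (hPm k)
  set v : ℕ → Rn n → ℝ := fun j => (hm (r j) (r j).2).mk (u (r j)) with hv
  have hvm : ∀ j, Measurable (v j) := fun j => (hm (r j) (r j).2).stronglyMeasurable_mk.measurable
  have hve : ∀ j, ∀ᵐ x, u (r j) x = v j x := fun j => (hm (r j) (r j).2).ae_eq_mk
  set W : ℕ → ℝ → Rn n → ℝ := fun k s => v (N k s) with hW
  have hWm : ∀ k, Measurable fun p : ℝ × Rn n => W k p.1 p.2 := by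
    intro k
    have h1 : Measurable fun p : ℕ × Rn n => v p.1 p.2 :=
      measurable_from_prod_countable_right fun j => hvm j
    exact h1.comp (f := fun p : ℝ × Rn n => (N k p.1, p.2))
      (((hNm k).comp measurable_fst).prodMk measurable_snd)
  set L : ℝ → Rn n → ℝ≥0∞ := fun s x => limsup (fun k => ENNReal.ofReal (W k s x)) atTop with hL
  have hLm : Measurable (Function.uncurry L) :=
    Measurable.limsup (f := fun k (p : ℝ × Rn n) => ENNReal.ofReal (W k p.1 p.2))
      fun k => (hWm k).ennreal_ofReal
  refine ⟨fun s x => ENNReal.ofReal (L s x).toReal, hLm.ennreal_toReal.ennreal_ofReal,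
    fun t x => ENNReal.ofReal_ne_top, fun t ht => ?_⟩
  -- at each time the approximations converge fast in `L²`, hence almost everywhere
  have hclose : ∀ k, ∫⁻ x, ENNReal.ofReal |W k t x - u t x| ^ (2 : ℝ) ≤
      ENNReal.ofReal ((1 / 4) ^ k) := by
    intro k
    have h1 : D (r (N k t)) t < e k := Nat.find_spec (hex k t) ht
    have h2 : invNorm (1 / 2) (fun x => ENNReal.ofReal |W k t x - u t x|) ≤ e k := by
      refine le_trans (le_of_eq (invNorm_congr_ae ?_)) h1.le
      filter_upwards [hve (N k t)] with x hx
      rw [hx]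
    have h3 := invNorm_rpow_inv (θ := 1 / 2) (by norm_num)
      (fun x => ENNReal.ofReal |W k t x - u t x|)
    rw [one_div_one_div] at h3
    rw [← h3]
    refine (ENNReal.rpow_le_rpow h2 (by norm_num)).trans (le_of_eq ?_)
    rw [he, ENNReal.ofReal_rpow_of_pos (by positivity), Real.rpow_two, ← pow_mul, mul_comm k,
      pow_mul]
    norm_num
  have hmk : ∀ k, AEMeasurable fun x => ENNReal.ofReal |W k t x - u t x| ^ (2 : ℝ) := fun k =>
    ((hvm (N k t)).aestronglyMeasurable.sub (hm t ht)).norm.aemeasurable.ennreal_ofReal.pow_const _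
  have hsum : ∫⁻ x, ∑' k, ENNReal.ofReal |W k t x - u t x| ^ (2 : ℝ) ≠ ∞ := by
    rw [lintegral_tsum hmk]
    refine ne_top_of_le_ne_top ?_ (ENNReal.tsum_le_tsum hclose)
    rw [← ENNReal.ofReal_tsum_of_nonneg (fun k => by positivity)
      (summable_geometric_of_lt_one (by norm_num) (by norm_num))]
    exact ENNReal.ofReal_ne_top
  filter_upwards [ae_lt_top' (AEMeasurable.tsum hmk) hsum] with x hx
  have h1 : Tendsto (fun k => ENNReal.ofReal |W k t x - u t x| ^ (2 : ℝ)) atTop (𝓝 0) :=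
    ENNReal.tendsto_atTop_zero_of_tsum_ne_top hx.ne
  have h2 : Tendsto (fun k => ENNReal.ofReal |W k t x - u t x|) atTop (𝓝 0) := by
    have h3 := (ENNReal.continuous_rpow_const (y := 1 / 2)).tendsto 0 |>.comp h1
    rw [ENNReal.zero_rpow_of_pos (by norm_num)] at h3
    refine h3.congr fun k => ?_
    simp only [Function.comp]
    rw [← ENNReal.rpow_mul]
    norm_num
  have h4 : Tendsto (fun k => |W k t x - u t x|) atTop (𝓝 0) := by
    have h5 := (ENNReal.tendsto_toReal ENNReal.zero_ne_top).comp h2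
    simpa [Function.comp_def, ENNReal.toReal_ofReal (abs_nonneg _)] using h5
  have h6 : Tendsto (fun k => W k t x) atTop (𝓝 (u t x)) :=
    tendsto_iff_dist_tendsto_zero.2 h4
  have h7 : L t x = ENNReal.ofReal (u t x) := (ENNReal.tendsto_ofReal h6).limsup_eq
  rw [h7, ENNReal.ofReal_toReal ENNReal.ofReal_ne_top]

theorem ofReal_nonlin {v : ℝ} (hv : 0 ≤ v) :
    ENNReal.ofReal (nonlin n v) = potential n (ENNReal.ofReal v) * ENNReal.ofReal v := by
  unfold potential nonlin
  rw [← ENNReal.ofReal_mul (by positivity), ENNReal.toReal_ofReal hv, abs_of_nonneg hv]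
  congr 1; ring

theorem nonlin_nonneg {v : ℝ} (hv : 0 ≤ v) : 0 ≤ nonlin n v := by
  unfold nonlin; positivity

theorem ofReal_heat {t : ℝ} (ht : 0 ≤ t) {f : Rn n → ℝ} {F : Rn n → ℝ≥0∞} {x : Rn n}
    (hf : ∀ᵐ y, 0 ≤ f y) (hF : ∀ᵐ y, ENNReal.ofReal (f y) = F y)
    (hint : Integrable (fun y => heatKernel n t (x - y) * f y) volume) :
    ENNReal.ofReal (heat t f x) = heatOp t F x := by
  unfold heat heatOp
  rw [ofReal_integral_eq_lintegral_ofReal hint]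
  · refine lintegral_congr_ae ?_
    filter_upwards [hF] with y hy
    rw [ENNReal.ofReal_mul (heatKernel_nonneg ht _), hy]
  · filter_upwards [hf] with y hy
    exact mul_nonneg (heatKernel_nonneg ht _) hy

theorem heat_nonneg {t : ℝ} (ht : 0 ≤ t) {f : Rn n → ℝ} (hf : ∀ᵐ y, 0 ≤ f y) (x : Rn n) :
    0 ≤ heat t f x := by
  refine integral_nonneg_of_ae ?_
  filter_upwards [hf] with y hy
  exact mul_nonneg (heatKernel_nonneg ht _) hy

/-- A positive small solution gives a `SmallMild` pair `(Φ, U)`, the same for all `ε` above the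
`exp L²` norm of the data. -/
theorem exists_smallMild (hn : 1 ≤ n) {φ : Rn n → ℝ} {u : ℝ → Rn n → ℝ} (hφ : ∀ᵐ x, 0 ≤ φ x)
    (hφE : MemExpL2 φ) (hu : IsPositiveSmallSolution φ u) :
    ∃ (Φ : Rn n → ℝ≥0∞) (U : ℝ → Rn n → ℝ≥0∞), (∀ᵐ x, Φ x = ENNReal.ofReal (φ x)) ∧
      (∀ t, 0 < t → ∀ᵐ x, U t x = ENNReal.ofReal (u t x)) ∧
      ∀ ε : ℝ, expL2Norm φ < ENNReal.ofReal ε → SmallMild n ε Φ U := by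
  have hφm : AEStronglyMeasurable φ volume := hφE.1.aestronglyMeasurable
  have hum : ∀ t, 0 < t → AEStronglyMeasurable (u t) volume := fun t ht =>
    (hu.solution.mem t ht).1.aestronglyMeasurable
  have hcont : ∀ θ : ℝ, 0 < θ → θ ≤ 1 / 2 → ∀ t, 0 < t →
      Tendsto (fun s => invNorm θ (fun x => ENNReal.ofReal |u s x - u t x|)) (𝓝 t) (𝓝 0) := by
    intro θ hθ hθ2 t ht
    obtain ⟨C, hC, h⟩ := invNorm_le_expL2Norm hθ hθ2
    have h1 := ENNReal.Tendsto.const_mul (a := ENNReal.ofReal C) (hu.solution.continuous t ht)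
      (Or.inr ENNReal.ofReal_ne_top)
    rw [mul_zero] at h1
    exact tendsto_of_tendsto_of_tendsto_of_le_of_le tendsto_const_nhds h1 (fun s => zero_le)
      (fun s => h (v := fun x => u s x - u t x))
  obtain ⟨U, hUm, hUt, hUu⟩ := exists_measurable_version hum (hcont (1 / 2) (by norm_num) le_rfl)
  set Φ : Rn n → ℝ≥0∞ := fun x => ENNReal.ofReal (hφm.mk φ x) with hΦ
  have hΦm : Measurable Φ := hφm.stronglyMeasurable_mk.measurable.ennreal_ofReal
  have hΦφ : ∀ᵐ x, Φ x = ENNReal.ofReal (φ x) := by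
    filter_upwards [hφm.ae_eq_mk] with x hx
    rw [hΦ, hx]
  have hinit : ∀ ε : ℝ, expL2Norm φ < ENNReal.ofReal ε → invNorm (1 / 2) Φ ≤ ENNReal.ofReal ε := by
    intro ε hε
    have hε0 : 0 < ε := ENNReal.ofReal_pos.1 (zero_le.trans_lt hε)
    refine le_trans (le_of_eq (invNorm_congr_ae ?_))
      (invNorm_half_le_of_expModular_le_one hε0 (expModular_le_one_of_lt hε))
    filter_upwards [hΦφ, hφ] with x hx hx0
    rw [hx, abs_of_nonneg hx0]
  refine ⟨Φ, U, hΦφ, hUu, fun ε hε => ?_⟩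
  have hε0 : 0 < ε := ENNReal.ofReal_pos.1 (zero_le.trans_lt hε)
  refine ⟨hε0, hΦm, hinit ε hε, hUm, hUt, fun t ht => ?_, fun t ht => ?_, fun T hT η hη => ?_⟩
  · filter_upwards [hUu t ht, hu.solution.duhamel t ht] with x hx hd
    obtain ⟨hd1, hd2, hd3⟩ := hd
    have hheat0 := heat_nonneg ht.le hφ x
    have hsrc0 : ∀ s ∈ Set.Ioo 0 t, 0 ≤ heat (t - s) (fun y => nonlin n (u s y)) x := by
      intro s hs
      refine heat_nonneg (by linarith [hs.2]) ?_ x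
      filter_upwards [hu.nonneg s hs.1] with y hy
      exact nonlin_nonneg hy
    have hsrc0' : ∀ᵐ s ∂(volume.restrict (Set.Ioo 0 t)),
        0 ≤ heat (t - s) (fun y => nonlin n (u s y)) x := by
      filter_upwards [ae_restrict_mem measurableSet_Ioo] with s hs using hsrc0 s hs
    rw [hx, hd3, ENNReal.ofReal_add hheat0 (integral_nonneg_of_ae hsrc0')]
    congr 1
    · refine ofReal_heat ht.le hφ (hΦφ.mono fun y hy => hy.symm) ?_
      -- the linear part converges absolutely because the data lie in `L²`
      refine ⟨((measurable_heatKernel.comp (f := fun y : Rn n => (t, x - y))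
        (by fun_prop)).aestronglyMeasurable).mul hφm, ?_⟩
      have h1 : ∫⁻ y, ‖heatKernel n t (x - y) * φ y‖ₑ = heatOp t Φ x := by
        refine lintegral_congr_ae ?_
        filter_upwards [hΦφ, hφ] with y hy hy0
        rw [hy, ← ENNReal.ofReal_mul (heatKernel_nonneg ht.le _),
          Real.enorm_of_nonneg (mul_nonneg (heatKernel_nonneg ht.le _) hy0)]
      rw [hasFiniteIntegral_iff_enorm, h1]
      refine lt_of_le_of_lt (heatOp_le ht (θ := 1 / 2) (by norm_num) (by norm_num) hΦm x) ?_
      exact ENNReal.mul_lt_top ENNReal.ofReal_lt_top ((hinit ε hε).trans_lt ENNReal.ofReal_lt_top)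
    · rw [ofReal_integral_eq_lintegral_ofReal hd2 hsrc0']
      refine lintegral_congr_ae ?_
      filter_upwards [hd1, ae_restrict_mem measurableSet_Ioo] with s hs1 hs
      refine ofReal_heat (by linarith [hs.2]) ?_ ?_ hs1
      · filter_upwards [hu.nonneg s hs.1] with y hy
        exact nonlin_nonneg hy
      · filter_upwards [hu.nonneg s hs.1, hUu s hs.1] with y hy hy2
        rw [ofReal_nonlin hy, hy2]
  · have h2 : expL2Norm (u t) < ENNReal.ofReal (2 * ε) := by
      refine (hu.bound t ht).trans_lt ?_
      rw [ENNReal.ofReal_mul (by norm_num), ENNReal.ofReal_ofNat]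
      exact (ENNReal.mul_lt_mul_iff_right (by norm_num) (by norm_num)).2 hε
    refine le_trans (le_of_eq (lintegral_congr_ae ?_)) (expModular_le_one_of_lt h2)
    filter_upwards [hUu t ht, hu.nonneg t ht] with x hx hx0
    rw [hx, ENNReal.toReal_ofReal hx0, abs_of_nonneg hx0]
  · have hk := katoExp_pos hn
    have hk2 := katoExp_lt n
    filter_upwards [(hcont (katoExp n) hk hk2.le T hT).eventually_le_const
      (ENNReal.ofReal_pos.2 hη), lt_mem_nhds hT] with s hs hs0
    refine (invNorm_mono_ae hk (g := fun x => U T x + ENNReal.ofReal |u s x - u T x|) ?_).trans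
      ((invNorm_add_le hk (by linarith) (measurable_slice hUm T).aemeasurable
        ((hum s hs0).sub (hum T hT)).norm.aemeasurable.ennreal_ofReal).trans
        (add_le_add le_rfl hs))
    filter_upwards [hUu s hs0, hUu T hT, hu.nonneg T hT] with x h1 h2 h3
    rw [h1, h2, ← ENNReal.ofReal_add h3 (abs_nonneg _)]
    refine ENNReal.ofReal_le_ofReal ?_
    linarith [le_abs_self (u s x - u T x)]

end

/-! ### The decay theorem -/

section

variable {n : ℕ}

theorem eLpNorm_eq_invNorm {f : Rn n → ℝ} {F : Rn n → ℝ≥0∞} (h0 : ∀ᵐ x, 0 ≤ f x)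
    (h : ∀ᵐ x, F x = ENNReal.ofReal (f x)) {q : ℝ≥0∞} (hq0 : q ≠ 0) (hqt : q ≠ ∞) :
    eLpNorm f q volume = invNorm (q⁻¹).toReal F := by
  rw [eLpNorm_eq_lintegral_rpow_enorm_toReal hq0 hqt]
  unfold invNorm
  rw [ENNReal.toReal_inv, one_div, one_div, inv_inv]
  congr 1
  refine lintegral_congr_ae ?_
  filter_upwards [h, h0] with x hx hx0
  rw [hx, Real.enorm_of_nonneg hx0]

/-- A bound that is linear in every `ε` above `N` holds with `N` itself. -/
theorem le_mul_of_forall_lt {N X : ℝ≥0∞} {c δ : ℝ} (hc : 0 ≤ c) (hN : N < ENNReal.ofReal δ)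
    (h : ∀ ε : ℝ, N < ENNReal.ofReal ε → ε ≤ δ → X ≤ ENNReal.ofReal (c * ε)) :
    X ≤ ENNReal.ofReal c * N := by
  have hNt : N ≠ ∞ := hN.ne_top
  have hNδ : N.toReal < δ := (ENNReal.lt_ofReal_iff_toReal_lt hNt).1 hN
  have h1 : Tendsto (fun ε : ℝ => ENNReal.ofReal (c * ε)) (𝓝[>] N.toReal)
      (𝓝 (ENNReal.ofReal (c * N.toReal))) := by
    refine (ENNReal.continuous_ofReal.tendsto _).comp ?_
    exact ((continuous_const.mul continuous_id).tendsto N.toReal).mono_left nhdsWithin_le_nhds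
  have h2 : X ≤ ENNReal.ofReal (c * N.toReal) := by
    refine ge_of_tendsto h1 ?_
    filter_upwards [Ioo_mem_nhdsGT hNδ] with ε hε
    exact h ε ((ENNReal.lt_ofReal_iff_toReal_lt hNt).2 hε.1) hε.2.le
  rwa [ENNReal.ofReal_mul hc, ENNReal.ofReal_toReal hNt] at h2

end

end ExpHeat

theorem theorem2p4 (n : ℕ) (hn : 1 ≤ n) :
    ∃ δ : ℝ, 0 < δ ∧ ∃ C : ℝ, 0 < C ∧ ∃ C' : ℝ≥0∞ → ℝ,
      ∀ p : ℝ, 1 ≤ p → p < 2 →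
      ∀ (φ : ExpHeat.Rn n → ℝ) (u : ℝ → ExpHeat.Rn n → ℝ),
        (∀ᵐ x, 0 ≤ φ x) →
        ExpHeat.MemExpL2 φ →
        MemLp φ (ENNReal.ofReal p) volume →
        ExpHeat.IsUniquePositiveSmallSolution φ u →
        max (ExpHeat.expL2Norm φ) (eLpNorm φ (ENNReal.ofReal p) volume) < ENNReal.ofReal δ →
        (∀ q : ℝ≥0∞, ENNReal.ofReal p ≤ q → ∀ t : ℝ, 0 < t →
          eLpNorm (u t) q volume ≤
            ENNReal.ofReal (C * t ^ (-ExpHeat.decayExp n p q)) * ExpHeat.interNorm p φ) ∧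
        (∀ q : ℝ≥0∞, ENNReal.ofReal p ≤ q → q < ∞ → ∀ t : ℝ, 0 < t →
          eLpNorm (u t) q volume ≤
            ENNReal.ofReal (C' q * (1 + t) ^ (-ExpHeat.decayExp n p q)) *
              ExpHeat.interNorm p φ) ∧
        (1 < p → ∀ q : ℝ≥0∞, ENNReal.ofReal p ≤ q →
          (fun t : ℝ => (eLpNorm (u t) q volume).toReal) =o[atTop]
            (fun t : ℝ => t ^ (-ExpHeat.decayExp n p q))) := by
  open ExpHeat in
  obtain ⟨δ₁, hδ₁, C₁, hC₁, hdecay⟩ := SmallMild.invNorm_decay hn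
  obtain ⟨δ₂, hδ₂, C₂, hC₂, hsup⟩ := SmallMild.sup_le hn
  obtain ⟨δ₃, hδ₃, hone⟩ := SmallMild.invNorm_decay_one_add hn
  obtain ⟨δ₄, hδ₄, hev⟩ := SmallMild.eventually_invNorm_decay hn
  obtain ⟨δ₅, hδ₅, hevsup⟩ := SmallMild.eventually_sup_le hn
  choose! K hK0 hK using hone
  refine ⟨min (min δ₁ δ₂) (min δ₃ (min δ₄ δ₅)), by positivity, C₁ + C₂, by positivity,
    fun q => K (q⁻¹).toReal, fun p hp1 hp2 φ u hφ hφE hφp hu hsmall => ?_⟩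
  set δ := min (min δ₁ δ₂) (min δ₃ (min δ₄ δ₅)) with hδ
  have hd1 : δ ≤ δ₁ := (min_le_left _ _).trans (min_le_left _ _)
  have hd2 : δ ≤ δ₂ := (min_le_left _ _).trans (min_le_right _ _)
  have hd3 : δ ≤ δ₃ := (min_le_right _ _).trans (min_le_left _ _)
  have hd4 : δ ≤ δ₄ := (min_le_right _ _).trans ((min_le_right _ _).trans (min_le_left _ _))
  have hd5 : δ ≤ δ₅ := (min_le_right _ _).trans ((min_le_right _ _).trans (min_le_right _ _))
  obtain ⟨Φ, U, hΦ, hU, hS⟩ := exists_smallMild hn hφ hφE hu.positive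
  have hp0 : 0 < p := by linarith
  set θ : ℝ := 1 / p with hθ
  have hθ2 : 1 / 2 < θ := one_div_lt_one_div_of_lt hp0 hp2
  have hθ1 : θ ≤ 1 := (div_le_one hp0).2 hp1
  have hθ0 : 0 < θ := by linarith
  have hpθ : ((ENNReal.ofReal p)⁻¹).toReal = θ := by
    rw [ENNReal.toReal_inv, ENNReal.toReal_ofReal hp0.le, hθ, one_div]
  have hΦnorm : eLpNorm φ (ENNReal.ofReal p) volume = invNorm θ Φ := by
    rw [eLpNorm_eq_invNorm hφ hΦ (ENNReal.ofReal_pos.2 hp0).ne' ENNReal.ofReal_ne_top, hpθ]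
  have hSε : ∀ ε : ℝ, interNorm p φ < ENNReal.ofReal ε →
      SmallMild n ε Φ U ∧ invNorm θ Φ ≤ ENNReal.ofReal ε := by
    intro ε hε
    refine ⟨hS ε ((le_max_left _ _).trans_lt hε), ?_⟩
    rw [← hΦnorm]
    exact (le_max_right _ _).trans hε.le
  have hq0 : ∀ q : ℝ≥0∞, ENNReal.ofReal p ≤ q → q ≠ 0 := fun q hq =>
    ((ENNReal.ofReal_pos.2 hp0).trans_le hq).ne'
  have hqle : ∀ q : ℝ≥0∞, ENNReal.ofReal p ≤ q → (q⁻¹).toReal ≤ θ := by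
    intro q hq
    rw [← hpθ]
    exact ENNReal.toReal_mono (ENNReal.inv_ne_top.2 (ENNReal.ofReal_pos.2 hp0).ne')
      (ENNReal.inv_le_inv.2 hq)
  have hqpos : ∀ q : ℝ≥0∞, ENNReal.ofReal p ≤ q → q ≠ ∞ → 0 < (q⁻¹).toReal := fun q hq hqt =>
    ENNReal.toReal_pos (ENNReal.inv_ne_zero.2 hqt) (ENNReal.inv_ne_top.2 (hq0 q hq))
  have hnorm : ∀ q : ℝ≥0∞, ENNReal.ofReal p ≤ q → q ≠ ∞ → ∀ t, 0 < t →
      eLpNorm (u t) q volume = invNorm (q⁻¹).toReal (U t) := fun q hq hqt t ht =>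
    eLpNorm_eq_invNorm (hu.positive.nonneg t ht) (hU t ht) (hq0 q hq) hqt
  have htop : ∀ t c, 0 < t → (∀ᵐ x, U t x ≤ ENNReal.ofReal c) →
      eLpNorm (u t) ∞ volume ≤ ENNReal.ofReal c := by
    intro t c ht h
    rw [eLpNorm_exponent_top]
    refine eLpNormEssSup_le_of_ae_enorm_bound ?_
    filter_upwards [h, hU t ht, hu.positive.nonneg t ht] with x h1 h2 h3
    rw [Real.enorm_of_nonneg h3, ← h2]
    exact h1
  have hexp_top : decayExp n p ∞ = (n : ℝ) / 2 * θ := by simp [decayExp, hθ]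
  have hexp : ∀ q, decayExp n p q = (n : ℝ) / 2 * (θ - (q⁻¹).toReal) := fun q => rfl
  refine ⟨fun q hq t ht => ?_, fun q hq hqt t ht => ?_, fun hp q hq => ?_⟩
  · refine le_mul_of_forall_lt (by positivity) hsmall fun ε hε hεδ => ?_
    obtain ⟨hSm, hΦε⟩ := hSε ε hε
    have hε0 := hSm.pos
    have ht' : 0 < t ^ (-decayExp n p q) := Real.rpow_pos_of_pos ht _
    by_cases hqt : q = ∞
    · subst hqt
      refine (htop t _ ht (hsup hSm (hεδ.trans hd2) θ hθ2.le hθ1 hΦε t ht)).trans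
        (ENNReal.ofReal_le_ofReal ?_)
      rw [← hexp_top, mul_right_comm]
      gcongr
      linarith
    · rw [hnorm q hq hqt t ht]
      refine (hdecay hSm (hεδ.trans hd1) θ _ hθ2.le hθ1 (hqpos q hq hqt) (hqle q hq) hΦε t ht).trans
        (ENNReal.ofReal_le_ofReal ?_)
      rw [← hexp, mul_right_comm]
      gcongr
      linarith
  · have hθ' := hqpos q hq hqt.ne
    have ht' : 0 < (1 + t) ^ (-decayExp n p q) := Real.rpow_pos_of_pos (by linarith) _
    refine le_mul_of_forall_lt (mul_nonneg (hK0 _ hθ').le ht'.le) hsmall fun ε hε hεδ => ?_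
    obtain ⟨hSm, hΦε⟩ := hSε ε hε
    rw [hnorm q hq hqt.ne t ht, mul_right_comm, hexp]
    exact hK _ hθ' hSm (hεδ.trans hd3) θ hθ2.le hθ1 (hqle q hq) hΦε t ht
  · obtain ⟨hSm, hΦε⟩ := hSε δ hsmall
    have hθlt : θ < 1 := (div_lt_one hp0).2 hp
    rw [isLittleO_iff]
    intro η hη
    have hbound : ∀ᶠ t : ℝ in atTop, eLpNorm (u t) q volume ≤
        ENNReal.ofReal (η * t ^ (-decayExp n p q)) := by
      by_cases hqt : q = ∞
      · subst hqt
        filter_upwards [hevsup hSm hd5 θ hθ2 hθlt hΦε η hη, eventually_gt_atTop 0] with t h ht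
        rw [hexp_top]
        exact htop t _ ht h
      · filter_upwards [hev hSm hd4 θ _ hθ2 hθlt (hqpos q hq hqt) (hqle q hq) hΦε η hη,
          eventually_gt_atTop 0] with t h ht
        rw [hnorm q hq hqt t ht, hexp]
        exact h
    filter_upwards [hbound, eventually_gt_atTop 0] with t h ht
    have ht' : 0 < t ^ (-decayExp n p q) := Real.rpow_pos_of_pos ht _
    rw [Real.norm_of_nonneg ENNReal.toReal_nonneg, Real.norm_of_nonneg ht'.le]
    exact ENNReal.toReal_le_of_le_ofReal (by positivity) h
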